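/- Let $D=\{1,\dots,k\}$ and $D'=\{0,1,\dots,k\}$. On $D'$ let $\sqcap,\sqcup$ be the symmetric, idempotent operations with $0\sqcap a=0$, $0\sqcup a=a$, and $a\sqcap b=a\sqcup b=0$ for distinct $a,b\in D$; a function $f$ on $D'^r$ is $k$-submodular if $f(x)+f(y)\ge f(x\sqcap y)+f(x\sqcup y)$ for all $x,y$. A binary basic $k$-submodular function is one of the following functions of at most two variables: (i) a unary $k$-submodular function $D'\to\{0,\frac12,1,\frac32,\dots\}$ (in particular the relaxations of a cost function $g:D\to\mathbb N$ by the value $\min g$, or by half the sum of the two smallest values of $g$, at $0$); (ii) for a permutation $\pi$ of $D$, the relaxation of the soft constraint $x=\pi(y)$: for $x,y\in D$ its value is $0$ if $x=\pi(y)$ and $1$ otherwise; its value is $0$ at $(0,0)$, and $\frac12$ if exactly one argument is $0$; (iii) for $d,d'\in D$, the relaxation of the soft constraint $x=d\vee y=d'$: its value is $0$ if $x=d$ or $y=d'$ or $x=y=0$; otherwise it is $\frac12$ if one of $x,y$ is $0$, and $1$ if neither is. Let $X$ be a finite set of variables and let $f':D'^X\to\frac12\mathbb N$ be a sum of $m$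 binary basic $k$-submodular functions of variables in $X$ (in particular, $f'$ may take values in $\mathbb N$). A minimum solution $x\in D'^X$ of $f'$ is extreme if there is no minimum solution $y\ne x$ of $f'$ such that $x_i\neq 0\Rightarrow x_i=y_i$ for all $i\in X$. **Theorem.** There is an algorithm (one program for a random access machine whose operations on natural numbers are addition, subtraction, comparison and indirect addressing, at unit cost) which, given $k$, $X=\{0,\dots,n-1\}$ and the list of the $m$ summands (scopes, permutations, constants, and value tables of the unary functions), computes an extreme minimum solution of $f'$ in $$O\bigl(\max(1,\min f')\cdot k\cdot m+|X|+1\bigr)$$ time, with an absolute constant in the $O$. In particular, if $m,k\ge1$ and every variable of $X$ occurs in some summand, the time is $O(\max(1,\min f')\cdot k\cdot m)$, which is $O((\min f')\cdot k\cdot m)$ when $\min f'\ge 1$. -/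

import Mathlib

/-! ### `k`-submodular functions on `D' = {0, 1, …, k}`

`D'` is `Fin (k + 1)` with the relaxed value `0`; the original domain `D = {1, …, k}` consists of the
values `d.succ` with `d : Fin k`. Assignments of the variables `X = Fin n` are maps
`Fin n → Fin (k + 1)`. -/

/-- The operation `⊓` on `D'`: idempotent, and `0` on any two distinct values. -/
def kMeet {k : ℕ} (a b : Fin (k + 1)) : Fin (k + 1) :=
  if a = b then a else 0

/-- The operation `⊔` on `D'`: idempotent, `0` is neutral, and two distinct non-zero values give `0`. -/
def kJoin {k : ℕ} (a b : Fin (k + 1)) : Fin (k + 1) :=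
  if a = 0 then b else if b = 0 then a else if a = b then a else 0

/-- `k`-submodularity of a function of the variables `ι`. -/
def IsKSubmodular {k : ℕ} {ι : Type} (f : (ι → Fin (k + 1)) → ℚ) : Prop :=
  ∀ x y : ι → Fin (k + 1),
    f (fun i => kMeet (x i) (y i)) + f (fun i => kJoin (x i) (y i)) ≤ f x + f y

/-- The basic relaxation of the soft version of the constraint `x = π(y)`. -/
def permCost {k : ℕ} (π : Equiv.Perm (Fin k)) (x y : Fin (k + 1)) : ℚ :=
  if x = 0 ∧ y = 0 then 0
  else if x = 0 ∨ y = 0 then 1 / 2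
  else if ∃ j : Fin k, y = j.succ ∧ x = (π j).succ then 0
  else 1

/-- The basic relaxation of the soft version of the constraint `x = d ∨ y = d'`. -/
def orCost {k : ℕ} (d d' : Fin k) (x y : Fin (k + 1)) : ℚ :=
  if x = d.succ ∨ y = d'.succ then 0
  else if x = 0 ∧ y = 0 then 0
  else if x = 0 ∨ y = 0 then 1 / 2
  else 1

/-- A basic `k`-submodular function of at most two of the variables `Fin n`, with its scope.
* `unary v h` is the function `h (φ v) / 2`: any `k`-submodular function of one variable with values in
  `{0, 1/2, 1, …}`, given by its doubled values. It covers both relaxations of a cost function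
  `g : D → ℕ`, the one with value `min g` at `0` and the one with value `(g d₁ + g d₂) / 2` at `0`,
  where `d₁`, `d₂` are the cheapest and the second cheapest element of `D`.
* `perm x y π` is the relaxation of the soft constraint `x = π(y)`
  (for `π = 1`: of the soft equality `x = y`).
* `or x d y d'` is the relaxation of the soft constraint `x = d ∨ y = d'`. -/
inductive BasicFn (k n : ℕ) : Type
  | unary (v : Fin n) (h : Fin (k + 1) → ℕ)
      (hsub : IsKSubmodular fun x : Fin 1 → Fin (k + 1) => (h (x 0) : ℚ) / 2) : BasicFn k n
  | perm (x y : Fin n) (π : Equiv.Perm (Fin k)) : BasicFn k n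
  | or (x : Fin n) (d : Fin k) (y : Fin n) (d' : Fin k) : BasicFn k n

/-- The value of a basic function at an assignment. -/
def BasicFn.eval {k n : ℕ} : BasicFn k n → (Fin n → Fin (k + 1)) → ℚ
  | .unary v h _, φ => (h (φ v) : ℚ) / 2
  | .perm x y π, φ => permCost π (φ x) (φ y)
  | .or x d y d', φ => orCost d d' (φ x) (φ y)

/-- The sum of a list of basic functions. -/
def sumFn {k n : ℕ} (I : List (BasicFn k n)) (φ : Fin n → Fin (k + 1)) : ℚ :=
  (I.map fun g => g.eval φ).sum

/-- The minimum of a function over all assignments. -/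
def minVal {k n : ℕ} (f : (Fin n → Fin (k + 1)) → ℚ) : ℚ :=
  Finset.univ.inf' Finset.univ_nonempty f

/-- `x` is a minimum solution of `f`. -/
def IsMinSol {k n : ℕ} (f : (Fin n → Fin (k + 1)) → ℚ) (x : Fin n → Fin (k + 1)) : Prop :=
  ∀ y, f x ≤ f y

/-- `x` is dominated by `y`. -/
def DominatedBy {k n : ℕ} (x y : Fin n → Fin (k + 1)) : Prop :=
  x ≠ y ∧ ∀ i, x i ≠ 0 → x i = y i

/-- `x` is an extreme minimum solution of `f`: no minimum solution dominates it. -/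
def IsExtremeMinSol {k n : ℕ} (f : (Fin n → Fin (k + 1)) → ℚ) (x : Fin n → Fin (k + 1)) : Prop :=
  IsMinSol f x ∧ ¬ ∃ y, IsMinSol f y ∧ DominatedBy x y

/-! ### The machine model

A random access machine with structured control flow: finitely many registers and arrays of natural
numbers (a program names only finitely many), indirect addressing, addition, truncated subtraction and
comparison. Every elementary operation, memory access, test and assignment costs one step. -/

/-- The memory: `var x` is the content of register `x`, and `arr a i` is cell `i` of array `a`. -/
structure RamState where
  var : ℕ → ℕ
  arr : ℕ → ℕ → ℕ

/-- Expressions; `get a e` reads the cell of array `a` whose index is the value of `e`. -/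
inductive RamExpr : Type
  | const (c : ℕ) : RamExpr
  | var (x : ℕ) : RamExpr
  | get (a : ℕ) (e : RamExpr) : RamExpr
  | add (e₁ e₂ : RamExpr) : RamExpr
  | sub (e₁ e₂ : RamExpr) : RamExpr
  | lt (e₁ e₂ : RamExpr) : RamExpr
  | eq (e₁ e₂ : RamExpr) : RamExpr

/-- The value of an expression; comparisons yield `1` (true) or `0` (false). -/
def RamExpr.eval (s : RamState) : RamExpr → ℕ
  | .const c => c
  | .var x => s.var x
  | .get a e => s.arr a (e.eval s)
  | .add e₁ e₂ => e₁.eval s + e₂.eval s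
  | .sub e₁ e₂ => e₁.eval s - e₂.eval s
  | .lt e₁ e₂ => if e₁.eval s < e₂.eval s then 1 else 0
  | .eq e₁ e₂ => if e₁.eval s = e₂.eval s then 1 else 0

/-- The number of steps for evaluating an expression. -/
def RamExpr.cost : RamExpr → ℕ
  | .const _ => 1
  | .var _ => 1
  | .get _ e => e.cost + 1
  | .add e₁ e₂ => e₁.cost + e₂.cost + 1
  | .sub e₁ e₂ => e₁.cost + e₂.cost + 1
  | .lt e₁ e₂ => e₁.cost + e₂.cost + 1
  | .eq e₁ e₂ => e₁.cost + e₂.cost + 1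

/-- Programs. -/
inductive RamProg : Type
  | skip : RamProg
  | assign (x : ℕ) (e : RamExpr) : RamProg
  | store (a : ℕ) (i e : RamExpr) : RamProg
  | seq (p q : RamProg) : RamProg
  | ite (e : RamExpr) (p q : RamProg) : RamProg
  | while (e : RamExpr) (p : RamProg) : RamProg

/-- `RamExec p s t s'`: program `p`, started in memory `s`, halts after exactly `t` steps in
memory `s'`. -/
inductive RamExec : RamProg → RamState → ℕ → RamState → Prop
  | skip (s : RamState) : RamExec .skip s 1 s
  | assign (x : ℕ) (e : RamExpr) (s : RamState) :
      RamExec (.assign x e) s (e.cost + 1) ⟨Function.update s.var x (e.eval s), s.arr⟩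
  | store (a : ℕ) (i e : RamExpr) (s : RamState) :
      RamExec (.store a i e) s (i.cost + e.cost + 1)
        ⟨s.var, Function.update s.arr a (Function.update (s.arr a) (i.eval s) (e.eval s))⟩
  | seq {p q : RamProg} {s s' s'' : RamState} {t t' : ℕ}
      (hp : RamExec p s t s') (hq : RamExec q s' t' s'') : RamExec (.seq p q) s (t + t') s''
  | iteTrue {e : RamExpr} {p q : RamProg} {s s' : RamState} {t : ℕ}
      (he : e.eval s ≠ 0) (hp : RamExec p s t s') : RamExec (.ite e p q) s (e.cost + 1 + t) s'
  | iteFalse {e : RamExpr} {p q : RamProg} {s s' : RamState} {t : ℕ}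
      (he : e.eval s = 0) (hq : RamExec q s t s') : RamExec (.ite e p q) s (e.cost + 1 + t) s'
  | whileTrue {e : RamExpr} {p : RamProg} {s s' s'' : RamState} {t t' : ℕ}
      (he : e.eval s ≠ 0) (hp : RamExec p s t s') (hw : RamExec (.while e p) s' t' s'') :
      RamExec (.while e p) s (e.cost + 1 + t + t') s''
  | whileFalse {e : RamExpr} {p : RamProg} {s : RamState}
      (he : e.eval s = 0) : RamExec (.while e p) s (e.cost + 1) s

/-! ### Input and output -/

/-- A basic function as a list of numbers: a tag, then the scope and the data of the function.
Values in `D'` are written as the numbers `0, …, k`. -/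
def BasicFn.encode {k n : ℕ} : BasicFn k n → List ℕ
  | .unary v h _ => [0, v.val] ++ List.ofFn h
  | .perm x y π => [1, x.val, y.val] ++ List.ofFn fun j => (π j).succ.val
  | .or x d y d' => [2, x.val, d.succ.val, y.val, d'.succ.val]

/-- The initial memory: registers `0`, `1`, `2` hold `k`, the number `n` of variables and the number of
summands, array `0` holds the encoded summands one after another, and everything else is `0`. -/
def initState {k n : ℕ} (I : List (BasicFn k n)) : RamState where
  var x := if x = 0 then k else if x = 1 then n else if x = 2 then I.length else 0
  arr a i := if a = 0 then (I.flatMap BasicFn.encode).getD i 0 else 0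

/-- The memory holds the assignment `φ` in array `1`. -/
def Outputs {k n : ℕ} (s : RamState) (φ : Fin n → Fin (k + 1)) : Prop :=
  ∀ v : Fin n, s.arr 1 v.val = (φ v).val

/-!
Extreme minimum solutions by augmenting paths.

Twice the function is represented by a network with a node for each variable `v` and each value `a ≠ 0`
(`node`), in which an assignment `φ` corresponds to the cut whose source side is
`nodeSet φ = {(v, φ v) | φ v ≠ 0}`. A permutation constraint gives `k` pairs of opposite unit edges, a
disjunction `2 k` unit edges (two of them with capacity `0`), and a unary function gives capacities from the
source and to the sink. Up to a constant `≥ 0`, the value of a cut of the form `nodeSet φ` is twice the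
function (`BasicFn.cutVal_nodeSet`), and an arbitrary cut is not smaller than the cut of the assignment
in which variables with several values get `0` (`BasicFn.eval_le_cutVal`). So the minimum
capacity of a cut and the minimum of the function correspond; the amount of flow sent is at most twice the minimum
(`Represents.le_two_mul_sumFn`), and when the flow is maximum, the minimum solutions are exactly the
assignments with a closed `nodeSet φ`: it contains the nodes adjacent to the source, none adjacent to the
sink, and no residual arc leaves it (`Represents.isMinSol_iff`). Each augmentation is a depth-first search in
time `O(k m)`, so that a maximum flow takes `O((min f' + 1) k m)` steps (`run_augmentProg`). Only the invariance
of cuts under augmentation is used; a flow itself is never mentioned.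

From the residual network, an extreme minimum solution is found in time `O(k m)` (`run_secondProg`). The
smallest closed set, of the nodes reachable from the source, has the form `nodeSet φ`
(`Represents.exists_nodeSet_eq`). The strong components of the other nodes are then considered, each after
those that can be reached from it: a postorder of the reversed network is computed, and by `reach_back` a
search from the last unsettled node in this order finds exactly one component. If the component has two values of a variable, or a value of a variable that has another value already, or an arc
to a rejected component, then no closed set extending the present one contains its nodes, and it is
rejected; otherwise its nodes are assigned (`Assigned.reject`, `Assigned.accept`). When all nodes are settled,
no minimum solution dominates the one found. Rejected components are marked as adjacent to the sink, which
lets all searches be the same program. Variables without nodes get the value `1`.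

Programs are treated with a small calculus of executions, `Run P s Q`, in which the postcondition `Q`
speaks of the number of steps and the final memory. The time of the searches is bounded by the potential
`arcsLeft`, the number of arcs not yet passed.
-/

/-! ### Executions of programs -/

/-- `Run P s Q`: the program `P` started in `s` halts, and the number of steps and the final memory
satisfy `Q`. -/
def Run (P : RamProg) (s : RamState) (Q : ℕ → RamState → Prop) : Prop :=
  ∃ t s', RamExec P s t s' ∧ Q t s'

theorem Run.mono {P : RamProg} {s : RamState} {Q Q' : ℕ → RamState → Prop}
    (h : Run P s Q) (hQ : ∀ t s', Q t s' → Q' t s') : Run P s Q' := by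
  obtain ⟨t, s', h, h'⟩ := h
  exact ⟨t, s', h, hQ _ _ h'⟩

theorem Run.seq {p q : RamProg} {s : RamState} {Q : ℕ → RamState → Prop}
    (h : Run p s fun t s' => Run q s' fun t' s'' => Q (t + t') s'') : Run (.seq p q) s Q := by
  obtain ⟨t, s', h, t', s'', h', hQ⟩ := h
  exact ⟨_, _, .seq h h', hQ⟩

theorem Run.iteTrue {e : RamExpr} {p q : RamProg} {s : RamState} {Q : ℕ → RamState → Prop}
    (he : e.eval s ≠ 0) (h : Run p s fun t s' => Q (e.cost + 1 + t) s') :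
    Run (.ite e p q) s Q := by
  obtain ⟨t, s', h, hQ⟩ := h
  exact ⟨_, _, .iteTrue he h, hQ⟩

theorem Run.iteFalse {e : RamExpr} {p q : RamProg} {s : RamState} {Q : ℕ → RamState → Prop}
    (he : e.eval s = 0) (h : Run q s fun t s' => Q (e.cost + 1 + t) s') :
    Run (.ite e p q) s Q := by
  obtain ⟨t, s', h, hQ⟩ := h
  exact ⟨_, _, .iteFalse he h, hQ⟩

/-- The rule for loops. The invariant speaks of the time spent so far; as each round takes time, a
bound on that time makes the loop terminate. -/
theorem Run.while {e : RamExpr} {p : RamProg} (Inv : ℕ → RamState → Prop) (B : ℕ) {s : RamState}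
    (hB : ∀ t s, Inv t s → t ≤ B) (h0 : Inv 0 s)
    (hstep : ∀ t s, Inv t s → e.eval s ≠ 0 →
      Run p s fun t' s' => Inv (t + (e.cost + 1 + t')) s') :
    Run (.while e p) s fun t s' => e.eval s' = 0 ∧ ∃ t', t = t' + (e.cost + 1) ∧ Inv t' s' := by
  have key : ∀ d t s, Inv t s → B - t ≤ d →
      Run (.while e p) s fun t' s' => e.eval s' = 0 ∧
        ∃ t'', t + t' = t'' + (e.cost + 1) ∧ Inv t'' s' := by
    intro d
    induction d with
    | zero =>
      intro t s hI hd
      by_cases he : e.eval s = 0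
      · exact ⟨_, _, .whileFalse he, he, t, rfl, hI⟩
      · obtain ⟨t', s', -, hI'⟩ := hstep t s hI he
        have := hB _ _ hI'
        omega
    | succ d ih =>
      intro t s hI hd
      by_cases he : e.eval s = 0
      · exact ⟨_, _, .whileFalse he, he, t, rfl, hI⟩
      · obtain ⟨t', s', hx, hI'⟩ := hstep t s hI he
        have := hB _ _ hI'
        obtain ⟨t₂, s₂, hx₂, he₂, t₃, h₃, hI₃⟩ := ih _ _ hI' (by omega)
        exact ⟨_, _, .whileTrue he hx hx₂, he₂, t₃, by omega, hI₃⟩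
  simpa using key B 0 s h0 (by omega)

theorem RamExpr.eval_lt_eq_zero {a b : RamExpr} {s : RamState} :
    (RamExpr.lt a b).eval s = 0 ↔ b.eval s ≤ a.eval s := by
  simp [RamExpr.eval]

namespace RamProg

/-- Sequential composition of a list of programs. -/
def block : List RamProg → RamProg
  | [] => .skip
  | p :: l => .seq p (block l)

/-- The program has no loop. -/
def straight : RamProg → Bool
  | .skip => true
  | .assign _ _ => true
  | .store _ _ _ => true
  | .seq p q => p.straight && q.straight
  | .ite _ p q => p.straight && q.straight
  | .while _ _ => false

/-- The final memory of a program without loops. -/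
def run : RamProg → RamState → RamState
  | .skip, s => s
  | .assign x e, s => ⟨Function.update s.var x (e.eval s), s.arr⟩
  | .store a i e, s =>
      ⟨s.var, Function.update s.arr a (Function.update (s.arr a) (i.eval s) (e.eval s))⟩
  | .seq p q, s => q.run (p.run s)
  | .ite e p q, s => if e.eval s = 0 then q.run s else p.run s
  | .while _ _, s => s

/-- A bound for the number of steps of a program without loops. -/
def bound : RamProg → ℕ
  | .skip => 1
  | .assign _ e => e.cost + 1
  | .store _ i e => i.cost + e.cost + 1
  | .seq p q => p.bound + q.bound
  | .ite e p q => e.cost + 1 + (p.bound + q.bound)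
  | .while _ _ => 0

theorem exists_exec_of_straight (P : RamProg) (h : P.straight = true) (s : RamState) :
    ∃ t, t ≤ P.bound ∧ RamExec P s t (P.run s) := by
  induction P generalizing s with
  | skip => exact ⟨_, le_rfl, .skip s⟩
  | assign x e => exact ⟨_, le_rfl, .assign x e s⟩
  | store a i e => exact ⟨_, le_rfl, .store a i e s⟩
  | seq p q hp hq =>
    simp only [straight, Bool.and_eq_true] at h
    obtain ⟨t, ht, hx⟩ := hp h.1 s
    obtain ⟨t', ht', hx'⟩ := hq h.2 (p.run s)
    exact ⟨_, by simp only [bound]; omega, .seq hx hx'⟩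
  | ite e p q hp hq =>
    simp only [straight, Bool.and_eq_true] at h
    by_cases he : e.eval s = 0
    · obtain ⟨t, ht, hx⟩ := hq h.2 s
      exact ⟨e.cost + 1 + t, by simp only [bound]; omega, by
        simpa [run, he] using RamExec.iteFalse he hx⟩
    · obtain ⟨t, ht, hx⟩ := hp h.1 s
      exact ⟨e.cost + 1 + t, by simp only [bound]; omega, by
        simpa [run, he] using RamExec.iteTrue he hx⟩
  | _ => simp [straight] at h

/-- The registers a program assigns to. -/
def modVar : RamProg → List ℕ
  | .skip => []
  | .assign x _ => [x]
  | .store _ _ _ => []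
  | .seq p q => p.modVar ++ q.modVar
  | .ite _ p q => p.modVar ++ q.modVar
  | .while _ p => p.modVar

/-- The arrays a program stores to. -/
def modArr : RamProg → List ℕ
  | .skip => []
  | .assign _ _ => []
  | .store a _ _ => [a]
  | .seq p q => p.modArr ++ q.modArr
  | .ite _ p q => p.modArr ++ q.modArr
  | .while _ p => p.modArr

/-- The registers and arrays that `P` does not mention on a left-hand side are the same in `s` and
`s'`. -/
structure Frame (P : RamProg) (s s' : RamState) : Prop where
  var : ∀ x, x ∉ P.modVar → s'.var x = s.var x
  arr : ∀ a, a ∉ P.modArr → s'.arr a = s.arr a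

theorem Frame.refl (P : RamProg) (s : RamState) : Frame P s s := ⟨fun _ _ => rfl, fun _ _ => rfl⟩

theorem frame_of_exec {P : RamProg} {s s' : RamState} {t : ℕ} (h : RamExec P s t s') :
    Frame P s s' := by
  induction h with
  | skip s => exact Frame.refl _ _
  | assign x e s =>
    refine ⟨fun y hy => ?_, fun _ _ => rfl⟩
    simp only [modVar, List.mem_singleton] at hy
    simp [Function.update_of_ne hy]
  | store a i e s =>
    refine ⟨fun _ _ => rfl, fun y hy => ?_⟩
    simp only [modArr, List.mem_singleton] at hy
    simp [Function.update_of_ne hy]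
  | seq _ _ ih₁ ih₂ =>
    refine ⟨fun y hy => ?_, fun y hy => ?_⟩
    · simp only [modVar, List.mem_append, not_or] at hy
      rw [ih₂.var y hy.2, ih₁.var y hy.1]
    · simp only [modArr, List.mem_append, not_or] at hy
      rw [ih₂.arr y hy.2, ih₁.arr y hy.1]
  | iteTrue _ _ ih =>
    refine ⟨fun y hy => ?_, fun y hy => ?_⟩
    · simp only [modVar, List.mem_append, not_or] at hy
      rw [ih.var y hy.1]
    · simp only [modArr, List.mem_append, not_or] at hy
      rw [ih.arr y hy.1]
  | iteFalse _ _ ih =>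
    refine ⟨fun y hy => ?_, fun y hy => ?_⟩
    · simp only [modVar, List.mem_append, not_or] at hy
      rw [ih.var y hy.2]
    · simp only [modArr, List.mem_append, not_or] at hy
      rw [ih.arr y hy.2]
  | whileTrue _ _ _ ih₁ ih₂ =>
    refine ⟨fun y hy => ?_, fun y hy => ?_⟩
    · rw [ih₂.var y hy, ih₁.var y hy]
    · rw [ih₂.arr y hy, ih₁.arr y hy]
  | whileFalse _ => exact Frame.refl _ _

end RamProg

theorem Run.frame {P : RamProg} {s : RamState} {Q : ℕ → RamState → Prop} (h : Run P s Q) :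
    Run P s fun t s' => Q t s' ∧ RamProg.Frame P s s' := by
  obtain ⟨t, s', h, h'⟩ := h
  exact ⟨t, s', h, h', RamProg.frame_of_exec h⟩

/-- A program without loops is run by computing its final memory. -/
theorem Run.straight {P : RamProg} {s : RamState} {Q : ℕ → RamState → Prop}
    (hP : P.straight = true) (h : ∀ t, t ≤ P.bound → Q t (P.run s)) : Run P s Q := by
  obtain ⟨t, ht, hx⟩ := P.exists_exec_of_straight hP s
  exact ⟨t, _, hx, h t ht⟩

/-- A block is run by running its first program and then the rest. -/
theorem Run.block_cons {p : RamProg} {l : List RamProg} {s : RamState}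
    {Q : ℕ → RamState → Prop}
    (h : Run p s fun t s' => Run (.block l) s' fun t' s'' => Q (t + t') s'') :
    Run (.block (p :: l)) s Q :=
  Run.seq h

theorem Run.block_nil {s : RamState} {Q : ℕ → RamState → Prop} (h : Q 1 s) :
    Run (.block []) s Q :=
  ⟨1, s, .skip s, h⟩

/-- A block whose first program has no loop. -/
theorem Run.block_straight {p : RamProg} {l : List RamProg} {s : RamState}
    {Q : ℕ → RamState → Prop} (hp : p.straight = true)
    (h : ∀ t, t ≤ p.bound → Run (.block l) (p.run s) fun t' s'' => Q (t + t') s'') :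
    Run (.block (p :: l)) s Q :=
  .block_cons (.straight hp h)

/-! ### Networks and depth-first search -/

/-- A residual network on nodes that are positive numbers. The arcs are `1, …, size`; arc `h` leads to
`dst h`, its reverse is `mate h`, its residual capacity is `cap h`. The arcs that leave `u` are chained in
decreasing order, from `head u` along `nxt` down to `0`. The residual capacities of the arcs from the
source to `u` and from `u` to the sink are `src u` and `snk u`. -/
structure Network where
  size : ℕ
  dst : ℕ → ℕ
  mate : ℕ → ℕ
  cap : ℕ → ℕ
  nxt : ℕ → ℕ
  head : ℕ → ℕ
  src : ℕ → ℕ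
  snk : ℕ → ℕ

namespace Network

/-- The tail of an arc. -/
def frm (N : Network) (h : ℕ) : ℕ := N.dst (N.mate h)

/-- `h` is an arc of the network. -/
def IsArc (N : Network) (h : ℕ) : Prop := 1 ≤ h ∧ h ≤ N.size

/-- The reverse arcs and the chains of outgoing arcs are consistent. -/
structure IsAdj (N : Network) : Prop where
  dst_ne : ∀ h, N.IsArc h → N.dst h ≠ 0
  mate_mem : ∀ h, N.IsArc h → N.IsArc (N.mate h)
  mate_mate : ∀ h, N.IsArc h → N.mate (N.mate h) = h
  mate_ne : ∀ h, N.IsArc h → N.mate h ≠ h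
  head_le : ∀ u, N.head u ≤ N.size
  frm_head : ∀ u, N.head u ≠ 0 → N.frm (N.head u) = u
  le_head : ∀ h, N.IsArc h → h ≤ N.head (N.frm h)
  nxt_lt : ∀ h, N.IsArc h → N.nxt h < h
  frm_nxt : ∀ h, N.IsArc h → N.nxt h ≠ 0 → N.frm (N.nxt h) = N.frm h
  le_nxt : ∀ h h', N.IsArc h → 1 ≤ h' → h' < h → N.frm h' = N.frm h → h' ≤ N.nxt h

/-- The adjacency given by the arcs `h` with `c h ≠ 0`. -/
def Edge (N : Network) (c : ℕ → ℕ) (u w : ℕ) : Prop :=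
  ∃ h, N.IsArc h ∧ N.frm h = u ∧ N.dst h = w ∧ c h ≠ 0

/-- Reachability along the arcs `h` with `c h ≠ 0`. -/
abbrev Reach (N : Network) (c : ℕ → ℕ) : ℕ → ℕ → Prop := Relation.ReflTransGen (N.Edge c)

/-- `S` contains the nodes adjacent to the source, none of those adjacent to the sink, and no residual arc
leaves it. -/
structure IsClosed (N : Network) (S : Finset ℕ) : Prop where
  src : ∀ u, N.src u ≠ 0 → u ∈ S
  snk : ∀ u ∈ S, N.snk u = 0
  edge : ∀ u ∈ S, ∀ w, N.Edge N.cap u w → w ∈ S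

theorem IsAdj.frm_mate {N : Network} (hN : N.IsAdj) {h : ℕ} (hh : N.IsArc h) :
    N.frm (N.mate h) = N.dst h := by
  rw [frm, hN.mate_mate h hh]

/-- Reversing the arcs reverses the adjacency. -/
theorem IsAdj.edge_mate_iff {N : Network} (hN : N.IsAdj) (u w : ℕ) :
    N.Edge (fun h => N.cap (N.mate h)) u w ↔ N.Edge N.cap w u := by
  constructor
  · rintro ⟨h, hh, rfl, rfl, hc⟩
    exact ⟨N.mate h, hN.mate_mem h hh, hN.frm_mate hh, rfl, hc⟩
  · rintro ⟨h, hh, rfl, rfl, hc⟩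
    exact ⟨N.mate h, hN.mate_mem h hh, hN.frm_mate hh, rfl, by
      simpa [hN.mate_mate h hh] using hc⟩

end Network

/-- The state of a depth-first search. The visited nodes are those with `vis x = stamp`; `pred x` is the
arc by which `x` was found (`0` for a root), `cur x` the next arc at `x` to be examined. The current path
is `stk` (last node first), the finished nodes are `done` (last finished first), and `tgt`, if not
`0`, is a node met so far that has residual capacity to the sink. -/
structure Dfs where
  vis : ℕ → ℕ
  pred : ℕ → ℕ
  cur : ℕ → ℕ
  stamp : ℕ
  tgt : ℕ
  stk : List ℕ
  done : List ℕ

namespace Dfs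

/-- The node `w` is met. -/
def mark (N : Network) (σ : Dfs) (w : ℕ) : Dfs :=
  { σ with tgt := if N.snk w = 0 then σ.tgt else w }

/-- The unvisited node `w`, found by the arc `e`, is visited. -/
def push (N : Network) (σ : Dfs) (w e : ℕ) : Dfs :=
  { σ with
    vis := Function.update σ.vis w σ.stamp
    pred := Function.update σ.pred w e
    cur := Function.update σ.cur w (N.head w)
    stk := w :: σ.stk }

/-- The node `w` is met, by the arc `e`, and visited if it is new. -/
def visit (N : Network) (σ : Dfs) (w e : ℕ) : Dfs :=
  if σ.vis w = σ.stamp then σ.mark N w else (σ.mark N w).push N w e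

/-- The arc examined next at `u` is replaced by its successor. -/
def advance (N : Network) (σ : Dfs) (u : ℕ) : Dfs :=
  { σ with cur := Function.update σ.cur u (N.nxt (σ.cur u)) }

/-- One step of the search along the arcs `h` with `c h ≠ 0`. -/
def step (N : Network) (c : ℕ → ℕ) (σ : Dfs) : Dfs :=
  match σ.stk with
  | [] => σ
  | u :: K =>
    if σ.cur u = 0 then { σ with stk := K, done := u :: σ.done }
    else if c (σ.cur u) = 0 then σ.advance N u
    else (σ.advance N u).visit N (N.dst (σ.cur u)) (σ.cur u)

/-- The nodes visited since the search began. -/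
def new (σ : Dfs) : List ℕ := σ.stk ++ σ.done

/-- Postorder: when `u` finishes, every unfinished node outside `B` to which an edge leads from a finished
node lies on the current path, so it reaches `u`. -/
def FinishOK (E : ℕ → ℕ → Prop) (B : Finset ℕ) : List ℕ → Prop
  | [] => True
  | u :: D => FinishOK E B D ∧ ∀ p ∈ u :: D, ∀ q, q ∉ u :: D → q ∉ B → E p q →
      Relation.ReflTransGen E q u

/-- The predecessor arcs form a forest on `l` whose roots satisfy `Rt`; depths are below `l.length`. -/
def IsForest (N : Network) (c : ℕ → ℕ) (Rt : ℕ → Prop) (pred : ℕ → ℕ) (l : List ℕ) : Prop :=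
  ∃ ρ : ℕ → ℕ, ∀ x ∈ l, ρ x < l.length ∧ (pred x = 0 → Rt x) ∧
    (pred x ≠ 0 → N.IsArc (pred x) ∧ c (pred x) ≠ 0 ∧ N.dst (pred x) = x ∧
      N.frm (pred x) ∈ l ∧ ρ (N.frm (pred x)) < ρ x)

/-- The invariant of a search with roots satisfying `Rt`, where the nodes of `B` were visited and finished
before. Inside a step, the arc `e` has been passed but its head has not been met yet. -/
structure Inv (N : Network) (c : ℕ → ℕ) (Rt : ℕ → Prop) (B : Finset ℕ) (e : ℕ) (σ : Dfs) :
    Prop where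
  vis_le : ∀ x, σ.vis x ≤ σ.stamp
  vis_iff : ∀ x, σ.vis x = σ.stamp ↔ x ∈ σ.stk ∨ x ∈ σ.done ∨ x ∈ B
  nodup : (σ.stk ++ σ.done).Nodup
  disj : ∀ x ∈ B, x ∉ σ.stk ∧ x ∉ σ.done
  isNode : ∀ x, x ∈ σ.stk ∨ x ∈ σ.done → ∃ h, N.IsArc h ∧ N.dst h = x
  cur_stk : ∀ x ∈ σ.stk, σ.cur x ≤ N.size ∧ (σ.cur x ≠ 0 → N.frm (σ.cur x) = x)
  cur_done : ∀ x, x ∈ σ.done ∨ x ∈ B → σ.cur x = 0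
  closed : ∀ h, N.IsArc h → h ≠ e → σ.vis (N.frm h) = σ.stamp → σ.cur (N.frm h) < h → c h ≠ 0 →
    σ.vis (N.dst h) = σ.stamp
  snk_edge : ∀ h, N.IsArc h → h ≠ e → N.frm h ∈ σ.stk ∨ N.frm h ∈ σ.done → σ.cur (N.frm h) < h →
    c h ≠ 0 → N.snk (N.dst h) ≠ 0 → σ.tgt ≠ 0
  snk_node : ∀ x, x ∈ σ.stk ∨ x ∈ σ.done → N.snk x ≠ 0 → σ.tgt ≠ 0
  tgt : σ.tgt ≠ 0 → N.snk σ.tgt ≠ 0 ∧ σ.vis σ.tgt = σ.stamp ∧ ∃ r, Rt r ∧ N.Reach c r σ.tgt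
  chain : σ.stk.IsChain fun w u => N.Edge c u w
  reach : ∀ x, x ∈ σ.stk ∨ x ∈ σ.done → ∃ r, Rt r ∧ N.Reach c r x
  finish : FinishOK (N.Edge c) B σ.done
  forest : IsForest N c Rt σ.pred σ.new

variable {N : Network} {c : ℕ → ℕ} {Rt : ℕ → Prop} {B : Finset ℕ} {σ : Dfs}

/-- A search can be started when the visited nodes are those of `B`, and `B` is closed. -/
theorem Inv.start (hs : σ.stk = []) (hd : σ.done = []) (ht : σ.tgt = 0)
    (hle : ∀ x, σ.vis x ≤ σ.stamp) (hvis : ∀ x, σ.vis x = σ.stamp ↔ x ∈ B)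
    (hcur : ∀ x ∈ B, σ.cur x = 0)
    (hB : ∀ u ∈ B, ∀ w, N.Edge c u w → w ∈ B) : Inv N c Rt B 0 σ where
  vis_le := hle
  vis_iff x := by simp [hs, hd, hvis]
  nodup := by simp [hs, hd]
  disj := by simp [hs, hd]
  isNode := by simp [hs, hd]
  cur_stk := by simp [hs]
  cur_done := by simpa [hd] using hcur
  closed h hh _ hv _ hch := (hvis _).2 (hB _ ((hvis _).1 hv) _ ⟨h, hh, rfl, rfl, hch⟩)
  snk_edge := by simp [hs, hd]
  snk_node := by simp [hs, hd]
  tgt h := absurd ht h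
  chain := by simp [hs]
  reach := by simp [hs, hd]
  finish := by simp [hd, FinishOK]
  forest := ⟨fun _ => 0, by simp [new, hs, hd]⟩

/-- When the path is empty, the visited nodes are closed. -/
theorem Inv.edge_mem {σ : Dfs} (I : Inv N c Rt B 0 σ) (hs : σ.stk = []) {u w : ℕ}
    (hu : u ∈ σ.done ∨ u ∈ B) (h : N.Edge c u w) : w ∈ σ.done ∨ w ∈ B := by
  obtain ⟨a, ha, rfl, rfl, hc⟩ := h
  have h1 := ha.1
  have h0 := I.cur_done _ hu
  have := I.closed a ha (by omega) ((I.vis_iff _).2 (by tauto)) (by omega) hc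
  simpa [I.vis_iff, hs] using this

/-- If a search from all nodes adjacent to the source has not met a node adjacent to the sink, the
visited nodes form a closed set. -/
theorem Inv.isClosed {σ : Dfs} (I : Inv N N.cap (fun u => N.src u ≠ 0) ∅ 0 σ) (hs : σ.stk = [])
    (ht : σ.tgt = 0) (hsrc : ∀ u, N.src u ≠ 0 → σ.vis u = σ.stamp) :
    N.IsClosed σ.done.toFinset where
  src u hu := by simpa [I.vis_iff, hs] using hsrc u hu
  snk u hu := by
    by_contra hne
    exact I.snk_node u (.inr (by simpa using hu)) hne ht
  edge u hu w huw := by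
    have := I.edge_mem hs (.inl (by simpa using hu)) huw
    simpa using this

/-- Each node of the current path reaches its last node. -/
theorem reach_head_of_chain {E : ℕ → ℕ → Prop} {u : ℕ} {K : List ℕ}
    (h : (u :: K).IsChain fun w u => E u w) : ∀ g ∈ u :: K, Relation.ReflTransGen E g u := by
  induction K generalizing u with
  | nil =>
    intro g hg
    rw [List.mem_singleton.1 hg]
  | cons v K ih =>
    rw [List.isChain_cons_cons] at h
    intro g hg
    rcases List.mem_cons.1 hg with rfl | hg
    · exact .refl
    · exact (ih h.2 g hg).tail h.1

/-- When all arcs at the end of the path have been passed, it is finished. -/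
theorem Inv.finish_step (I : Inv N c Rt B 0 σ) {u : ℕ} {K : List ℕ}
    (hs : σ.stk = u :: K) (hc : σ.cur u = 0) :
    Inv N c Rt B 0 { σ with stk := K, done := u :: σ.done } := by
  have hnd := I.nodup
  rw [hs] at hnd
  have hm : ∀ x, (x ∈ K ∨ x ∈ u :: σ.done) ↔ (x ∈ σ.stk ∨ x ∈ σ.done) := by
    intro x; simp only [hs, List.mem_cons]; tauto
  refine
    { vis_le := I.vis_le, vis_iff := fun x => ?_, nodup := ?_, disj := ?_, isNode := ?_,
      cur_stk := ?_, cur_done := ?_, closed := I.closed,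
      snk_edge := ?_, snk_node := ?_, tgt := I.tgt, chain := ?_, reach := ?_,
      finish := ?_, forest := ?_ }
  · rw [I.vis_iff x, ← or_assoc, ← or_assoc, ← hm]
  · exact (List.perm_middle.nodup_iff).2 hnd
  · intro x hx
    have := I.disj x hx
    rw [← not_or] at this ⊢
    rwa [hm]
  · intro x hx; exact I.isNode x ((hm x).1 hx)
  · intro x hx; exact I.cur_stk x (by rw [hs]; exact List.mem_cons_of_mem _ hx)
  · intro x hx
    rcases hx with hx | hx
    · rcases List.mem_cons.1 hx with rfl | hx
      · exact hc
      · exact I.cur_done x (.inl hx)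
    · exact I.cur_done x (.inr hx)
  · intro h hh he hf; exact I.snk_edge h hh he ((hm _).1 hf)
  · intro x hx; exact I.snk_node x ((hm x).1 hx)
  · have := I.chain
    rw [hs] at this
    exact this.tail
  · intro x hx; exact I.reach x ((hm x).1 hx)
  · -- all arcs at a finished node have been passed, so its neighbours have been visited; one that is not
    -- finished lies on the path
    refine ⟨I.finish, ?_⟩
    rintro p hp q hq hqB ⟨h, hh, rfl, rfl, hch⟩
    have hcur : σ.cur (N.frm h) = 0 := by
      rcases List.mem_cons.1 hp with h' | h'
      · rw [h']; exact hc
      · exact I.cur_done _ (.inl h')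
    have hv : σ.vis (N.frm h) = σ.stamp := by
      rw [I.vis_iff, ← or_assoc, ← hm]; exact .inl (.inr hp)
    have h1 := hh.1
    have := I.closed h hh (by omega) hv (by omega) hch
    rw [I.vis_iff, ← or_assoc, ← hm] at this
    have hch := I.chain
    rw [hs] at hch
    refine reach_head_of_chain hch _ (List.mem_cons_of_mem _ ?_)
    tauto
  · obtain ⟨ρ, hρ⟩ := I.forest
    have hnew : ∀ x, x ∈ K ++ u :: σ.done ↔ x ∈ σ.new := by
      intro x; simp only [new, hs, List.mem_append, List.mem_cons]; tauto
    have hlen : (K ++ u :: σ.done).length = σ.new.length := by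
      simp only [new, hs, List.length_append, List.length_cons]; omega
    refine ⟨ρ, fun x hx => ?_⟩
    have := hρ x ((hnew x).1 hx)
    simp only [new] at this ⊢
    refine ⟨by rw [hlen]; exact this.1, this.2.1, fun h => ?_⟩
    obtain ⟨a, b, d, f, g⟩ := this.2.2 h
    exact ⟨a, b, d, (hnew _).2 f, g⟩

theorem Inv.isArc_cur (I : Inv N c Rt B 0 σ) {u : ℕ} {K : List ℕ}
    (hs : σ.stk = u :: K) (hc : σ.cur u ≠ 0) : N.IsArc (σ.cur u) ∧ N.frm (σ.cur u) = u := by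
  have := I.cur_stk u (by simp [hs])
  exact ⟨⟨by omega, this.1⟩, this.2 hc⟩

theorem Inv.advance (hN : N.IsAdj) (I : Inv N c Rt B 0 σ) {u : ℕ} {K : List ℕ}
    (hs : σ.stk = u :: K) (hc : σ.cur u ≠ 0) :
    Inv N c Rt B (σ.cur u) (σ.advance N u) := by
  obtain ⟨ha, hf⟩ := I.isArc_cur hs hc
  have hlt := hN.nxt_lt _ ha
  have hu : u ∈ σ.stk := by simp [hs]
  -- every arc passed after the step, except the current one, was passed before
  have hpass : ∀ h, N.IsArc h → h ≠ σ.cur u →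
      Function.update σ.cur u (N.nxt (σ.cur u)) (N.frm h) < h → σ.cur (N.frm h) < h := by
    intro h hh hne hlt'
    by_cases hx : N.frm h = u
    · rw [hx, Function.update_self] at hlt'
      rw [hx]
      by_contra hcon
      have := hN.le_nxt _ h ha hh.1 (by omega) (by rw [hx, hf])
      omega
    · rwa [Function.update_of_ne hx] at hlt'
  refine
    { vis_le := I.vis_le, vis_iff := I.vis_iff, nodup := I.nodup, disj := I.disj, isNode := I.isNode, cur_stk := ?_,
      cur_done := ?_, closed := ?_, snk_edge := ?_, snk_node := I.snk_node, tgt := I.tgt,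
      chain := I.chain, reach := I.reach, finish := I.finish, forest := I.forest }
  · intro x hx
    simp only [Dfs.advance] at hx ⊢
    by_cases hxu : x = u
    · subst hxu
      rw [Function.update_self]
      have := ha.2
      exact ⟨by omega, fun h => (hN.frm_nxt _ ha h).trans hf⟩
    · rw [Function.update_of_ne hxu]; exact I.cur_stk x hx
  · intro x hx
    simp only [Dfs.advance] at hx ⊢
    have : x ≠ u := by
      rintro rfl
      rcases hx with hx | hx
      · exact (List.disjoint_of_nodup_append I.nodup) hu hx
      · exact (I.disj x hx).1 hu
    rw [Function.update_of_ne this]; exact I.cur_done x hx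
  · intro h hh hne hv hlt' hch
    have h1 := hh.1
    exact I.closed h hh (by omega) hv (hpass h hh hne hlt') hch
  · intro h hh hne hv hlt' hch
    have h1 := hh.1
    exact I.snk_edge h hh (by omega) hv (hpass h hh hne hlt') hch

theorem Inv.skip {e : ℕ} (I : Inv N c Rt B e σ) (he : c e = 0) : Inv N c Rt B 0 σ :=
  { I with
    closed := fun h hh _ hv hlt hch => I.closed h hh (by rintro rfl; exact hch he) hv hlt hch
    snk_edge := fun h hh _ hv hlt hch => I.snk_edge h hh (by rintro rfl; exact hch he) hv hlt hch }

/-- `w` is met either as a root, on an empty path, or through an arc `e` from the end of the path. -/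
def Meets (N : Network) (c : ℕ → ℕ) (Rt : ℕ → Prop) (σ : Dfs) (w e : ℕ) : Prop :=
  (e = 0 ∧ σ.stk = [] ∧ Rt w ∧ ∃ h, N.IsArc h ∧ N.dst h = w) ∨
  (N.IsArc e ∧ c e ≠ 0 ∧ N.dst e = w ∧ ∃ K, σ.stk = N.frm e :: K)

theorem Inv.reach_of_meets {e w : ℕ} (I : Inv N c Rt B e σ) (hm : Meets N c Rt σ w e) :
    ∃ r, Rt r ∧ N.Reach c r w := by
  rcases hm with ⟨-, -, h, -⟩ | ⟨ha, hce, rfl, K, hK⟩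
  · exact ⟨w, h, .refl⟩
  · obtain ⟨r, hr, h⟩ := I.reach (N.frm e) (.inl (by simp [hK]))
    exact ⟨r, hr, h.tail ⟨e, ha, rfl, rfl, hce⟩⟩

theorem Meets.isNode {e w : ℕ} (hm : Meets N c Rt σ w e) : ∃ h, N.IsArc h ∧ N.dst h = w := by
  rcases hm with ⟨-, -, -, h⟩ | ⟨ha, -, h, -⟩
  · exact h
  · exact ⟨e, ha, h⟩

/-- When an already visited node is met, all clauses of the invariant hold again. -/
theorem Inv.visit_old (hN : N.IsAdj) {e w : ℕ} (I : Inv N c Rt B e σ) (hm : Meets N c Rt σ w e)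
    (hv : σ.vis w = σ.stamp) : Inv N c Rt B 0 (σ.mark N w) := by
  have hw : w ≠ 0 := by
    obtain ⟨h, hh, rfl⟩ := hm.isNode
    exact hN.dst_ne h hh
  have hmono : σ.tgt ≠ 0 → (σ.mark N w).tgt ≠ 0 := by
    intro h; simp only [mark]; split_ifs <;> assumption
  have he : ∀ h, N.IsArc h → h = e → N.dst h = w := by
    rintro h hh rfl
    rcases hm with ⟨h0, -⟩ | ⟨-, -, h, -⟩
    · have := hh.1; omega
    · exact h
  refine
    { vis_le := I.vis_le, vis_iff := I.vis_iff, nodup := I.nodup, disj := I.disj, isNode := I.isNode,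
      cur_stk := I.cur_stk, cur_done := I.cur_done, closed := ?_, snk_edge := ?_, snk_node := ?_,
      tgt := ?_, chain := I.chain, reach := I.reach, finish := I.finish, forest := I.forest }
  · intro h hh _ hvf hlt hch
    by_cases hhe : h = e
    · simp only [mark, he h hh hhe, hv]
    · exact I.closed h hh hhe hvf hlt hch
  · intro h hh _ hvf hlt hch hsn
    by_cases hhe : h = e
    · rw [he h hh hhe] at hsn
      simp [mark, hsn, hw]
    · exact hmono (I.snk_edge h hh hhe hvf hlt hch hsn)
  · intro x hx hsn
    exact hmono (I.snk_node x hx hsn)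
  · intro ht
    by_cases hsn : N.snk w = 0
    · simp only [mark, hsn, if_true] at ht ⊢
      exact I.tgt ht
    · simp only [mark, hsn, if_false]
      exact ⟨hsn, hv, I.reach_of_meets hm⟩

/-- When a new node is met, it becomes the end of the path. -/
theorem Inv.visit_new (hN : N.IsAdj) {e w : ℕ} (I : Inv N c Rt B e σ) (hm : Meets N c Rt σ w e)
    (hv : σ.vis w ≠ σ.stamp) : Inv N c Rt B 0 ((σ.mark N w).push N w e) := by
  obtain ⟨ha, hha, hdw⟩ := hm.isNode
  have hw : w ≠ 0 := by rw [← hdw]; exact hN.dst_ne ha hha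
  have hmono : σ.tgt ≠ 0 → ((σ.mark N w).push N w e).tgt ≠ 0 := by
    intro h; simp only [mark, push]; split_ifs <;> assumption
  have he : ∀ h, N.IsArc h → h = e → N.dst h = w := by
    rintro h hh rfl
    rcases hm with ⟨h0, -⟩ | ⟨-, -, h, -⟩
    · have := hh.1; omega
    · exact h
  have hnot : w ∉ σ.stk ∧ w ∉ σ.done ∧ w ∉ B := by
    rw [Ne, I.vis_iff] at hv; tauto
  have hvis : ∀ x, Function.update σ.vis w σ.stamp x = σ.stamp ↔ x = w ∨ σ.vis x = σ.stamp := by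
    intro x
    by_cases hx : x = w
    · simp [hx]
    · simp [hx]
  have hne : ∀ x, x ∈ σ.stk ∨ x ∈ σ.done ∨ x ∈ B → x ≠ w := by
    rintro x hx rfl
    tauto
  -- no arc at `w` has been passed yet
  have hpass : ∀ h, N.IsArc h → N.frm h = w →
      ¬ Function.update σ.cur w (N.head w) (N.frm h) < h := by
    intro h hh hfw
    have := hN.le_head h hh
    rw [hfw] at this ⊢
    rw [Function.update_self]
    omega
  refine
    { vis_le := ?_, vis_iff := ?_, nodup := ?_, disj := ?_, isNode := ?_, cur_stk := ?_,
      cur_done := ?_, closed := ?_, snk_edge := ?_, snk_node := ?_,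
      tgt := ?_, chain := ?_, reach := ?_, finish := I.finish, forest := ?_ }
  · intro x
    simp only [push, mark, Function.update_apply]
    split_ifs
    · exact le_rfl
    · exact I.vis_le x
  · intro x
    simp only [push, mark, hvis, I.vis_iff, List.mem_cons]
    tauto
  · simp only [push, mark, List.cons_append, List.nodup_cons, List.mem_append]
    exact ⟨by tauto, I.nodup⟩
  · intro x hx
    have := I.disj x hx
    simp only [push, mark, List.mem_cons, not_or]
    exact ⟨⟨hne x (by tauto), this.1⟩, this.2⟩
  · intro x hx
    simp only [push, mark, List.mem_cons] at hx
    by_cases hxw : x = w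
    · exact ⟨ha, hha, hdw.trans hxw.symm⟩
    · exact I.isNode x (by tauto)
  · intro x hx
    simp only [push, mark, List.mem_cons] at hx ⊢
    by_cases hxw : x = w
    · subst hxw
      rw [Function.update_self]
      exact ⟨hN.head_le _, hN.frm_head _⟩
    · rw [Function.update_of_ne hxw]
      exact I.cur_stk x (by tauto)
  · intro x hx
    simp only [push, mark] at hx ⊢
    rw [Function.update_of_ne (hne x (by tauto))]
    exact I.cur_done x hx
  · intro h hh _ hvf hlt hch
    simp only [push, mark] at hvf hlt ⊢
    rw [hvis] at hvf ⊢
    by_cases hfw : N.frm h = w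
    · exact absurd hlt (hpass h hh hfw)
    · rw [Function.update_of_ne hfw] at hlt
      by_cases hhe : h = e
      · exact .inl (he h hh hhe)
      · exact .inr (I.closed h hh hhe (by tauto) hlt hch)
  · intro h hh _ hvf hlt hch hsn
    by_cases hfw : N.frm h = w
    · exact absurd hlt (hpass h hh hfw)
    · simp only [push, mark, List.mem_cons] at hvf hlt
      rw [Function.update_of_ne hfw] at hlt
      by_cases hhe : h = e
      · rw [he h hh hhe] at hsn
        simp [mark, push, hsn, hw]
      · exact hmono (I.snk_edge h hh hhe (by tauto) hlt hch hsn)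
  · intro x hx hsn
    simp only [push, mark, List.mem_cons] at hx
    by_cases hxw : x = w
    · subst hxw
      simp [mark, push, hsn, hw]
    · exact hmono (I.snk_node x (by tauto) hsn)
  · intro ht
    by_cases hsn : N.snk w = 0
    · simp only [mark, push, hsn, if_true] at ht ⊢
      obtain ⟨h1, h2, h3⟩ := I.tgt ht
      exact ⟨h1, (hvis _).2 (.inr h2), h3⟩
    · simp only [mark, push, hsn, if_false]
      exact ⟨hsn, (hvis _).2 (.inl rfl), I.reach_of_meets hm⟩
  · simp only [push, mark]
    rcases hm with ⟨-, hs, -⟩ | ⟨hae, hce, hde, K, hs⟩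
    · simp [hs]
    · rw [hs, List.isChain_cons_cons, ← hs]
      exact ⟨⟨e, hae, rfl, hde, hce⟩, I.chain⟩
  · intro x hx
    simp only [push, mark, List.mem_cons] at hx
    by_cases hxw : x = w
    · subst hxw
      exact I.reach_of_meets hm
    · exact I.reach x (by tauto)
  · obtain ⟨ρ, hρ⟩ := I.forest
    have hwn : w ∉ σ.new := by simp only [new, List.mem_append]; tauto
    refine ⟨Function.update ρ w σ.new.length, fun x hx => ?_⟩
    simp only [push, mark, new, List.cons_append, List.mem_cons, List.length_cons] at hx ⊢
    change x = w ∨ x ∈ σ.new at hx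
    change _ < σ.new.length + 1 ∧ _ ∧ (_ → _ ∧ _ ∧ _ ∧ (_ ∨ _ ∈ σ.new) ∧ _)
    rcases hx with rfl | hx
    · simp only [Function.update_self]
      refine ⟨Nat.lt_succ_self _, ?_, ?_⟩
      · rintro rfl
        rcases hm with ⟨-, -, h, -⟩ | ⟨h, -⟩
        · exact h
        · have := h.1; omega
      · intro he0
        rcases hm with ⟨h, -⟩ | ⟨hae, hce, hde, K, hs⟩
        · exact absurd h he0
        · have hmem : N.frm e ∈ σ.new := by simp [new, hs]
          have hfe : N.frm e ≠ x := by rintro h; exact hwn (h ▸ hmem)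
          rw [Function.update_of_ne hfe]
          exact ⟨hae, hce, hde, .inr hmem, (hρ _ hmem).1⟩
    · have hxw : x ≠ w := by rintro rfl; exact hwn hx
      simp only [Function.update_of_ne hxw]
      obtain ⟨h1, h2, h3⟩ := hρ x hx
      refine ⟨Nat.lt_succ_of_lt h1, h2, fun h => ?_⟩
      obtain ⟨a, b, d, f, g⟩ := h3 h
      have hfe : N.frm (σ.pred x) ≠ w := by rintro h; exact hwn (h ▸ f)
      rw [Function.update_of_ne hfe]
      exact ⟨a, b, d, .inr f, g⟩

theorem Inv.visit (hN : N.IsAdj) {e w : ℕ} (I : Inv N c Rt B e σ) (hm : Meets N c Rt σ w e) :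
    Inv N c Rt B 0 (σ.visit N w e) := by
  unfold Dfs.visit
  split_ifs with hv
  · exact I.visit_old hN hm hv
  · exact I.visit_new hN hm hv

theorem Inv.step (hN : N.IsAdj) (I : Inv N c Rt B 0 σ) : Inv N c Rt B 0 (σ.step N c) := by
  unfold Dfs.step
  split
  · exact I
  · next u K hs =>
    split_ifs with h0 hc
    · exact I.finish_step hs h0
    · exact (I.advance hN hs h0).skip hc
    · obtain ⟨ha, hf⟩ := I.isArc_cur hs h0
      exact (I.advance hN hs h0).visit hN
        (.inr ⟨ha, hc, rfl, K, by simp only [Dfs.advance, hs, hf]⟩)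

/-- The number of arcs that the search has not passed yet. -/
def unpassed (N : Network) (σ : Dfs) : ℕ :=
  ((Finset.Icc 1 N.size).filter fun h =>
    ¬ (σ.vis (N.frm h) = σ.stamp ∧ σ.cur (N.frm h) < h)).card

theorem unpassed_le (N : Network) (σ : Dfs) : σ.unpassed N ≤ N.size := by
  refine (Finset.card_filter_le _ _).trans ?_
  simp

theorem unpassed_visit (N : Network) (σ : Dfs) (w e : ℕ) :
    (σ.visit N w e).unpassed N ≤ σ.unpassed N := by
  unfold Dfs.visit
  split_ifs with hv
  · exact le_rfl
  · unfold unpassed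
    refine Finset.card_le_card fun h => ?_
    rw [Finset.mem_filter, Finset.mem_filter]
    simp only [Finset.mem_Icc, push, mark]
    rintro ⟨hh, hn⟩
    refine ⟨hh, fun ⟨h1, h2⟩ => hn ?_⟩
    have : N.frm h ≠ w := by rintro hw; rw [hw] at h1; exact hv h1
    rw [Function.update_of_ne this, Function.update_of_ne this]
    exact ⟨h1, h2⟩

theorem unpassed_advance (hN : N.IsAdj) (I : Inv N c Rt B 0 σ) {u : ℕ} {K : List ℕ}
    (hs : σ.stk = u :: K) (hc : σ.cur u ≠ 0) :
    (σ.advance N u).unpassed N + 1 ≤ σ.unpassed N := by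
  obtain ⟨ha, hf⟩ := I.isArc_cur hs hc
  have hlt := hN.nxt_lt _ ha
  unfold unpassed
  refine Finset.card_lt_card (Finset.ssubset_iff_of_subset ?_ |>.2 ⟨σ.cur u, ?_, ?_⟩)
  · intro h
    rw [Finset.mem_filter, Finset.mem_filter]
    simp only [Finset.mem_Icc, Dfs.advance]
    rintro ⟨hh, hn⟩
    refine ⟨hh, fun ⟨h1, h2⟩ => hn ⟨h1, ?_⟩⟩
    by_cases hfu : N.frm h = u
    · rw [hfu] at h2 ⊢
      rw [Function.update_self]
      omega
    · rwa [Function.update_of_ne hfu]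
  · have := ha.1
    have := ha.2
    simp only [Finset.mem_filter, Finset.mem_Icc, hf]
    omega
  · have hv : σ.vis u = σ.stamp := (I.vis_iff u).2 (.inl (by simp [hs]))
    rw [Finset.mem_filter]
    simp only [Finset.mem_Icc, Dfs.advance, hf, Function.update_self]
    tauto

theorem length_visit (N : Network) (σ : Dfs) (w e : ℕ) :
    (σ.visit N w e).stk.length ≤ σ.stk.length + 1 ∧ (σ.visit N w e).done = σ.done := by
  unfold Dfs.visit
  split_ifs <;> simp [mark, push]

theorem vis_visit_mono (N : Network) (σ : Dfs) (w e x : ℕ) (h : σ.vis x = σ.stamp) :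
    (σ.visit N w e).vis x = σ.stamp := by
  unfold Dfs.visit
  split_ifs
  · exact h
  · simp only [mark, push, Function.update_apply]
    split_ifs
    · rfl
    · exact h

theorem vis_visit_self (N : Network) (σ : Dfs) (w e : ℕ) :
    (σ.visit N w e).vis w = σ.stamp := by
  unfold Dfs.visit
  split_ifs with h
  · exact h
  · simp [mark, push]

theorem stamp_visit (N : Network) (σ : Dfs) (w e : ℕ) : (σ.visit N w e).stamp = σ.stamp := by
  unfold Dfs.visit
  split_ifs <;> rfl

theorem vis_step_mono (N : Network) (c : ℕ → ℕ) (σ : Dfs) (x : ℕ) (h : σ.vis x = σ.stamp) :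
    (σ.step N c).vis x = σ.stamp := by
  unfold Dfs.step
  split
  · exact h
  · split_ifs
    · exact h
    · exact h
    · exact vis_visit_mono N (σ.advance N _) _ _ x h

/-- Each step passes an arc or finishes a node. -/
theorem potential_step (hN : N.IsAdj) (I : Inv N c Rt B 0 σ) (hs : σ.stk ≠ []) :
    2 * (σ.step N c).unpassed N + (σ.step N c).stk.length + 1 ≤
        2 * σ.unpassed N + σ.stk.length ∧
      (σ.step N c).stk.length + (σ.step N c).done.length + (σ.step N c).unpassed N ≤
        σ.stk.length + σ.done.length + σ.unpassed N := by
  unfold Dfs.step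
  split
  · next h => exact absurd h hs
  · next u K hs =>
    split_ifs with h0 hc
    · have : unpassed N { σ with stk := K, done := u :: σ.done } = σ.unpassed N := rfl
      simp only [this, hs, List.length_cons]
      omega
    · have := unpassed_advance hN I hs h0
      simp only [Dfs.advance] at this ⊢
      omega
    · have h1 := unpassed_advance hN I hs h0
      have h2 := unpassed_visit N (σ.advance N u) (N.dst (σ.cur u)) (σ.cur u)
      have h3 := length_visit N (σ.advance N u) (N.dst (σ.cur u)) (σ.cur u)
      have h4 : (σ.advance N u).stk = σ.stk := rfl
      have h5 : (σ.advance N u).done = σ.done := rfl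
      rw [h4, h5] at h3
      rw [h3.2]
      omega

end Dfs

/-! ### Cuts of a network -/

namespace Network

/-- The contribution of an arc to the capacity of the cut `S`. -/
def arcCut (N : Network) (S : Finset ℕ) (h : ℕ) : ℤ :=
  if N.frm h ∈ S ∧ N.dst h ∉ S then N.cap h else 0

/-- The contribution of the arcs between a node and the source or the sink. -/
def nodeCut (N : Network) (S : Finset ℕ) (u : ℕ) : ℤ :=
  if u ∈ S then N.snk u else N.src u

/-- The residual capacity of the cut whose source side is `S`, in a network with nodes below `M`. -/
def cut (N : Network) (M : ℕ) (S : Finset ℕ) : ℤ :=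
  ∑ h ∈ Finset.Icc 1 N.size, N.arcCut S h + ∑ u ∈ Finset.range M, N.nodeCut S u

/-- A network with all nodes below `M`, such that the nodes adjacent to the source or the sink are
ends of arcs. -/
structure Wf (N : Network) (M : ℕ) : Prop extends N.IsAdj where
  dst_lt : ∀ h, N.IsArc h → N.dst h < M
  src_node : ∀ u, N.src u ≠ 0 → ∃ h, N.IsArc h ∧ N.dst h = u
  snk_node : ∀ u, N.snk u ≠ 0 → ∃ h, N.IsArc h ∧ N.dst h = u

theorem cut_nonneg (N : Network) (M : ℕ) (S : Finset ℕ) : 0 ≤ N.cut M S := by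
  refine add_nonneg (Finset.sum_nonneg fun h _ => ?_) (Finset.sum_nonneg fun u _ => ?_)
  · unfold arcCut; split_ifs <;> simp
  · unfold nodeCut; split_ifs <;> simp

/-- A closed set is a residual cut of capacity `0`, hence a minimum cut. -/
theorem cut_eq_zero_iff {N : Network} {M : ℕ} (hN : N.Wf M) (S : Finset ℕ) :
    N.cut M S = 0 ↔ N.IsClosed S := by
  have h1 : ∀ h ∈ Finset.Icc 1 N.size, 0 ≤ N.arcCut S h := fun h _ => by
    unfold arcCut; split_ifs <;> simp
  have h2 : ∀ u ∈ Finset.range M, 0 ≤ N.nodeCut S u := fun h _ => by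
    unfold nodeCut; split_ifs <;> simp
  rw [cut, add_eq_zero_iff_of_nonneg (Finset.sum_nonneg h1) (Finset.sum_nonneg h2),
    Finset.sum_eq_zero_iff_of_nonneg h1, Finset.sum_eq_zero_iff_of_nonneg h2]
  constructor
  · rintro ⟨ha, hb⟩
    have hb' : ∀ u, (∃ h, N.IsArc h ∧ N.dst h = u) → N.nodeCut S u = 0 := by
      rintro u ⟨h, hh, rfl⟩
      exact hb _ (Finset.mem_range.2 (hN.dst_lt h hh))
    refine ⟨fun u hu => ?_, fun u hu => ?_, ?_⟩
    · by_contra hS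
      have := hb' u (hN.src_node u hu)
      simp [nodeCut, hS, hu] at this
    · by_contra hs
      have := hb' u (hN.snk_node u hs)
      simp [nodeCut, hu, hs] at this
    · rintro u hu w ⟨h, hh, rfl, rfl, hc⟩
      by_contra hS
      have := ha h (Finset.mem_Icc.2 hh)
      simp [arcCut, hu, hS, hc] at this
  · rintro ⟨hsrc, hsnk, hedge⟩
    refine ⟨fun h hh => ?_, fun u _ => ?_⟩
    · unfold arcCut
      split_ifs with hc
      · by_contra hne
        exact hc.2 (hedge _ hc.1 _ ⟨h, Finset.mem_Icc.1 hh, rfl, rfl, by simpa using hne⟩)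
      · rfl
    · unfold nodeCut
      split_ifs with hu
      · simp [hsnk u hu]
      · by_contra hne
        exact hu (hsrc u (by simpa using hne))

/-- One unit is sent along the arc `e`. -/
def pushArc (N : Network) (e : ℕ) : Network :=
  let cap' := Function.update N.cap e (N.cap e - 1)
  { N with cap := Function.update cap' (N.mate e) (cap' (N.mate e) + 1) }

/-- One unit is sent from `w` to the sink. -/
def drainSnk (N : Network) (w : ℕ) : Network :=
  { N with snk := Function.update N.snk w (N.snk w - 1) }

/-- One unit is sent from the source to `w`. -/
def drainSrc (N : Network) (w : ℕ) : Network :=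
  { N with src := Function.update N.src w (N.src w - 1) }

theorem IsAdj.of_eq {N N' : Network} (hN : N.IsAdj) (h1 : N'.size = N.size) (h2 : N'.dst = N.dst)
    (h3 : N'.mate = N.mate) (h4 : N'.nxt = N.nxt) (h5 : N'.head = N.head) : N'.IsAdj := by
  cases N; cases N'; simp only at h1 h2 h3 h4 h5; subst h1 h2 h3 h4 h5
  exact ⟨hN.1, hN.2, hN.3, hN.4, hN.5, hN.6, hN.7, hN.8, hN.9, hN.10⟩

theorem Wf.pushArc {N : Network} {M : ℕ} (hN : N.Wf M) (e : ℕ) : (N.pushArc e).Wf M :=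
  { toIsAdj := hN.toIsAdj.of_eq rfl rfl rfl rfl rfl
    dst_lt := hN.dst_lt
    src_node := hN.src_node
    snk_node := hN.snk_node }

theorem Wf.drainSnk {N : Network} {M : ℕ} (hN : N.Wf M) (w : ℕ) : (N.drainSnk w).Wf M :=
  { toIsAdj := hN.toIsAdj.of_eq rfl rfl rfl rfl rfl
    dst_lt := hN.dst_lt
    src_node := hN.src_node
    snk_node := fun u hu => hN.snk_node u fun h => hu (by
      simp only [Network.drainSnk, Function.update_apply]; split_ifs with hw
      · subst hw; omega
      · exact h) }

theorem Wf.drainSrc {N : Network} {M : ℕ} (hN : N.Wf M) (w : ℕ) : (N.drainSrc w).Wf M :=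
  { toIsAdj := hN.toIsAdj.of_eq rfl rfl rfl rfl rfl
    dst_lt := hN.dst_lt
    snk_node := hN.snk_node
    src_node := fun u hu => hN.src_node u fun h => hu (by
      simp only [Network.drainSrc, Function.update_apply]; split_ifs with hw
      · subst hw; omega
      · exact h) }

/-- Sending a unit along an arc changes all cuts in a way that depends on the ends of the arc only. -/
theorem cut_pushArc {N : Network} {M : ℕ} (hN : N.Wf M) {e : ℕ} (he : N.IsArc e)
    (hc : N.cap e ≠ 0) (S : Finset ℕ) :
    (N.pushArc e).cut M S + (if N.frm e ∈ S then 1 else 0) =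
      N.cut M S + (if N.dst e ∈ S then 1 else 0) := by
  have hne := hN.mate_ne e he
  have hcap : ∀ h, ((N.pushArc e).cap h : ℤ) =
      N.cap h + ((if h = N.mate e then 1 else 0) - (if h = e then 1 else 0)) := by
    intro h
    simp only [pushArc, Function.update_apply]
    by_cases h1 : h = N.mate e
    · subst h1; simp [hne]
    · by_cases h2 : h = e
      · subst h2; simp [h1]; omega
      · simp [h1, h2]
  have harc : ∀ h, (N.pushArc e).arcCut S h = N.arcCut S h +
      ((if h = N.mate e then (if N.frm h ∈ S ∧ N.dst h ∉ S then 1 else 0) else 0) -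
       (if h = e then (if N.frm h ∈ S ∧ N.dst h ∉ S then 1 else 0) else 0)) := by
    intro h
    unfold arcCut
    rw [hcap]
    change (if N.frm h ∈ S ∧ N.dst h ∉ S then _ else _) = _
    split_ifs <;> simp
  have hsum : (N.pushArc e).cut M S = N.cut M S +
      ((if N.dst e ∈ S ∧ N.frm e ∉ S then 1 else 0) -
        (if N.frm e ∈ S ∧ N.dst e ∉ S then 1 else 0)) := by
    have hm := hN.mate_mem e he
    unfold cut
    simp only [harc, Finset.sum_add_distrib, Finset.sum_sub_distrib]
    change ∑ h ∈ Finset.Icc 1 N.size, _ + _ + ∑ u ∈ Finset.range M, N.nodeCut S u = _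
    have e1 : (Network.pushArc N e).size = N.size := rfl
    have hd : N.dst (N.mate e) = N.frm e := rfl
    rw [e1, Finset.sum_ite_eq' , Finset.sum_ite_eq', if_pos (Finset.mem_Icc.2 hm),
      if_pos (Finset.mem_Icc.2 he), hN.frm_mate he]
    simp only [hd]
    ring
  rw [hsum]
  split_ifs <;> first | omega | tauto

theorem cut_drainSnk {N : Network} {M : ℕ} {w : ℕ} (hw : w < M) (hc : N.snk w ≠ 0)
    (S : Finset ℕ) : (N.drainSnk w).cut M S + (if w ∈ S then 1 else 0) = N.cut M S := by
  have hnode : ∀ u, (N.drainSnk w).nodeCut S u =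
      N.nodeCut S u - (if u = w then (if u ∈ S then 1 else 0) else 0) := by
    intro u
    by_cases hu : u = w
    · subst hu
      simp only [nodeCut, drainSnk, Function.update_self, if_true]
      split_ifs <;> omega
    · simp [nodeCut, drainSnk, hu]
  unfold cut
  simp only [hnode, Finset.sum_sub_distrib, Finset.sum_ite_eq', Finset.mem_range, hw, if_true]
  change ∑ h ∈ Finset.Icc 1 N.size, N.arcCut S h + _ + _ = _
  ring

theorem cut_drainSrc {N : Network} {M : ℕ} {w : ℕ} (hw : w < M) (hc : N.src w ≠ 0)
    (S : Finset ℕ) : (N.drainSrc w).cut M S + 1 = N.cut M S + (if w ∈ S then 1 else 0) := by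
  have hnode : ∀ u, (N.drainSrc w).nodeCut S u =
      N.nodeCut S u - (if u = w then (if u ∈ S then 0 else 1) else 0) := by
    intro u
    by_cases hu : u = w
    · subst hu
      simp only [nodeCut, drainSrc, Function.update_self, if_true]
      split_ifs <;> omega
    · simp [nodeCut, drainSrc, hu]
  unfold cut
  simp only [hnode, Finset.sum_sub_distrib, Finset.sum_ite_eq', Finset.mem_range, hw, if_true]
  change ∑ h ∈ Finset.Icc 1 N.size, N.arcCut S h + _ + _ = _
  split_ifs <;> ring

end Network

/-! ### Cuts and assignments -/

/-- The node of the value `a` of the variable `v`. -/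
def node (k v a : ℕ) : ℕ := v * (k + 1) + a

/-- The value `a` rounds the set `p` of values: `a` is the only element of `p`, or `a = 0` and `p` is empty or
has several elements. -/
def Rounds {k : ℕ} (p : Fin k → Prop) (a : Fin (k + 1)) : Prop :=
  (∀ j : Fin k, a = j.succ → ∀ i, p i ↔ i = j) ∧
    (a = 0 → (∀ i, ¬ p i) ∨ ∃ i j, i ≠ j ∧ p i ∧ p j)

/-- The cut that represents the soft constraint `x = π(y)`. -/
def permSum {k : ℕ} (π : Equiv.Perm (Fin k)) (p q : Fin k → Prop) [DecidablePred p]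
    [DecidablePred q] : ℤ :=
  ∑ j, ((if p (π j) ∧ ¬ q j then 1 else 0) + (if q j ∧ ¬ p (π j) then 1 else 0))

/-- The cut that represents the soft constraint `x = d ∨ y = d'`. -/
def orSum {k : ℕ} (d d' : Fin k) (p q : Fin k → Prop) [DecidablePred p] [DecidablePred q] : ℤ :=
  ∑ j, ((if p j ∧ ¬ q d' then (if j = d then 0 else 1) else 0) +
    (if q j ∧ ¬ p d then (if j = d' then 0 else 1) else 0))

/-- The cut that represents a unary function, up to a constant. -/
def unarySum {k : ℕ} (h : Fin (k + 1) → ℕ) (p : Fin k → Prop) [DecidablePred p] : ℤ :=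
  ∑ j : Fin k, ((if p j then h j.succ - h 0 else h 0 - h j.succ : ℕ) : ℤ)

/-- The constant in the representation of a unary function. -/
def unaryConst {k : ℕ} (h : Fin (k + 1) → ℕ) : ℤ :=
  h 0 - ∑ j : Fin k, ((h 0 - h j.succ : ℕ) : ℤ)

section Local

variable {k : ℕ} {p q : Fin k → Prop} [DecidablePred p] [DecidablePred q]

theorem sum_two_le {F G : Fin k → ℤ} (hF : ∀ j, 0 ≤ F j) (hG : ∀ j, 0 ≤ G j) {i j : Fin k}
    (hi : 1 ≤ F i) (hj : 1 ≤ G j) : 2 ≤ ∑ x, (F x + G x) := by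
  rw [Finset.sum_add_distrib]
  have h1 := Finset.single_le_sum (fun x _ => hF x) (Finset.mem_univ i)
  have h2 := Finset.single_le_sum (fun x _ => hG x) (Finset.mem_univ j)
  omega

/-- Rounding a cut does not increase the cost of a soft constraint `x = π(y)`. -/
theorem le_permSum (π : Equiv.Perm (Fin k)) {a b : Fin (k + 1)} (ha : Rounds p a)
    (hb : Rounds q b) : 2 * permCost π a b ≤ permSum π p q := by
  have h1 : ∀ j, (0 : ℤ) ≤ if p (π j) ∧ ¬ q j then 1 else 0 := fun j => by split_ifs <;> simp
  have h2 : ∀ j, (0 : ℤ) ≤ if q j ∧ ¬ p (π j) then 1 else 0 := fun j => by split_ifs <;> simp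
  have h0 : 0 ≤ permSum π p q := Finset.sum_nonneg fun j _ => add_nonneg (h1 j) (h2 j)
  -- a single value on which the two sides disagree costs one edge
  have hone : (∃ j, ¬ (p (π j) ↔ q j)) → 1 ≤ permSum π p q := by
    rintro ⟨j, hj⟩
    refine le_trans ?_ (Finset.single_le_sum
      (fun j _ => add_nonneg (h1 j) (h2 j)) (Finset.mem_univ j))
    by_cases hp : p (π j) <;> by_cases hq : q j <;> simp [hp, hq] at hj ⊢
  unfold permCost
  split_ifs with c1 c2 c3
  · simpa using h0
  · have : 1 ≤ permSum π p q := by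
      apply hone
      by_contra hcon
      push Not at hcon
      rcases c2 with rfl | rfl
      · obtain ⟨j, rfl⟩ := Fin.exists_succ_eq.2 (fun h => c1 ⟨rfl, h⟩)
        have hq := hb.1 j rfl
        rcases ha.2 rfl with hp | ⟨i, i', hne, hpi, hpi'⟩
        · exact hp _ ((hcon j).2 ((hq j).2 rfl))
        · have e1 := (hq _).1 ((hcon (π.symm i)).1 (by simpa using hpi))
          have e2 := (hq _).1 ((hcon (π.symm i')).1 (by simpa using hpi'))
          exact hne (π.symm.injective (e1.trans e2.symm))
      · obtain ⟨j, rfl⟩ := Fin.exists_succ_eq.2 (fun h => c1 ⟨h, rfl⟩)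
        have hp := ha.1 j rfl
        rcases hb.2 rfl with hq | ⟨i, i', hne, hqi, hqi'⟩
        · exact hq (π.symm j) ((hcon _).1 (by simp [hp]))
        · have e1 := (hp _).1 ((hcon i).2 hqi)
          have e2 := (hp _).1 ((hcon i').2 hqi')
          exact hne (π.injective (e1.trans e2.symm))
    have : (1 : ℚ) ≤ permSum π p q := by exact_mod_cast this
    linarith
  · simpa using h0
  · push Not at c2
    obtain ⟨i, rfl⟩ := Fin.exists_succ_eq.2 c2.1
    obtain ⟨j, rfl⟩ := Fin.exists_succ_eq.2 c2.2
    have hp := ha.1 i rfl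
    have hq := hb.1 j rfl
    have hij : π j ≠ i := fun h => c3 ⟨j, rfl, by rw [h]⟩
    have : 2 ≤ permSum π p q := by
      refine sum_two_le h1 h2 (i := π.symm i) (j := j) ?_ ?_
      · have : ¬ π.symm i = j := fun h => hij (by rw [← h]; simp)
        simp [hp, hq, this]
      · simp [hp, hq, hij]
    have : (2 : ℚ) ≤ permSum π p q := by exact_mod_cast this
    linarith

theorem permSum_eq (π : Equiv.Perm (Fin k)) {a b : Fin (k + 1)} (ha : ∀ i, p i ↔ a = i.succ)
    (hb : ∀ i, q i ↔ b = i.succ) : permSum π p q = 2 * permCost π a b := by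
  have hs : ∀ i : Fin k, (0 : Fin (k + 1)) ≠ i.succ := fun i => (Fin.succ_ne_zero i).symm
  have hx : ∀ i j : Fin k, i = π j ↔ j = π.symm i := fun i j => by
    rw [Equiv.eq_symm_apply, eq_comm]
  unfold permSum permCost
  simp only [ha, hb]
  induction a using Fin.cases with
  | zero =>
    induction b using Fin.cases with
    | zero => simp [hs]
    | succ j => simp [hs, Fin.succ_inj]
  | succ i =>
    induction b using Fin.cases with
    | zero => simp [hs, Fin.succ_inj, hx]
    | succ j =>
      simp only [Fin.succ_inj, Fin.succ_ne_zero, false_and, if_false, or_self, exists_eq_left',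
        Finset.sum_add_distrib]
      by_cases hij : i = π j
      · subst hij
        simp only [if_true]
        simp
      · rw [if_neg hij]
        have e1 : ∀ x, (if i = π x ∧ ¬ j = x then (1 : ℤ) else 0) =
            if x = π.symm i then 1 else 0 := by
          intro x
          simp only [hx i x]
          by_cases h : x = π.symm i
          · have : ¬ j = x := by rintro rfl; exact hij ((hx _ _).2 h)
            simp [h]
            rintro rfl; simp at hij
          · simp [h]
        have e2 : ∀ x, (if j = x ∧ ¬ i = π x then (1 : ℤ) else 0) =
            if x = j then 1 else 0 := by
          intro x
          by_cases h : x = j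
          · subst h; simp [hij]
          · simp [h, Ne.symm h]
        simp only [e1, e2, Finset.sum_ite_eq', Finset.mem_univ, if_true]
        norm_num

/-- Rounding a cut does not increase the cost of a soft constraint `x = d ∨ y = d'`. -/
theorem le_orSum (d d' : Fin k) {a b : Fin (k + 1)} (ha : Rounds p a)
    (hb : Rounds q b) : 2 * orCost d d' a b ≤ orSum d d' p q := by
  have h1 : ∀ j, (0 : ℤ) ≤ if p j ∧ ¬ q d' then (if j = d then 0 else 1) else 0 :=
    fun j => by split_ifs <;> simp
  have h2 : ∀ j, (0 : ℤ) ≤ if q j ∧ ¬ p d then (if j = d' then 0 else 1) else 0 :=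
    fun j => by split_ifs <;> simp
  have h0 : 0 ≤ orSum d d' p q := Finset.sum_nonneg fun j _ => add_nonneg (h1 j) (h2 j)
  have hone1 : ∀ j, p j → ¬ q d' → j ≠ d → 1 ≤ orSum d d' p q := by
    intro j hpj hqd hj
    refine le_trans ?_ (Finset.single_le_sum
      (fun j _ => add_nonneg (h1 j) (h2 j)) (Finset.mem_univ j))
    have := h2 j
    simp only [hpj, hqd, hj, not_false_eq_true, and_self, if_true, if_false] at this ⊢
    omega
  have hone2 : ∀ j, q j → ¬ p d → j ≠ d' → 1 ≤ orSum d d' p q := by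
    intro j hpj hqd hj
    refine le_trans ?_ (Finset.single_le_sum
      (fun j _ => add_nonneg (h1 j) (h2 j)) (Finset.mem_univ j))
    have := h1 j
    simp only [hpj, hqd, hj, not_false_eq_true, and_self, if_true, if_false] at this ⊢
    omega
  unfold orCost
  split_ifs with c0 c1 c2
  · simpa using h0
  · simpa using h0
  · push Not at c0
    have : 1 ≤ orSum d d' p q := by
      rcases c2 with rfl | rfl
      · obtain ⟨j, rfl⟩ := Fin.exists_succ_eq.2 (fun h => c1 ⟨rfl, h⟩)
        have hq := hb.1 j rfl
        have hj : j ≠ d' := fun h => c0.2 (by rw [h])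
        rcases ha.2 rfl with hp | ⟨i, i', hne, hpi, hpi'⟩
        · exact hone2 j ((hq j).2 rfl) (hp d) hj
        · have hqd : ¬ q d' := fun h => hj ((hq _).1 h).symm
          by_cases hid : i = d
          · exact hone1 i' hpi' hqd (fun h => hne (hid.trans h.symm))
          · exact hone1 i hpi hqd hid
      · obtain ⟨j, rfl⟩ := Fin.exists_succ_eq.2 (fun h => c1 ⟨h, rfl⟩)
        have hp := ha.1 j rfl
        have hj : j ≠ d := fun h => c0.1 (by rw [h])
        rcases hb.2 rfl with hq | ⟨i, i', hne, hqi, hqi'⟩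
        · exact hone1 j ((hp j).2 rfl) (hq d') hj
        · have hpd : ¬ p d := fun h => hj ((hp _).1 h).symm
          by_cases hid : i = d'
          · exact hone2 i' hqi' hpd (fun h => hne (hid.trans h.symm))
          · exact hone2 i hqi hpd hid
    have : (1 : ℚ) ≤ orSum d d' p q := by exact_mod_cast this
    linarith
  · push Not at c0 c2
    obtain ⟨i, rfl⟩ := Fin.exists_succ_eq.2 c2.1
    obtain ⟨j, rfl⟩ := Fin.exists_succ_eq.2 c2.2
    have hp := ha.1 i rfl
    have hq := hb.1 j rfl
    have hi : ¬ i = d := fun h => c0.1 (by rw [h])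
    have hj : ¬ j = d' := fun h => c0.2 (by rw [h])
    have : 2 ≤ orSum d d' p q := by
      refine sum_two_le h1 h2 (i := i) (j := j) ?_ ?_
      · simp [hp, hq, hi, Ne.symm hj]
      · simp [hp, hq, hj, Ne.symm hi]
    have : (2 : ℚ) ≤ orSum d d' p q := by exact_mod_cast this
    linarith

theorem orSum_eq (d d' : Fin k) {a b : Fin (k + 1)} (ha : ∀ i, p i ↔ a = i.succ)
    (hb : ∀ i, q i ↔ b = i.succ) : orSum d d' p q = 2 * orCost d d' a b := by
  have hs : ∀ i : Fin k, (0 : Fin (k + 1)) ≠ i.succ := fun i => (Fin.succ_ne_zero i).symm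
  have key : ∀ (i d : Fin k) (P : Prop) [Decidable P],
      ∑ x, (if i = x ∧ ¬ P then (if x = d then (0 : ℤ) else 1) else 0) =
        if P ∨ i = d then 0 else 1 := by
    intro i d P _
    have : ∀ x, (if i = x ∧ ¬ P then (if x = d then (0 : ℤ) else 1) else 0) =
        if x = i then (if P ∨ i = d then 0 else 1) else 0 := by
      intro x
      by_cases h : x = i
      · subst h; by_cases P <;> simp [*]
      · simp [h, Ne.symm h]
    simp only [this, Finset.sum_ite_eq', Finset.mem_univ, if_true]
  unfold orSum orCost
  simp only [ha, hb]
  induction a using Fin.cases with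
  | zero =>
    induction b using Fin.cases with
    | zero => simp [hs]
    | succ j =>
      have := key j d' False
      simp only [not_false_eq_true, and_true, false_or] at this
      simp only [hs, Fin.succ_inj, false_and, not_false_eq_true, and_true, if_false, zero_add,
        false_or, true_or, this, Fin.succ_ne_zero, and_false]
      split_ifs <;> simp
  | succ i =>
    induction b using Fin.cases with
    | zero =>
      have := key i d False
      simp only [not_false_eq_true, and_true, false_or] at this
      simp only [hs, Fin.succ_inj, false_and, not_false_eq_true, and_true, if_false, add_zero,
        or_false, or_true, this, Fin.succ_ne_zero]
      split_ifs <;> simp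
    | succ j =>
      simp only [Fin.succ_inj, Fin.succ_ne_zero, and_self, or_self, if_false,
        Finset.sum_add_distrib, key]
      by_cases h1 : i = d <;> by_cases h2 : j = d' <;> simp [h1, h2]

theorem unarySum_add_const (h : Fin (k + 1) → ℕ) :
    unarySum h p + unaryConst h = h 0 + ∑ j, if p j then (h j.succ : ℤ) - h 0 else 0 := by
  unfold unarySum unaryConst
  have : ∀ j : Fin k, ((if p j then h j.succ - h 0 else h 0 - h j.succ : ℕ) : ℤ) =
      ((h 0 - h j.succ : ℕ) : ℤ) + if p j then (h j.succ : ℤ) - h 0 else 0 := by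
    intro j
    split_ifs <;> omega
  simp only [this, Finset.sum_add_distrib]
  ring

/-- Two different values cost on average at least as much as `0`. -/
theorem two_mul_le_of_isKSubmodular {h : Fin (k + 1) → ℕ}
    (hsub : IsKSubmodular fun x : Fin 1 → Fin (k + 1) => (h (x 0) : ℚ) / 2) {i j : Fin k}
    (hij : i ≠ j) : 2 * h 0 ≤ h i.succ + h j.succ := by
  have := hsub (fun _ => i.succ) (fun _ => j.succ)
  simp only [kMeet, kJoin, Fin.succ_inj, hij, if_false, Fin.succ_ne_zero] at this
  have h' : (2 * h 0 : ℚ) ≤ h i.succ + h j.succ := by linarith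
  exact_mod_cast h'

theorem unaryConst_nonneg {h : Fin (k + 1) → ℕ}
    (hsub : IsKSubmodular fun x : Fin 1 → Fin (k + 1) => (h (x 0) : ℚ) / 2) :
    0 ≤ unaryConst h := by
  unfold unaryConst
  by_cases hall : ∀ j : Fin k, h 0 ≤ h j.succ
  · rw [Finset.sum_eq_zero]
    · simp
    · intro j _
      have := hall j
      omega
  · push Not at hall
    obtain ⟨i, hi⟩ := hall
    rw [Finset.sum_eq_single i]
    · omega
    · intro j _ hj
      have := two_mul_le_of_isKSubmodular hsub hj
      omega
    · simp

/-- Rounding a cut does not increase a unary function: a variable with several values pays at least as much as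
for `0`. -/
theorem le_unarySum {h : Fin (k + 1) → ℕ}
    (hsub : IsKSubmodular fun x : Fin 1 → Fin (k + 1) => (h (x 0) : ℚ) / 2) {a : Fin (k + 1)}
    (ha : Rounds p a) : (h a : ℤ) ≤ unarySum h p + unaryConst h := by
  rw [unarySum_add_const]
  induction a using Fin.cases with
  | succ i =>
    have := ha.1 i rfl
    simp [this]
  | zero =>
    rcases ha.2 rfl with hp | ⟨i, i', hne, hpi, hpi'⟩
    · simp [hp]
    · -- at most one of the summands is negative, and it is outweighed by any other one
      have hex : ∃ i i', i ≠ i' ∧ p i ∧ p i' ∧ ∀ j, p j → j ≠ i → h 0 ≤ h j.succ := by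
        by_cases hall : ∀ j : Fin k, p j → h 0 ≤ h j.succ
        · exact ⟨i, i', hne, hpi, hpi', fun j hj _ => hall j hj⟩
        · push Not at hall
          obtain ⟨l, hpl, hl⟩ := hall
          have hl' : ∀ j, p j → j ≠ l → h 0 ≤ h j.succ := fun j _ hj => by
            have := two_mul_le_of_isKSubmodular hsub hj
            omega
          by_cases hil : i = l
          · exact ⟨i, i', hne, hpi, hpi', hil ▸ hl'⟩
          · exact ⟨l, i, Ne.symm hil, hpl, hpi, hl'⟩
      obtain ⟨i, i', hne, hpi, hpi', hpos⟩ := hex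
      have h1 := two_mul_le_of_isKSubmodular hsub hne
      have h2 : ∑ j ∈ {i, i'}, (if p j then (h j.succ : ℤ) - h 0 else 0) ≤
          ∑ j, if p j then (h j.succ : ℤ) - h 0 else 0 := by
        refine Finset.sum_le_sum_of_subset_of_nonneg (Finset.subset_univ _) fun j _ hj => ?_
        have : j ≠ i := by rintro rfl; simp at hj
        have := hpos j
        split_ifs with hpj
        · have := this hpj ‹_›
          omega
        · exact le_rfl
      rw [Finset.sum_pair hne, if_pos hpi, if_pos hpi'] at h2
      omega

theorem unarySum_eq (h : Fin (k + 1) → ℕ) {a : Fin (k + 1)} (ha : ∀ i, p i ↔ a = i.succ) :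
    unarySum h p + unaryConst h = h a := by
  rw [unarySum_add_const]
  induction a using Fin.cases with
  | zero => simp [ha, (Fin.succ_ne_zero _).symm]
  | succ i => simp [ha, Fin.succ_inj]

end Local

section Assignments

variable {k n : ℕ}

theorem node_inj {v w a b : ℕ} (ha : a ≤ k) (hb : b ≤ k) (h : node k v a = node k w b) :
    v = w ∧ a = b := by
  unfold node at h
  have h1 : (v * (k + 1) + a) / (k + 1) = v := by
    rw [mul_comm, Nat.mul_add_div (by omega), Nat.div_eq_of_lt (by omega), add_zero]
  have h2 : (w * (k + 1) + b) / (k + 1) = w := by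
    rw [mul_comm, Nat.mul_add_div (by omega), Nat.div_eq_of_lt (by omega), add_zero]
  have hvw : v = w := by rw [← h1, ← h2, h]
  subst hvw
  exact ⟨rfl, by omega⟩

/-- The capacity of the cut `S` in the network of a basic function. -/
def BasicFn.cutVal (S : Finset ℕ) : BasicFn k n → ℤ
  | .unary v h _ => unarySum h fun j => node k v j.succ ∈ S
  | .perm x y π => permSum π (fun j => node k x j.succ ∈ S) fun j => node k y j.succ ∈ S
  | .or x d y d' => orSum d d' (fun j => node k x j.succ ∈ S) fun j => node k y j.succ ∈ S

/-- The difference between (twice) a basic function and the cuts in its network. -/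
def BasicFn.constVal : BasicFn k n → ℤ
  | .unary _ h _ => unaryConst h
  | .perm _ _ _ => 0
  | .or _ _ _ _ => 0

theorem BasicFn.constVal_nonneg (g : BasicFn k n) : 0 ≤ g.constVal := by
  cases g with
  | unary v h hsub => exact unaryConst_nonneg hsub
  | perm => exact le_rfl
  | or => exact le_rfl

/-- The cut that represents an assignment. -/
def nodeSet (φ : Fin n → Fin (k + 1)) : Finset ℕ :=
  (Finset.univ.filter fun v : Fin n => φ v ≠ 0).image fun v : Fin n => node k v (φ v)

theorem mem_nodeSet_iff {φ : Fin n → Fin (k + 1)} {x : ℕ} :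
    x ∈ nodeSet φ ↔ ∃ v : Fin n, φ v ≠ 0 ∧ node k v (φ v) = x := by
  simp [nodeSet]

theorem node_mem_nodeSet {φ : Fin n → Fin (k + 1)} {v : Fin n} {j : Fin k} :
    node k v j.succ ∈ nodeSet φ ↔ φ v = j.succ := by
  rw [mem_nodeSet_iff]
  constructor
  · rintro ⟨w, -, h⟩
    obtain ⟨h1, h2⟩ := node_inj (by omega) (by omega) h
    rw [← Fin.ext h1]
    exact Fin.ext h2
  · intro h
    exact ⟨v, by rw [h]; exact Fin.succ_ne_zero j, by rw [h]⟩

/-- Rounding a cut to an assignment does not increase the value. -/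
theorem BasicFn.eval_le_cutVal {S : Finset ℕ} {φ : Fin n → Fin (k + 1)}
    (h : ∀ v : Fin n, Rounds (fun j => node k v j.succ ∈ S) (φ v)) (g : BasicFn k n) :
    2 * g.eval φ ≤ g.cutVal S + g.constVal := by
  cases g with
  | unary v c hsub =>
    have := le_unarySum hsub (h v)
    have : (c (φ v) : ℚ) ≤ unarySum c (fun j => node k v j.succ ∈ S) + unaryConst c := by
      exact_mod_cast this
    simp only [eval, cutVal, constVal]
    linarith
  | perm x y π =>
    have := le_permSum π (h x) (h y)
    simpa [eval, cutVal, constVal] using this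
  | or x d y d' =>
    have := le_orSum d d' (h x) (h y)
    simpa [eval, cutVal, constVal] using this

/-- The cut of an assignment has the value of the assignment. -/
theorem BasicFn.cutVal_nodeSet (φ : Fin n → Fin (k + 1)) (g : BasicFn k n) :
    (g.cutVal (nodeSet φ) + g.constVal : ℚ) = 2 * g.eval φ := by
  cases g with
  | unary v c hsub =>
    have := unarySum_eq (p := fun j => node k v j.succ ∈ nodeSet φ) c
      fun i => node_mem_nodeSet
    have : (unarySum c (fun j => node k v j.succ ∈ nodeSet φ) + unaryConst c : ℚ) = c (φ v) := by
      exact_mod_cast this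
    simp only [eval, cutVal, constVal]
    linarith
  | perm x y π =>
    have := permSum_eq (p := fun j => node k x j.succ ∈ nodeSet φ)
      (q := fun j => node k y j.succ ∈ nodeSet φ) π
      (fun i => node_mem_nodeSet) fun i => node_mem_nodeSet
    simpa [eval, cutVal, constVal] using this
  | or x d y d' =>
    have := orSum_eq (p := fun j => node k x j.succ ∈ nodeSet φ)
      (q := fun j => node k y j.succ ∈ nodeSet φ) d d'
      (fun i => node_mem_nodeSet) fun i => node_mem_nodeSet
    simpa [eval, cutVal, constVal] using this

/-- The sum of the cuts of all summands. -/
def sumCut (I : List (BasicFn k n)) (S : Finset ℕ) : ℤ := (I.map (BasicFn.cutVal S)).sum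

/-- The sum of the constants of all summands. -/
def sumConst (I : List (BasicFn k n)) : ℤ := (I.map BasicFn.constVal).sum

theorem sumConst_nonneg (I : List (BasicFn k n)) : 0 ≤ sumConst I :=
  List.sum_nonneg fun x hx => by
    obtain ⟨g, -, rfl⟩ := List.mem_map.1 hx
    exact g.constVal_nonneg

theorem sumFn_le_sumCut {S : Finset ℕ} {φ : Fin n → Fin (k + 1)}
    (h : ∀ v : Fin n, Rounds (fun j => node k v j.succ ∈ S) (φ v)) (I : List (BasicFn k n)) :
    2 * sumFn I φ ≤ sumCut I S + sumConst I := by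
  induction I with
  | nil => simp [sumFn, sumCut, sumConst]
  | cons g I ih =>
    have := g.eval_le_cutVal h
    simp only [sumFn, sumCut, sumConst, List.map_cons, List.sum_cons] at ih ⊢
    rw [Int.cast_add, Int.cast_add]
    linarith

theorem sumCut_nodeSet (φ : Fin n → Fin (k + 1)) (I : List (BasicFn k n)) :
    (sumCut I (nodeSet φ) + sumConst I : ℚ) = 2 * sumFn I φ := by
  induction I with
  | nil => simp [sumFn, sumCut, sumConst]
  | cons g I ih =>
    have := g.cutVal_nodeSet φ
    simp only [sumFn, sumCut, sumConst, List.map_cons, List.sum_cons] at ih ⊢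
    rw [Int.cast_add, Int.cast_add]
    linarith

/-- Every cut can be rounded to an assignment, by giving up the variables with several values. -/
theorem exists_rounds (S : Finset ℕ) : ∃ φ : Fin n → Fin (k + 1),
    (∀ v : Fin n, Rounds (fun j => node k v j.succ ∈ S) (φ v)) ∧ nodeSet φ ⊆ S := by
  have : ∀ v : Fin n, ∃ a : Fin (k + 1), Rounds (fun j : Fin k => node k v j.succ ∈ S) a ∧
      ∀ j : Fin k, a = j.succ → node k v j.succ ∈ S := by
    intro v
    by_cases h : ∃ j : Fin k, ∀ i : Fin k, node k v i.succ ∈ S ↔ i = j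
    · obtain ⟨j, hj⟩ := h
      refine ⟨j.succ, ⟨fun i hi => ?_, fun h0 => absurd h0 (Fin.succ_ne_zero j)⟩, fun i hi => ?_⟩
      · rw [← Fin.succ_injective _ hi]; exact hj
      · rw [← Fin.succ_injective _ hi]; exact (hj j).2 rfl
    · refine ⟨0, ⟨fun i hi => absurd hi.symm (Fin.succ_ne_zero i), fun _ => ?_⟩,
        fun i hi => absurd hi.symm (Fin.succ_ne_zero i)⟩
      by_contra hcon
      push Not at hcon
      obtain ⟨⟨j, hj⟩, hu⟩ := hcon
      refine h ⟨j, fun i => ⟨fun hi => ?_, fun hi => hi ▸ hj⟩⟩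
      by_contra hij
      exact hu i j hij hi hj
  choose φ h1 h2 using this
  refine ⟨φ, h1, fun x hx => ?_⟩
  obtain ⟨v, hv, rfl⟩ := mem_nodeSet_iff.1 hx
  obtain ⟨j, hj⟩ := Fin.exists_succ_eq.2 hv
  rw [← hj]
  exact h2 v j hj.symm

/-- The residual network represents the sum of the list `I`, after `r` units have been sent from the
source to the sink. -/
structure Represents (N : Network) (I : List (BasicFn k n)) (r : ℕ) : Prop where
  wf : N.Wf (n * (k + 1))
  cut : ∀ S, N.cut (n * (k + 1)) S + r = sumCut I S
  isNode : ∀ h, N.IsArc h → ∃ (v : Fin n) (j : Fin k), N.dst h = node k v j.succ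

variable {N : Network} {I : List (BasicFn k n)} {r : ℕ}

theorem Represents.two_mul_sumFn (hN : Represents N I r) (φ : Fin n → Fin (k + 1)) :
    2 * sumFn I φ = N.cut (n * (k + 1)) (nodeSet φ) + r + sumConst I := by
  rw [← sumCut_nodeSet, ← hN.cut]
  push_cast
  ring

/-- The amount of flow is a lower bound, as cuts and the constants of the summands are nonnegative. -/
theorem Represents.le_two_mul_sumFn (hN : Represents N I r) (φ : Fin n → Fin (k + 1)) :
    (r : ℚ) ≤ 2 * sumFn I φ := by
  rw [hN.two_mul_sumFn φ]
  have h1 : (0 : ℚ) ≤ N.cut (n * (k + 1)) (nodeSet φ) := by exact_mod_cast N.cut_nonneg _ _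
  have h2 : (0 : ℚ) ≤ sumConst I := by exact_mod_cast sumConst_nonneg I
  linarith

/-- If the flow is maximum, the minimum solutions are the assignments whose cuts are closed. -/
theorem Represents.isMinSol_iff (hN : Represents N I r) {R : Finset ℕ} (hR : N.IsClosed R)
    (ψ : Fin n → Fin (k + 1)) : IsMinSol (sumFn I) ψ ↔ N.IsClosed (nodeSet ψ) := by
  have hnn : ∀ φ : Fin n → Fin (k + 1), (0 : ℚ) ≤ N.cut (n * (k + 1)) (nodeSet φ) := fun φ => by
    exact_mod_cast N.cut_nonneg _ _
  obtain ⟨φ, hφ, -⟩ := exists_rounds (k := k) (n := n) R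
  have h0 := sumFn_le_sumCut hφ I
  rw [← hN.cut R, (Network.cut_eq_zero_iff hN.wf R).2 hR] at h0
  push_cast at h0
  rw [← Network.cut_eq_zero_iff hN.wf]
  constructor
  · intro h
    have h1 := h φ
    have h2 := hN.two_mul_sumFn ψ
    have h3 := hnn ψ
    have : (N.cut (n * (k + 1)) (nodeSet ψ) : ℚ) = 0 := by linarith
    exact_mod_cast this
  · intro h χ
    have h1 := hN.two_mul_sumFn ψ
    have h2 := hN.two_mul_sumFn χ
    have h3 := hnn χ
    rw [h] at h1
    push_cast at h1
    linarith

/-- The smallest closed set is the cut of an assignment: rounding it does not increase the cut, so the rounded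
set is closed too, and contains everything that is reachable from the source. -/
theorem Represents.exists_nodeSet_eq (hN : Represents N I r) {R : Finset ℕ} (hR : N.IsClosed R)
    (hreach : ∀ x ∈ R, ∃ u, N.src u ≠ 0 ∧ N.Reach N.cap u x) :
    ∃ φ : Fin n → Fin (k + 1), nodeSet φ = R := by
  obtain ⟨φ, hφ, hsub⟩ := exists_rounds (k := k) (n := n) R
  have h0 := sumFn_le_sumCut hφ I
  rw [← hN.cut R, (Network.cut_eq_zero_iff hN.wf R).2 hR, hN.two_mul_sumFn] at h0
  have h1 := N.cut_nonneg (n * (k + 1)) (nodeSet φ)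
  have h2 : (N.cut (n * (k + 1)) (nodeSet φ) : ℚ) ≤ 0 := by
    push_cast at h0
    linarith
  have h3 : N.cut (n * (k + 1)) (nodeSet φ) = 0 := le_antisymm (by exact_mod_cast h2) h1
  have hc := (Network.cut_eq_zero_iff hN.wf _).1 h3
  refine ⟨φ, Finset.Subset.antisymm hsub fun x hx => ?_⟩
  obtain ⟨u, hu, hux⟩ := hreach x hx
  induction hux with
  | refl => exact hc.src u hu
  | tail hab hbc ih =>
    refine hc.edge _ (ih (hsub ?_)) _ hbc
    clear ih hbc hx
    induction hab with
    | refl => exact hc.src u hu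
    | tail _ hbc ih => exact hc.edge _ ih _ hbc

/-- Domination is inclusion of the cuts. -/
theorem Represents.isExtremeMinSol (hN : Represents N I r) {φ : Fin n → Fin (k + 1)}
    (hφ : N.IsClosed (nodeSet φ))
    (hmax : ∀ ψ : Fin n → Fin (k + 1), N.IsClosed (nodeSet ψ) → nodeSet φ ⊆ nodeSet ψ →
      ∀ v, φ v = 0 → ψ v = 0) : IsExtremeMinSol (sumFn I) φ := by
  refine ⟨(hN.isMinSol_iff hφ φ).2 hφ, ?_⟩
  rintro ⟨ψ, hψ, hne, hdom⟩
  refine hne (funext fun v => ?_)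
  by_cases hv : φ v = 0
  · rw [hv, hmax ψ ((hN.isMinSol_iff hφ ψ).1 hψ) ?_ v hv]
    intro x hx
    obtain ⟨w, hw, rfl⟩ := mem_nodeSet_iff.1 hx
    exact mem_nodeSet_iff.2 ⟨w, hdom w hw ▸ hw, by rw [hdom w hw]⟩
  · exact hdom v hv

end Assignments

/-! ### The memory layout -/

-- The registers: `k`, the numbers of variables and of summands (as given), the number of arcs, and the
-- input position
notation "rK" => 0
notation "rN" => 1
notation "rM" => 2
notation "rH" => 3
notation "rP" => 4
-- counters and auxiliary values; `rW` is the node and `rE` the arc at hand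
notation "rI" => 5
notation "rA" => 6
notation "rU" => 7
notation "rW" => 8
notation "rE" => 9
-- the search: the stamp of visited nodes, the length of the path, the number of entries of the array of
-- finished nodes, the node adjacent to the sink that was met, and the beginning of the present search in
-- the array of finished nodes
notation "rSt" => 10
notation "rSp" => 11
notation "rFin" => 12
notation "rTgt" => 13
notation "rBeg" => 14
-- the components: whether to reject, a counter, and the number of nodes of the postorder that remain
notation "rBad" => 15
notation "rJ" => 16
notation "rL" => 17
-- The arrays: the input and the output, and for each variable the number before its nodes
notation "aIn" => 0
notation "aOut" => 1
notation "aBase" => 2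
-- the network, as in `Network`
notation "aDst" => 3
notation "aMate" => 4
notation "aCap" => 5
notation "aNxt" => 6
notation "aHead" => 7
notation "aSrc" => 8
notation "aSnk" => 9
-- for each node, its variable and its value
notation "aVar" => 10
notation "aVal" => 11
-- the search, as in `Dfs`, with the path and the finished nodes
notation "aVis" => 12
notation "aPred" => 13
notation "aCur" => 14
notation "aStk" => 15
notation "aOrd" => 16

/-- The network in the memory. -/
def Network.ofState (s : RamState) : Network where
  size := s.var rH
  dst := s.arr aDst
  mate := s.arr aMate
  cap := s.arr aCap
  nxt := s.arr aNxt
  head := s.arr aHead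
  src := s.arr aSrc
  snk := s.arr aSnk

/-- The entries `f b, …, f (b + m - 1)`, the last one first. -/
def stackOf (f : ℕ → ℕ) (b : ℕ) : ℕ → List ℕ
  | 0 => []
  | m + 1 => f (b + m) :: stackOf f b m

theorem stackOf_congr {f g : ℕ → ℕ} {b m : ℕ} (h : ∀ i, i < b + m → f i = g i) :
    stackOf f b m = stackOf g b m := by
  induction m with
  | zero => rfl
  | succ m ih =>
    rw [stackOf, stackOf, h _ (by omega), ih fun i hi => h i (by omega)]

theorem stackOf_update {f : ℕ → ℕ} {b m i x : ℕ} (h : b + m ≤ i) :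
    stackOf (Function.update f i x) b m = stackOf f b m :=
  stackOf_congr fun j hj => Function.update_of_ne (by omega) _ _

theorem length_stackOf (f : ℕ → ℕ) (b m : ℕ) : (stackOf f b m).length = m := by
  induction m with
  | zero => rfl
  | succ m ih => rw [stackOf, List.length_cons, ih]

theorem mem_stackOf {f : ℕ → ℕ} {b m x : ℕ} :
    x ∈ stackOf f b m ↔ ∃ i, b ≤ i ∧ i < b + m ∧ f i = x := by
  induction m with
  | zero => simp only [stackOf, List.not_mem_nil, false_iff]; rintro ⟨i, h1, h2, -⟩; omega
  | succ m ih =>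
    rw [stackOf, List.mem_cons, ih]
    constructor
    · rintro (rfl | ⟨i, h1, h2, h3⟩)
      · exact ⟨b + m, by omega, by omega, rfl⟩
      · exact ⟨i, h1, by omega, h3⟩
    · rintro ⟨i, h1, h2, h3⟩
      by_cases hi : i = b + m
      · exact .inl (by rw [← h3, hi])
      · exact .inr ⟨i, h1, by omega, h3⟩

/-- The state of the search in the memory. The finished nodes are those in the array `aOrd` from
`rBeg` on. -/
def Dfs.ofState (s : RamState) : Dfs where
  vis := s.arr aVis
  pred := s.arr aPred
  cur := s.arr aCur
  stamp := s.var rSt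
  tgt := s.var rTgt
  stk := stackOf (s.arr aStk) 0 (s.var rSp)
  done := stackOf (s.arr aOrd) (s.var rBeg) (s.var rFin - s.var rBeg)

/-! ### The search program -/

/-- The node in `rW` is met, by the arc in `rE`. -/
def visitProg : RamProg := .block [
  .ite (.get aSnk (.var rW)) (.assign rTgt (.var rW)) .skip,
  .ite (.eq (.get aVis (.var rW)) (.var rSt)) .skip (.block [
    .store aVis (.var rW) (.var rSt),
    .store aPred (.var rW) (.var rE),
    .store aCur (.var rW) (.get aHead (.var rW)),
    .store aStk (.var rSp) (.var rW),
    .assign rSp (.add (.var rSp) (.const 1))])]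

/-- Is the arc in `rE` (if `b` is false: its reverse) residual? -/
def activeExpr (b : Bool) : RamExpr :=
  .get aCap (if b then .var rE else .get aMate (.var rE))

/-- The capacities along which the search goes: forward if `b` is true, else backward. -/
def Network.active (N : Network) (b : Bool) (h : ℕ) : ℕ := N.cap (if b then h else N.mate h)

/-- One step of the search. -/
def dfsBody (b : Bool) : RamProg := .block [
  .assign rU (.get aStk (.sub (.var rSp) (.const 1))),
  .assign rE (.get aCur (.var rU)),
  .ite (.var rE)
    (.block [
      .store aCur (.var rU) (.get aNxt (.var rE)),
      .ite (activeExpr b) (.block [.assign rW (.get aDst (.var rE)), visitProg]) .skip])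
    (.block [
      .assign rSp (.sub (.var rSp) (.const 1)),
      .store aOrd (.var rFin) (.var rU),
      .assign rFin (.add (.var rFin) (.const 1))])]

/-- The search until the path is empty. -/
def dfsProg (b : Bool) : RamProg := .while (.var rSp) (dfsBody b)

/-- The search from the root in `rW`. -/
def rootProg (b : Bool) : RamProg :=
  .block [.block [.assign rE (.const 0), visitProg], dfsProg b]

theorem Dfs.ofState_visitProg (s : RamState) :
    Dfs.ofState (visitProg.run s) =
      (Dfs.ofState s).visit (Network.ofState s) (s.var rW) (s.var rE) := by
  by_cases h1 : s.arr aSnk (s.var rW) = 0 <;>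
    by_cases h2 : s.arr aVis (s.var rW) = s.var rSt <;>
    simp [visitProg, RamProg.block, RamProg.run, RamExpr.eval, Dfs.ofState, Dfs.visit,
      Dfs.push, Dfs.mark, Network.ofState, stackOf, stackOf_update, h1, h2]

theorem Dfs.ofState_dfsBody (b : Bool) (s : RamState) (hsp : s.var rSp ≠ 0)
    (hfin : s.var rBeg ≤ s.var rFin) :
    Dfs.ofState ((dfsBody b).run s) =
      (Dfs.ofState s).step (Network.ofState s) ((Network.ofState s).active b) := by
  obtain ⟨m, hm⟩ := Nat.exists_eq_succ_of_ne_zero hsp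
  by_cases h0 : s.arr aCur (s.arr aStk m) = 0
  · have e1 : s.var rFin + 1 - s.var rBeg = s.var rFin - s.var rBeg + 1 := by omega
    have e2 : s.var rBeg + (s.var rFin - s.var rBeg) = s.var rFin := by omega
    simp [dfsBody, RamProg.block, RamProg.run, RamExpr.eval, Dfs.ofState, Dfs.step, hm, stackOf,
      h0, e1, e2, stackOf_update]
  · have hc : (activeExpr b).eval ⟨Function.update (Function.update s.var rU (s.arr aStk m)) rE
        (s.arr aCur (s.arr aStk m)), Function.update s.arr aCur (Function.update (s.arr aCur)
          (s.arr aStk m) (s.arr aNxt (s.arr aCur (s.arr aStk m))))⟩ =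
        (Network.ofState s).active b (s.arr aCur (s.arr aStk m)) := by
      cases b <;> simp [activeExpr, RamExpr.eval, Network.active, Network.ofState]
    generalize (Network.ofState s).active b = c at hc
    by_cases h1 : c (s.arr aCur (s.arr aStk m)) = 0
    · simp [dfsBody, RamProg.block, RamProg.run, RamExpr.eval, Dfs.step, hm, stackOf,
        h0, hc, h1, Dfs.advance, Dfs.ofState, Network.ofState]
    · simp [dfsBody, RamProg.block, RamProg.run, RamExpr.eval, hm, h0, hc, h1,
        Dfs.ofState_visitProg]
      simp [Dfs.ofState, Dfs.step, hm, stackOf, h0, h1, Dfs.advance, Network.ofState]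

theorem Network.ofState_congr {s s' : RamState} (hv : s'.var rH = s.var rH)
    (ha : ∀ a, aDst ≤ a → a ≤ aSnk → s'.arr a = s.arr a) :
    Network.ofState s' = Network.ofState s := by
  simp [Network.ofState, hv, ha]

/-- The memory holds the network `N` and a search in it with an empty path; the nodes of `B` were
visited before this search. -/
structure Searching (b : Bool) (N : Network) (Rt : ℕ → Prop) (B : Finset ℕ) (s : RamState) :
    Prop where
  net : Network.ofState s = N
  inv : Dfs.Inv N (N.active b) Rt B 0 (Dfs.ofState s)
  sp : s.var rSp = 0
  fin : s.var rBeg ≤ s.var rFin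

/-- The changes made by a search: visited nodes stay visited, and the nodes that finished before the search
are kept. -/
structure Extends (s s' : RamState) : Prop where
  vis : ∀ x, s.arr aVis x = s.var rSt → s'.arr aVis x = s'.var rSt
  stamp : s'.var rSt = s.var rSt
  ord : ∀ i, i < s.var rBeg → s'.arr aOrd i = s.arr aOrd i

theorem Extends.refl (s : RamState) : Extends s s := ⟨fun _ h => h, rfl, fun _ _ => rfl⟩

theorem Extends.trans {s s' s'' : RamState} (h : Extends s s') (h' : Extends s' s'')
    (hb : s'.var rBeg = s.var rBeg) : Extends s s'' :=
  ⟨fun x hx => h'.vis x (h.vis x hx), h'.stamp.trans h.stamp, fun i hi => by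
    rw [h'.ord i (by omega), h.ord i hi]⟩

/-- The number of arcs not yet passed by the search in the memory. -/
def arcsLeft (s : RamState) : ℕ := (Dfs.ofState s).unpassed (Network.ofState s)

theorem arcsLeft_eq {N : Network} {s : RamState} (h : Network.ofState s = N) :
    arcsLeft s = (Dfs.ofState s).unpassed N := by
  rw [arcsLeft, h]

theorem arcsLeft_le (s : RamState) : arcsLeft s ≤ s.var rH := Dfs.unpassed_le _ _

theorem frame_dfsBody {b : Bool} {s s' : RamState} (h : RamProg.Frame (dfsBody b) s s') :
    Network.ofState s' = Network.ofState s ∧ s'.var rBeg = s.var rBeg ∧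
      s'.var rSt = s.var rSt := by
  refine ⟨Network.ofState_congr (h.var _ (by simp [dfsBody, visitProg, RamProg.modVar,
    RamProg.block])) fun a h1 h2 => h.arr _ ?_, h.var _ ?_, h.var _ ?_⟩
  · simp [dfsBody, visitProg, RamProg.modArr, RamProg.block]; omega
  · simp [dfsBody, visitProg, RamProg.modVar, RamProg.block]
  · simp [dfsBody, visitProg, RamProg.modVar, RamProg.block]

theorem ord_dfsBody (b : Bool) (s : RamState) (hfin : s.var rBeg ≤ s.var rFin) :
    s.var rBeg ≤ ((dfsBody b).run s).var rFin ∧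
      ∀ i, i < s.var rBeg → ((dfsBody b).run s).arr aOrd i = s.arr aOrd i := by
  have hv : ∀ s : RamState, (visitProg.run s).var rFin = s.var rFin ∧
      (visitProg.run s).arr aOrd = s.arr aOrd := by
    intro s
    obtain ⟨t, -, h⟩ := visitProg.exists_exec_of_straight rfl s
    have := RamProg.frame_of_exec h
    exact ⟨this.var _ (by simp [visitProg, RamProg.modVar, RamProg.block]),
      this.arr _ (by simp [visitProg, RamProg.modArr, RamProg.block])⟩
  by_cases h0 : s.arr aCur (s.arr aStk (s.var rSp - 1)) = 0
  · simp only [dfsBody, RamProg.block, RamProg.run, RamExpr.eval, h0, Function.update_self,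
      if_true, ne_eq, Nat.reduceEqDiff, not_false_eq_true,
      Function.update_of_ne]
    refine ⟨by omega, fun i hi => ?_⟩
    rw [Function.update_of_ne (by omega)]
  · simp only [dfsBody, RamProg.block, RamProg.run, RamExpr.eval, h0, Function.update_self,
      if_false, ne_eq, Nat.reduceEqDiff, not_false_eq_true,
      Function.update_of_ne]
    split_ifs <;> simp [hv, hfin]

/-- The cost of a step of the search. -/
def stepCost : ℕ := 80

theorem bound_dfsBody (b : Bool) : 2 + (dfsBody b).bound ≤ stepCost := by
  cases b <;> decide

theorem run_dfsProg {b : Bool} {N : Network} {Rt : ℕ → Prop} {B : Finset ℕ} {s : RamState}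
    (hN : N.IsAdj) (hnet : Network.ofState s = N)
    (hI : Dfs.Inv N (N.active b) Rt B 0 (Dfs.ofState s)) (hfin : s.var rBeg ≤ s.var rFin) :
    Run (dfsProg b) s fun t s' => Searching b N Rt B s' ∧ Extends s s' ∧
      t + stepCost * (2 * arcsLeft s') ≤ stepCost * (2 * arcsLeft s + s.var rSp) + 2 ∧
      (s'.var rFin - s'.var rBeg) + arcsLeft s' ≤
        s.var rSp + (s.var rFin - s.var rBeg) + arcsLeft s := by
  have hlen : ∀ s, (Dfs.ofState s).stk.length = s.var rSp := fun s => length_stackOf _ _ _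
  have hlen' : ∀ s, (Dfs.ofState s).done.length = s.var rFin - s.var rBeg :=
    fun s => length_stackOf _ _ _
  refine (Run.while (fun t s' => RamProg.Frame (dfsBody b) s s' ∧
      Dfs.Inv N (N.active b) Rt B 0 (Dfs.ofState s') ∧ s'.var rBeg ≤ s'.var rFin ∧
      Extends s s' ∧
      t + stepCost * (2 * arcsLeft s' + s'.var rSp) ≤ stepCost * (2 * arcsLeft s + s.var rSp) ∧
      s'.var rSp + (s'.var rFin - s'.var rBeg) + arcsLeft s' ≤
        s.var rSp + (s.var rFin - s.var rBeg) + arcsLeft s)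
      (stepCost * (2 * arcsLeft s + s.var rSp)) (fun t s' h => by omega)
      ⟨.refl _ _, hI, hfin, .refl _, by omega, le_rfl⟩ ?_).mono ?_
  · rintro t s₁ ⟨hf, hI₁, hfin₁, hext, ht, hc⟩ hsp
    have hsp' : s₁.var rSp ≠ 0 := hsp
    refine (Run.straight (by cases b <;> rfl) (Q := fun t' s' => s' = (dfsBody b).run s₁ ∧
      t' ≤ (dfsBody b).bound) fun t' ht' => ⟨rfl, ht'⟩).frame.mono ?_
    rintro t' s₂ ⟨⟨hs₂, ht'⟩, hf₂⟩
    obtain ⟨hn₁, hb₁, hst₁⟩ := frame_dfsBody hf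
    obtain ⟨hn₂, hb₂, hst₂⟩ := frame_dfsBody hf₂
    rw [hnet] at hn₁
    have hstep := Dfs.ofState_dfsBody b s₁ hsp' hfin₁
    rw [← hs₂, hn₁] at hstep
    have hord := ord_dfsBody b s₁ hfin₁
    rw [← hs₂] at hord
    have hne : (Dfs.ofState s₁).stk ≠ [] := by
      intro h
      have := hlen s₁
      rw [h] at this
      exact hsp' this.symm
    have hpot := Dfs.potential_step hN hI₁ hne
    rw [← hstep, hlen, hlen, hlen', hlen', ← arcsLeft_eq hn₁, ← arcsLeft_eq (hn₂.trans hn₁)]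
      at hpot
    have hb := bound_dfsBody b
    refine ⟨⟨fun x hx => by rw [hf₂.var x hx, hf.var x hx],
      fun x hx => by rw [hf₂.arr x hx, hf.arr x hx]⟩, ?_, by omega, ?_, ?_, by omega⟩
    · rw [hstep]; exact hI₁.step hN
    · refine hext.trans ⟨fun x hx => ?_, hst₂, hord.2⟩ hb₁
      have := Dfs.vis_step_mono N (N.active b) (Dfs.ofState s₁) x hx
      rw [← hstep] at this
      rw [hst₂]
      exact this
    · simp only [RamExpr.cost, stepCost] at hb ht ⊢
      omega
  · rintro t s' ⟨hsp, t', rfl, hf, hI', hfin', hext, ht, hc⟩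
    have hsp' : s'.var rSp = 0 := hsp
    rw [hsp', add_zero] at ht
    rw [hsp'] at hc
    refine ⟨⟨(frame_dfsBody hf).1.trans hnet, hI', hsp', hfin'⟩, hext, ?_, by omega⟩
    simp only [RamExpr.cost]
    omega

/-- The cost of starting a search at a root. -/
def rootCost : ℕ := 200

theorem run_rootProg {b : Bool} {N : Network} {Rt : ℕ → Prop} {B : Finset ℕ} {s : RamState}
    (hN : N.IsAdj) (hs : Searching b N Rt B s) (hW : Rt (s.var rW))
    (hnode : ∃ h, N.IsArc h ∧ N.dst h = s.var rW) :
    Run (rootProg b) s fun t s' => Searching b N Rt B s' ∧ Extends s s' ∧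
      s'.arr aVis (s.var rW) = s'.var rSt ∧
      t + 2 * stepCost * arcsLeft s' ≤ 2 * stepCost * arcsLeft s + rootCost ∧
      (s'.var rFin - s'.var rBeg) + arcsLeft s' ≤
        (s.var rFin - s.var rBeg) + arcsLeft s + 1 := by
  have hlen : ∀ s, (Dfs.ofState s).stk.length = s.var rSp := fun s => length_stackOf _ _ _
  set P : RamProg := .block [.assign rE (.const 0), visitProg] with hP
  have hrun : P.run s = visitProg.run ⟨Function.update s.var rE 0, s.arr⟩ := by
    simp [hP, RamProg.block, RamProg.run, RamExpr.eval]
  -- the state after the root has been visited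
  set s₁ := P.run s with hs₁
  have hfr : RamProg.Frame P s s₁ := by
    obtain ⟨t, -, h⟩ := P.exists_exec_of_straight rfl s
    exact RamProg.frame_of_exec h
  have hnet₁ : Network.ofState s₁ = N := by
    rw [← hs.net]
    refine Network.ofState_congr (hfr.var _ (by simp [P, visitProg, RamProg.modVar,
      RamProg.block])) fun a h1 h2 => hfr.arr _ ?_
    simp [P, visitProg, RamProg.modArr, RamProg.block]; omega
  have hbeg : s₁.var rBeg = s.var rBeg :=
    hfr.var _ (by simp [P, visitProg, RamProg.modVar, RamProg.block])
  have hst : s₁.var rSt = s.var rSt :=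
    hfr.var _ (by simp [P, visitProg, RamProg.modVar, RamProg.block])
  have hfin : s₁.var rFin = s.var rFin :=
    hfr.var _ (by simp [P, visitProg, RamProg.modVar, RamProg.block])
  have hord : s₁.arr aOrd = s.arr aOrd :=
    hfr.arr _ (by simp [P, visitProg, RamProg.modArr, RamProg.block])
  have hdfs : Dfs.ofState s₁ = (Dfs.ofState s).visit N (s.var rW) 0 := by
    rw [hrun, Dfs.ofState_visitProg, ← hs.net]
    simp [Dfs.ofState, Network.ofState]
  have hstk : (Dfs.ofState s).stk = [] := by
    rw [← List.length_eq_zero_iff, hlen, hs.sp]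
  have hI₁ : Dfs.Inv N (N.active b) Rt B 0 (Dfs.ofState s₁) := by
    rw [hdfs]
    exact hs.inv.visit hN (.inl ⟨rfl, hstk, hW, hnode⟩)
  have hsp₁ : s₁.var rSp ≤ 1 := by
    have := (Dfs.length_visit N (Dfs.ofState s) (s.var rW) 0).1
    rwa [← hdfs, hlen, hlen, hs.sp] at this
  have hleft : arcsLeft s₁ ≤ arcsLeft s := by
    have := Dfs.unpassed_visit N (Dfs.ofState s) (s.var rW) 0
    rwa [← hdfs, ← arcsLeft_eq hnet₁, ← arcsLeft_eq hs.net] at this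
  have hvis₁ : s₁.arr aVis (s.var rW) = s₁.var rSt := by
    have := Dfs.vis_visit_self N (Dfs.ofState s) (s.var rW) 0
    rw [← Dfs.stamp_visit N (Dfs.ofState s) (s.var rW) 0, ← hdfs] at this
    exact this
  have hmono : ∀ x, s.arr aVis x = s.var rSt → s₁.arr aVis x = s₁.var rSt := by
    intro x hx
    have := Dfs.vis_visit_mono N (Dfs.ofState s) (s.var rW) 0 x hx
    rw [← Dfs.stamp_visit N (Dfs.ofState s) (s.var rW) 0, ← hdfs] at this
    exact this
  have hext₁ : Extends s s₁ := ⟨hmono, hst, fun i _ => by rw [hord]⟩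
  refine Run.block_straight rfl fun t ht => ?_
  change t ≤ P.bound at ht
  rw [← hs₁]
  refine Run.block_cons ((run_dfsProg hN hnet₁ hI₁ (by rw [hbeg, hfin]; exact hs.fin)).mono ?_)
  rintro t' s₂ ⟨hs₂, hext, ht', hc⟩
  refine Run.block_nil ⟨hs₂, hext₁.trans hext hbeg, hext.vis _ hvis₁, ?_, by omega⟩
  have hb : P.bound ≤ 60 := by decide
  simp only [stepCost, rootCost] at ht' ⊢
  omega

/-! ### Searches from many roots -/

/-- The test for roots: forward searches start at the nodes adjacent to the source, backward searches at all
nodes. -/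
def rootExpr (b : Bool) : RamExpr := if b then .get aSrc (.var rW) else .const 1

/-- The roots of the search. -/
def Network.IsRoot (N : Network) (b : Bool) (u : ℕ) : Prop := b = true → N.src u ≠ 0

/-- One round of `scanProg`. -/
def scanBody (b : Bool) : RamProg := .block [
  .assign rW (.get aDst (.var rI)),
  .ite (rootExpr b) (rootProg b) .skip,
  .assign rI (.add (.var rI) (.const 1))]

/-- A new search from all roots. -/
def scanProg (b : Bool) : RamProg := .block [
  .block [
    .assign rSt (.add (.var rSt) (.const 1)),
    .assign rTgt (.const 0),
    .assign rBeg (.var rFin),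
    .assign rI (.const 1)],
  .while (.lt (.var rI) (.add (.var rH) (.const 1))) (scanBody b)]

/-- The cost of `scanProg` per arc. -/
def scanCost : ℕ := 500

theorem frame_scanBody {b : Bool} {s s' : RamState} (h : RamProg.Frame (scanBody b) s s') :
    s'.var rBeg = s.var rBeg ∧ s'.var rSt = s.var rSt ∧ s'.var rH = s.var rH := by
  refine ⟨h.var _ ?_, h.var _ ?_, h.var _ ?_⟩ <;>
    simp [scanBody, rootProg, dfsProg, dfsBody, visitProg, RamProg.modVar, RamProg.block]

theorem frame_rootProg {b : Bool} {s s' : RamState} (h : RamProg.Frame (rootProg b) s s') :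
    s'.var rBeg = s.var rBeg ∧ s'.var rSt = s.var rSt ∧ s'.var rI = s.var rI ∧
      s'.var rH = s.var rH := by
  refine ⟨h.var _ ?_, h.var _ ?_, h.var _ ?_, h.var _ ?_⟩ <;>
    simp [rootProg, dfsProg, dfsBody, visitProg, RamProg.modVar, RamProg.block]

theorem Searching.congr {b : Bool} {N : Network} {Rt : ℕ → Prop} {B : Finset ℕ} {s s' : RamState}
    (h : Searching b N Rt B s) (h1 : Network.ofState s' = Network.ofState s)
    (h2 : Dfs.ofState s' = Dfs.ofState s) (h3 : s'.var rSp = s.var rSp)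
    (h4 : s'.var rBeg = s.var rBeg) (h5 : s'.var rFin = s.var rFin) : Searching b N Rt B s' :=
  ⟨h1.trans h.net, h2 ▸ h.inv, h3.trans h.sp, by rw [h4, h5]; exact h.fin⟩

theorem run_scanBody {b : Bool} {N : Network} {s : RamState} (hN : N.IsAdj)
    (hs : Searching b N (N.IsRoot b) ∅ s) (hI : N.IsArc (s.var rI)) :
    Run (scanBody b) s fun t s' => Searching b N (N.IsRoot b) ∅ s' ∧ Extends s s' ∧
      (N.IsRoot b (N.dst (s.var rI)) → s'.arr aVis (N.dst (s.var rI)) = s'.var rSt) ∧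
      s'.var rI = s.var rI + 1 ∧
      t + 2 * stepCost * arcsLeft s' ≤ 2 * stepCost * arcsLeft s + (rootCost + 20) ∧
      (s'.var rFin - s'.var rBeg) + arcsLeft s' ≤
        (s.var rFin - s.var rBeg) + arcsLeft s + 1 := by
  have hdst : s.arr aDst = N.dst := by rw [← hs.net]; rfl
  have hsrc : s.arr aSrc = N.src := by rw [← hs.net]; rfl
  refine Run.block_straight rfl fun t₁ ht₁ => ?_
  set s₁ := (RamProg.assign rW (.get aDst (.var rI))).run s with hs₁
  have hW : s₁.var rW = N.dst (s.var rI) := by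
    simp [s₁, RamProg.run, RamExpr.eval, hdst]
  have hS₁ : Searching b N (N.IsRoot b) ∅ s₁ := hs.congr rfl rfl rfl rfl rfl
  have hleft : arcsLeft s₁ = arcsLeft s := rfl
  have heval : (rootExpr b).eval s₁ ≠ 0 ↔ N.IsRoot b (N.dst (s.var rI)) := by
    cases b
    · simp [rootExpr, RamExpr.eval, Network.IsRoot]
    · simp only [rootExpr, if_true, RamExpr.eval, Network.IsRoot, hW, true_imp_iff]
      rw [← hsrc]; rfl
  have hcost : (rootExpr b).cost ≤ 2 := by cases b <;> decide
  have hb₁ : t₁ ≤ 3 := ht₁.trans (by decide)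
  by_cases hr : N.IsRoot b (N.dst (s.var rI))
  · refine Run.block_cons (Run.iteTrue (heval.2 hr) ((run_rootProg hN hS₁ (hW ▸ hr)
      ⟨_, hI, hW.symm⟩).frame.mono ?_))
    rintro t₂ s₂ ⟨⟨hS₂, hext, hv, ht₂, hc⟩, hf⟩
    obtain ⟨hf1, hf2, hf3, hf4⟩ := frame_rootProg hf
    refine Run.block_straight rfl fun t₃ ht₃ => Run.block_nil ?_
    have hb₃ : t₃ ≤ 4 := ht₃.trans (by decide)
    rw [hW] at hv
    rw [hleft] at ht₂ hc
    refine ⟨hS₂.congr rfl rfl rfl rfl rfl, ⟨hext.vis, hext.stamp, hext.ord⟩, fun _ => hv, ?_,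
      ?_, ?_⟩
    · change s₂.var rI + 1 = _
      rw [hf3]; rfl
    · change _ + 2 * stepCost * arcsLeft s₂ ≤ _
      omega
    · exact hc
  · refine Run.block_cons (Run.iteFalse (by_contra fun h => hr (heval.1 h))
      (Run.straight rfl fun t₂ ht₂ => ?_))
    refine Run.block_straight rfl fun t₃ ht₃ => Run.block_nil ?_
    have hb₂ : t₂ ≤ 1 := ht₂.trans (by decide)
    have hb₃ : t₃ ≤ 4 := ht₃.trans (by decide)
    refine ⟨hS₁.congr rfl rfl rfl rfl rfl, ⟨fun _ h => h, rfl, fun _ _ => rfl⟩,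
      fun h => absurd h hr, rfl, ?_, ?_⟩
    · change _ + 2 * stepCost * arcsLeft s ≤ _
      simp only [rootCost]
      omega
    · exact Nat.le_succ _

/-- The outcome of `scanProg`. -/
structure Scanned (b : Bool) (N : Network) (s : RamState) : Prop
    extends Searching b N (N.IsRoot b) ∅ s where
  roots : ∀ h, N.IsArc h → N.IsRoot b (N.dst h) → s.arr aVis (N.dst h) = s.var rSt
  count : s.var rFin - s.var rBeg ≤ 2 * N.size

/-- The searches together take a time linear in the number of arcs. The list of roots runs through the ends of all
arcs, with repetitions. -/
theorem run_scanProg (b : Bool) {N : Network} {s : RamState} (hN : N.IsAdj)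
    (hnet : Network.ofState s = N) (hsp : s.var rSp = 0)
    (hvis : ∀ x, s.arr aVis x ≤ s.var rSt) :
    Run (scanProg b) s fun t s' => Scanned b N s' ∧ s'.var rBeg = s.var rFin ∧
      (∀ i, i < s.var rFin → s'.arr aOrd i = s.arr aOrd i) ∧
      t ≤ scanCost * (N.size + 1) := by
  refine Run.block_straight rfl fun t₁ ht₁ => ?_
  have hb₁ : t₁ ≤ 12 := ht₁.trans (by decide)
  clear ht₁
  set s₁ := RamProg.run _ s with hs₁
  have hsp₁ : s₁.var rSp = 0 := hsp
  have hbeg₁ : s₁.var rBeg = s.var rFin := rfl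
  have hfin₁ : s₁.var rFin = s.var rFin := rfl
  have hI₁ : s₁.var rI = 1 := rfl
  have hst₁ : s₁.var rSt = s.var rSt + 1 := rfl
  have hord₁ : s₁.arr aOrd = s.arr aOrd := rfl
  have hH₁ : s₁.var rH = N.size := by rw [← hnet]; rfl
  have hS₁ : Searching b N (N.IsRoot b) ∅ s₁ := by
    refine ⟨hnet, ?_, hsp, le_rfl⟩
    have hv : ∀ x, s₁.arr aVis x < s₁.var rSt := fun x => Nat.lt_succ_of_le (hvis x)
    refine Dfs.Inv.start ?_ ?_ rfl (fun x => (hv x).le) (fun x => ?_) (by simp) (by simp)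
    · simp [Dfs.ofState, hsp₁, stackOf]
    · simp [Dfs.ofState, hbeg₁, hfin₁, stackOf]
    · exact ⟨fun h => absurd h (hv x).ne, fun h => by simp at h⟩
  clear_value s₁
  refine Run.block_cons ((Run.while (fun t s' => RamProg.Frame (scanBody b) s₁ s' ∧
      Searching b N (N.IsRoot b) ∅ s' ∧ Extends s₁ s' ∧ 1 ≤ s'.var rI ∧
      s'.var rI ≤ N.size + 1 ∧
      (∀ h, 1 ≤ h → h < s'.var rI → N.IsRoot b (N.dst h) →
        s'.arr aVis (N.dst h) = s'.var rSt) ∧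
      t + 2 * stepCost * arcsLeft s' ≤
        2 * stepCost * arcsLeft s₁ + (rootCost + 30) * (s'.var rI - 1) ∧
      (s'.var rFin - s'.var rBeg) + arcsLeft s' ≤ arcsLeft s₁ + (s'.var rI - 1))
      (2 * stepCost * arcsLeft s₁ + (rootCost + 30) * N.size) ?_
      ⟨.refl _ _, hS₁, .refl _, by omega, by omega, fun h h1 h2 => by omega, by omega,
        by omega⟩ ?_).mono ?_)
  · rintro t s' ⟨-, -, -, h1, h2, -, h3, -⟩
    have : (rootCost + 30) * (s'.var rI - 1) ≤ (rootCost + 30) * N.size :=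
      Nat.mul_le_mul_left _ (by omega)
    omega
  · rintro t s₂ ⟨hf, hS, hext, h1, h2, hroots, ht, hc⟩ hcond
    obtain ⟨hf1, hf2, hf3⟩ := frame_scanBody hf
    have hlt : s₂.var rI < N.size + 1 := by
      rw [Ne, RamExpr.eval_lt_eq_zero] at hcond
      simp only [RamExpr.eval] at hcond
      omega
    refine (run_scanBody hN hS ⟨h1, by omega⟩).frame.mono ?_
    rintro t' s₃ ⟨⟨hS₃, hext₃, hr₃, hI₃, ht₃, hc₃⟩, hf₃⟩
    refine ⟨⟨fun x hx => by rw [hf₃.var x hx, hf.var x hx],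
      fun x hx => by rw [hf₃.arr x hx, hf.arr x hx]⟩, hS₃, hext.trans hext₃ hf1, by omega,
      by omega, ?_, ?_, by omega⟩
    · intro h hh1 hh2 hr
      by_cases hh : h = s₂.var rI
      · rw [hh] at hr ⊢; exact hr₃ hr
      · exact hext₃.vis _ (hroots h hh1 (by omega) hr)
    · have : s₃.var rI - 1 = (s₂.var rI - 1) + 1 := by omega
      rw [this, Nat.mul_succ]
      simp only [RamExpr.cost]
      omega
  · rintro t s' ⟨hcond, t', rfl, hf, hS, hext, h1, h2, hroots, ht, hc⟩
    obtain ⟨hf1, hf2, hf3⟩ := frame_scanBody hf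
    have hge : s'.var rI = N.size + 1 := by
      rw [RamExpr.eval_lt_eq_zero] at hcond
      simp only [RamExpr.eval] at hcond
      omega
    have hleft := arcsLeft_le s₁
    rw [hge, Nat.add_sub_cancel] at ht hc
    refine Run.block_nil ⟨⟨hS, fun h hh hr => hroots h hh.1 (by have := hh.2; omega) hr,
      by omega⟩, hf1.trans hbeg₁, fun i hi => ?_, ?_⟩
    · rw [hext.ord i (by omega), hord₁]
    · simp only [RamExpr.cost, scanCost, stepCost, rootCost] at ht ⊢
      omega

/-! ### Augmentation -/

/-- One arc of the augmenting path, from the arc by which the node in `rW` was found. -/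
def pushBody : RamProg := .block [
  .assign rE (.get aPred (.var rW)),
  .store aCap (.var rE) (.sub (.get aCap (.var rE)) (.const 1)),
  .store aCap (.get aMate (.var rE)) (.add (.get aCap (.get aMate (.var rE))) (.const 1)),
  .assign rW (.get aDst (.get aMate (.var rE)))]

/-- One unit is sent along the path found by the search, to the node in `rTgt`. -/
def pushProg : RamProg := .block [
  .block [
    .assign rW (.var rTgt),
    .store aSnk (.var rW) (.sub (.get aSnk (.var rW)) (.const 1))],
  .while (.get aPred (.var rW)) pushBody,
  .store aSrc (.var rW) (.sub (.get aSrc (.var rW)) (.const 1))]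

/-- As long as a search from the source meets a node adjacent to the sink, one unit is sent along the path
found. -/
def augmentProg : RamProg := .block [
  .assign rFin (.const 0),
  scanProg true,
  .while (.var rTgt) (.block [pushProg, .assign rFin (.const 0), scanProg true])]

theorem Network.active_true (N : Network) : N.active true = N.cap := by
  funext h; simp [Network.active]

/-- The cost of sending one unit, per arc. -/
def pushCost : ℕ := 100

theorem run_pushBody (s : RamState) :
    Network.ofState (pushBody.run s) = (Network.ofState s).pushArc (s.arr aPred (s.var rW)) ∧
      (pushBody.run s).var rW = (Network.ofState s).frm (s.arr aPred (s.var rW)) := by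
  constructor <;>
    simp [pushBody, RamProg.block, RamProg.run, RamExpr.eval, Network.ofState, Network.pushArc,
      Network.frm]

variable {k n : ℕ} {I : List (BasicFn k n)}

/-- While the path is followed backwards, one unit has been sent from the node in `rW` to the sink: a cut whose
source side contains this node has lost one unit. -/
theorem run_pushProg {N : Network} {r : ℕ} {s : RamState} (hN : Represents N I r)
    (hs : Scanned true N s) (htgt : s.var rTgt ≠ 0) :
    Run pushProg s fun t s' => Represents (Network.ofState s') I (r + 1) ∧
      t ≤ pushCost * (N.size + 1) := by
  have hstk : (Dfs.ofState s).stk = [] := by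
    simp [Dfs.ofState, hs.sp, stackOf]
  have hI := hs.inv
  rw [N.active_true] at hI
  set D := (Dfs.ofState s).done with hD
  obtain ⟨ρ, hρ⟩ := hI.forest
  rw [Dfs.new, hstk, List.nil_append, ← hD] at hρ
  have hDlen : D.length ≤ 2 * N.size := by
    rw [hD]; simp only [Dfs.ofState, length_stackOf]; exact hs.count
  have hDlt : ∀ x ∈ D, x < n * (k + 1) := fun x hx => by
    obtain ⟨h, hh, rfl⟩ := hI.isNode x (.inr hx)
    exact hN.wf.dst_lt h hh
  obtain ⟨hsnk, hvis, -⟩ := hI.tgt htgt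
  have hmem : s.var rTgt ∈ D := by
    rw [hI.vis_iff, hstk] at hvis
    simp only [List.not_mem_nil, Finset.notMem_empty, false_or, or_false] at hvis
    exact hvis
  have hsnk' : N.snk (s.var rTgt) ≠ 0 := hsnk
  refine Run.block_straight rfl fun t₁ ht₁ => ?_
  have hb₁ : t₁ ≤ 20 := ht₁.trans (by decide)
  clear ht₁
  set s₁ := RamProg.run _ s with hs₁
  have hW₁ : s₁.var rW = s.var rTgt := rfl
  have hpred₁ : s₁.arr aPred = s.arr aPred := rfl
  have hnet₁ : Network.ofState s₁ = N.drainSnk (s.var rTgt) := by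
    rw [← hs.net, hs₁]
    simp [RamProg.block, RamProg.run, RamExpr.eval, Network.ofState, Network.drainSnk]
  clear_value s₁
  refine Run.block_cons ((Run.while (fun t s' => RamProg.Frame pushBody s₁ s' ∧
      (Network.ofState s').Wf (n * (k + 1)) ∧
      (∀ S, (Network.ofState s').cut (n * (k + 1)) S + (if s'.var rW ∈ S then 1 else 0) + r =
        sumCut I S) ∧ s'.var rW ∈ D ∧
      (∀ x ∈ D, ρ x ≤ ρ (s'.var rW) → s.arr aPred x ≠ 0 →
        (Network.ofState s').cap (s.arr aPred x) ≠ 0) ∧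
      t + 40 * ρ (s'.var rW) ≤ 40 * ρ (s.var rTgt)) (40 * ρ (s.var rTgt))
      (fun t s' h => by omega) ⟨.refl _ _, ?_, fun S => ?_, ?_, ?_, by rw [hW₁]; omega⟩ ?_).mono ?_)
  · rw [hnet₁]; exact hN.wf.drainSnk _
  · rw [hnet₁, hW₁, Network.cut_drainSnk (hDlt _ hmem) hsnk', hN.cut]
  · rw [hW₁]; exact hmem
  · intro x hx _ hp
    rw [hnet₁]
    exact ((hρ x hx).2.2 hp).2.1
  · rintro t s₂ ⟨hf, hwf, hcut, hmem₂, hcap, ht⟩ hcond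
    have hp₂ : s₂.arr aPred = s.arr aPred := by
      rw [← hpred₁]
      exact hf.arr _ (by simp [pushBody, RamProg.modArr, RamProg.block])
    have hst : ∀ a, a ≠ aCap → s₂.arr a = s₁.arr a := fun a ha =>
      hf.arr _ (by simpa [pushBody, RamProg.modArr, RamProg.block] using ha)
    have hdst : (Network.ofState s₂).dst = N.dst := by
      have : (Network.ofState s₂).dst = (Network.ofState s₁).dst := hst aDst (by decide)
      rw [this, hnet₁]; rfl
    have hmate : (Network.ofState s₂).mate = N.mate := by
      have : (Network.ofState s₂).mate = (Network.ofState s₁).mate := hst aMate (by decide)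
      rw [this, hnet₁]; rfl
    have hsize : (Network.ofState s₂).size = N.size := by
      have : (Network.ofState s₂).size = (Network.ofState s₁).size :=
        hf.var _ (by simp [pushBody, RamProg.modVar, RamProg.block])
      rw [this, hnet₁]; rfl
    have hfrm : ∀ h, (Network.ofState s₂).frm h = N.frm h := fun h => by
      rw [Network.frm, Network.frm, hdst, hmate]
    have he0 : s.arr aPred (s₂.var rW) ≠ 0 := by rw [← hp₂]; exact hcond
    obtain ⟨ha, hce, hde, hfe, hlt⟩ := (hρ _ hmem₂).2.2 he0
    change N.dst (s.arr aPred (s₂.var rW)) = s₂.var rW at hde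
    change N.frm (s.arr aPred (s₂.var rW)) ∈ D at hfe
    change ρ (N.frm (s.arr aPred (s₂.var rW))) < ρ (s₂.var rW) at hlt
    change N.IsArc (s.arr aPred (s₂.var rW)) at ha
    have hce₂ := hcap _ hmem₂ le_rfl he0
    refine (Run.straight (P := pushBody) rfl (Q := fun t' s' => s' = pushBody.run s₂ ∧
      t' ≤ pushBody.bound) fun t' ht' => ⟨rfl, ht'⟩).frame.mono ?_
    rintro t' s₃ ⟨⟨rfl, ht'⟩, hf₃⟩
    have hb' : t' ≤ 30 := ht'.trans (by decide)
    obtain ⟨hnet₃, hW₃⟩ := run_pushBody s₂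
    rw [hp₂] at hnet₃ hW₃
    rw [hfrm] at hW₃
    set e := s.arr aPred (s₂.var rW) with he
    have ha₂ : (Network.ofState s₂).IsArc e := by rw [Network.IsArc, hsize]; exact ha
    refine ⟨⟨fun x hx => by rw [hf₃.var x hx, hf.var x hx],
      fun x hx => by rw [hf₃.arr x hx, hf.arr x hx]⟩, ?_, fun S => ?_, ?_, ?_, ?_⟩
    · rw [hnet₃]; exact hwf.pushArc e
    · have h1 := Network.cut_pushArc hwf ha₂ hce₂ S
      rw [hfrm, hdst, hde] at h1
      rw [hnet₃, hW₃, ← hcut S, h1]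
    · rw [hW₃]; exact hfe
    · intro x hx hρx hpx
      rw [hW₃] at hρx
      have hne : s.arr aPred x ≠ e := by
        intro hxe
        have h1 := ((hρ x hx).2.2 hpx).2.2.1
        change N.dst (s.arr aPred x) = x at h1
        rw [hxe, hde] at h1
        rw [← h1] at hρx
        omega
      have := hcap x hx (by omega) hpx
      rw [hnet₃]
      simp only [Network.pushArc, Function.update_apply]
      split_ifs <;> first | exact Nat.succ_ne_zero _ | exact this
    · rw [hW₃]
      simp only [RamExpr.cost]
      omega
  · rintro t s₂ ⟨hcond, t', rfl, hf, hwf, hcut, hmem₂, -, ht⟩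
    have hp₂ : s₂.arr aPred = s.arr aPred := by
      rw [← hpred₁]
      exact hf.arr _ (by simp [pushBody, RamProg.modArr, RamProg.block])
    have hst : ∀ a, a ≠ aCap → s₂.arr a = s₁.arr a := fun a ha =>
      hf.arr _ (by simpa [pushBody, RamProg.modArr, RamProg.block] using ha)
    have hdst : (Network.ofState s₂).dst = N.dst := by
      have : (Network.ofState s₂).dst = (Network.ofState s₁).dst := hst aDst (by decide)
      rw [this, hnet₁]; rfl
    have hsrc : (Network.ofState s₂).src = N.src := by
      have : (Network.ofState s₂).src = (Network.ofState s₁).src := hst aSrc (by decide)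
      rw [this, hnet₁]; rfl
    have hsize : (Network.ofState s₂).size = N.size := by
      have : (Network.ofState s₂).size = (Network.ofState s₁).size :=
        hf.var _ (by simp [pushBody, RamProg.modVar, RamProg.block])
      rw [this, hnet₁]; rfl
    have hp0 : s.arr aPred (s₂.var rW) = 0 := by rw [← hp₂]; exact hcond
    have hroot : N.src (s₂.var rW) ≠ 0 := (hρ _ hmem₂).2.1 hp0 rfl
    refine Run.block_straight rfl fun t₃ ht₃ => Run.block_nil ?_
    have hb₃ : t₃ ≤ 20 := ht₃.trans (by decide)
    have hnet₃ : Network.ofState (RamProg.run (.store aSrc (.var rW)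
        (.sub (.get aSrc (.var rW)) (.const 1))) s₂) =
        (Network.ofState s₂).drainSrc (s₂.var rW) := by
      simp [RamProg.run, RamExpr.eval, Network.ofState, Network.drainSrc]
    rw [hnet₃]
    refine ⟨⟨hwf.drainSrc _, fun S => ?_, fun h hh => ?_⟩, ?_⟩
    · have h1 := Network.cut_drainSrc (N := Network.ofState s₂) (hDlt _ hmem₂)
        (by rw [hsrc]; exact hroot) S
      rw [← hcut S, ← h1]
      push_cast
      ring
    · have hd : ((Network.ofState s₂).drainSrc (s₂.var rW)).dst = N.dst := hdst
      have hz : ((Network.ofState s₂).drainSrc (s₂.var rW)).size = N.size := hsize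
      rw [Network.IsArc, hz] at hh
      rw [hd]
      exact hN.isNode h hh
    · have hρlt := (hρ _ hmem).1
      simp only [RamExpr.cost, pushCost]
      omega

/-- The cost of one augmentation and the next search, per arc. -/
def augmentCost : ℕ := 700

theorem frame_pushProg {s s' : RamState} (h : RamProg.Frame pushProg s s') :
    s'.var rH = s.var rH ∧ s'.var rSt = s.var rSt ∧ s'.var rSp = s.var rSp ∧
      s'.arr aVis = s.arr aVis := by
  refine ⟨h.var _ ?_, h.var _ ?_, h.var _ ?_, h.arr _ ?_⟩ <;>
    simp [pushProg, pushBody, RamProg.modVar, RamProg.modArr, RamProg.block]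

/-- There are at most `R` augmentations if `R` bounds the amounts of flow. -/
theorem run_augmentProg {N : Network} {r R : ℕ} {s : RamState} (hN : Represents N I r)
    (hnet : Network.ofState s = N) (hsp : s.var rSp = 0)
    (hvis : ∀ x, s.arr aVis x ≤ s.var rSt)
    (hR : ∀ N' r', Represents N' I r' → r' ≤ R) :
    Run augmentProg s fun t s' => ∃ N' r', Represents N' I r' ∧ Scanned true N' s' ∧
      N'.size = N.size ∧ s'.var rTgt = 0 ∧ t ≤ augmentCost * (N.size + 1) * (R + 1) := by
  refine Run.block_straight rfl fun t₁ ht₁ => ?_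
  have hb₁ : t₁ ≤ 2 := ht₁.trans (by decide)
  clear ht₁
  set s₁ := RamProg.run _ s with hs₁
  refine Run.block_cons ((run_scanProg true (N := N) hN.wf.toIsAdj (s := s₁) hnet hsp
    hvis).mono ?_)
  clear_value s₁
  rintro t₂ s₂ ⟨hS₂, -, -, ht₂⟩
  refine Run.block_cons ((Run.while (fun t s' => ∃ N' r', Represents N' I r' ∧ Scanned true N' s' ∧
      N'.size = N.size ∧ t + 650 * (N.size + 1) * r ≤ 650 * (N.size + 1) * r')
      (650 * (N.size + 1) * R)
      ?_ ⟨N, r, hN, hS₂, rfl, by omega⟩ ?_).mono ?_)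
  · rintro t s' ⟨N', r', hN', -, -, ht⟩
    have := Nat.mul_le_mul_left (650 * (N.size + 1)) (hR N' r' hN')
    omega
  · rintro t s₃ ⟨N', r', hN', hS₃, hsz, ht⟩ hcond
    refine Run.block_cons ((run_pushProg hN' hS₃ hcond).frame.mono ?_)
    rintro t₄ s₄ ⟨⟨hN₄, ht₄⟩, hf⟩
    obtain ⟨hf1, hf2, hf3, hf4⟩ := frame_pushProg hf
    refine Run.block_straight rfl fun t₅ ht₅ => ?_
    have hb₅ : t₅ ≤ 2 := ht₅.trans (by decide)
    have hsz₄ : (Network.ofState s₄).size = N.size := by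
      rw [← hsz, ← hS₃.net]; exact hf1
    refine Run.block_cons ((run_scanProg true (N := Network.ofState s₄) hN₄.wf.toIsAdj
      (s := RamProg.run (.assign rFin (.const 0)) s₄) rfl (hf3.trans hS₃.sp) ?_).mono ?_)
    · intro x
      change s₄.arr aVis x ≤ s₄.var rSt
      rw [hf4, hf2]
      exact hS₃.inv.vis_le x
    · rintro t₆ s₆ ⟨hS₆, -, -, ht₆⟩
      refine Run.block_nil ⟨_, r' + 1, hN₄, hS₆, hsz₄, ?_⟩
      rw [hsz₄] at ht₆
      rw [hsz] at ht₄
      have h7 : 650 * (N.size + 1) * (r' + 1) =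
          650 * (N.size + 1) * r' + 650 * (N.size + 1) := by ring
      rw [h7]
      simp only [RamExpr.cost, pushCost, scanCost] at ht₄ ht₆ ⊢
      omega
  · rintro t s₃ ⟨hcond, t', rfl, N', r', hN', hS₃, hsz, ht⟩
    refine Run.block_nil ⟨N', r', hN', hS₃, hsz, hcond, ?_⟩
    have h1 := Nat.mul_le_mul_left (650 * (N.size + 1)) (hR N' r' hN')
    have h2 : augmentCost * (N.size + 1) * (R + 1) = 700 * (N.size + 1) * R +
      700 * (N.size + 1) := by rw [augmentCost]; ring
    have h3 : 650 * (N.size + 1) * R ≤ 700 * (N.size + 1) * R := by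
      gcongr
      omega
    simp only [RamExpr.cost, scanCost] at ht₂ ⊢
    omega

/-! ### Strong components from the postorder -/

/-- A path from outside `T` to a node of `T` has an edge that enters `T`. -/
theorem exists_crossing {E : ℕ → ℕ → Prop} {T : List ℕ} {a b : ℕ}
    (h : Relation.ReflTransGen E a b) (ha : a ∉ T) (hb : b ∈ T) :
    ∃ q p, Relation.ReflTransGen E a q ∧ E q p ∧ q ∉ T ∧ p ∈ T ∧ Relation.ReflTransGen E p b := by
  induction h with
  | refl => exact absurd hb ha
  | @tail c d hac hcd ih =>
    by_cases hc : c ∈ T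
    · obtain ⟨q, p, h1, h2, h3, h4, h5⟩ := ih hc
      exact ⟨q, p, h1, h2, h3, h4, h5.tail hcd⟩
    · exact ⟨c, d, hac, hcd, hc, hb, .refl⟩

theorem mem_of_reach {E : ℕ → ℕ → Prop} {B : Finset ℕ} (hB : ∀ u ∈ B, ∀ w, E u w → w ∈ B)
    {a b : ℕ} (h : Relation.ReflTransGen E a b) (ha : a ∈ B) : b ∈ B := by
  induction h with
  | refl => exact ha
  | tail _ hbc ih => exact hB _ ih _ hbc

/-- If `W` finished last, in a search along the reversed edges, among the nodes outside the closed set `B`,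
then all nodes outside `B` that `W` reaches are in the strong component of `W`. -/
theorem reach_back {E : ℕ → ℕ → Prop} {B : Finset ℕ} {W : ℕ} {L : List ℕ}
    (hfin : Dfs.FinishOK (fun u w => E w u) ∅ (W :: L)) (hnd : (W :: L).Nodup)
    (hB : ∀ u ∈ B, ∀ w, E u w → w ∈ B)
    (hcov : ∀ x, x ∉ B → Relation.ReflTransGen E W x → x ∈ W :: L) {x : ℕ} (hx : x ∉ B)
    (hr : Relation.ReflTransGen E W x) : Relation.ReflTransGen E x W := by
  have hsuf : ∀ (A : List ℕ) (u : ℕ) (D : List ℕ),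
      Dfs.FinishOK (fun u w => E w u) ∅ (A ++ u :: D) →
      ∀ p ∈ u :: D, ∀ q, q ∉ u :: D → E q p → Relation.ReflTransGen E u q := by
    intro A u D h p hp q hq hqp
    induction A with
    | nil => exact Relation.reflTransGen_swap.1 (h.2 p hp q hq (by simp) hqp)
    | cons a A ih => exact ih h.1
  -- induction on the number of nodes that finished after `u`: a path from `W` to `u` enters the set of `u` and
  -- the nodes that finished before it through an edge from some `q`; by the property of the postorder, `u`
  -- reaches `q`, which finished later
  have key : ∀ m (A : List ℕ) (u : ℕ) (D : List ℕ), A.length ≤ m → W :: L = A ++ u :: D →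
      u ∉ B → Relation.ReflTransGen E W u → Relation.ReflTransGen E u W := by
    intro m
    induction m with
    | zero =>
      intro A u D hA heq _ _
      obtain rfl : A = [] := List.length_eq_zero_iff.1 (by omega)
      simp only [List.nil_append, List.cons.injEq] at heq
      rw [heq.1]
    | succ m ih =>
      intro A u D hA heq hu hWu
      rcases A with _ | ⟨a, A⟩
      · simp only [List.nil_append, List.cons.injEq] at heq
        rw [heq.1]
      · have hWa : W = a := by simpa using congrArg List.head? heq
        have hnd' := hnd
        rw [heq] at hnd'
        have hdisj := List.disjoint_of_nodup_append hnd'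
        have hWT : W ∉ u :: D := fun h => hdisj (by simp [hWa]) h
        obtain ⟨q, p, h1, h2, h3, h4, h5⟩ := exists_crossing hWu hWT (by simp)
        have hqB : q ∉ B := fun h => hu (mem_of_reach hB (h5.head h2) h)
        have hq := hcov q hqB h1
        rw [heq, List.mem_append] at hq
        obtain ⟨A₁, A₂, hA₁⟩ := List.append_of_mem (hq.resolve_right h3)
        have huq := hsuf (a :: A) u D (by rw [← heq]; exact hfin) p h4 q h3 h2
        refine huq.trans (ih A₁ q (A₂ ++ u :: D) ?_ ?_ hqB h1)
        · have := congrArg List.length hA₁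
          simp only [List.length_append, List.length_cons] at this hA
          omega
        · rw [heq, hA₁, List.append_assoc, List.cons_append]
  obtain ⟨A, D, h⟩ := List.append_of_mem (hcov x hx hr)
  exact key _ A x D le_rfl h hx hr

/-! ### Accepting or rejecting a component -/

/-- One round of the loop that tries to assign the nodes of a component. -/
def acceptBody : RamProg := .block [
  .assign rU (.get aOrd (.var rJ)),
  .ite (.get aOut (.get aVar (.var rU))) (.assign rBad (.const 1))
    (.store aOut (.get aVar (.var rU)) (.get aVal (.var rU))),
  .assign rJ (.add (.var rJ) (.const 1))]

/-- One round of the loop that rejects the nodes of a component. -/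
def rejectBody : RamProg := .block [
  .assign rU (.get aOrd (.var rJ)),
  .store aSnk (.var rU) (.const 1),
  .ite (.eq (.get aOut (.get aVar (.var rU))) (.get aVal (.var rU)))
    (.store aOut (.get aVar (.var rU)) (.const 0)) .skip,
  .assign rJ (.add (.var rJ) (.const 1))]

/-- The nodes found by a search are assigned, if no node adjacent to the sink was met and their variables
have no other values; otherwise the nodes are joined to the sink. -/
def settleProg : RamProg := .block [
  .block [.assign rBad (.var rTgt), .assign rJ (.var rBeg)],
  .while (.lt (.var rJ) (.var rFin)) acceptBody,
  .ite (.var rBad)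
    (.block [.assign rJ (.var rBeg), .while (.lt (.var rJ) (.var rFin)) rejectBody])
    .skip]

/-- The cost of settling a node. -/
def settleCost : ℕ := 80

/-- The outcome of `settleProg` on the nodes `D`, in terms of the variables `vr` and the values `vl` of the
nodes. -/
def Settled (vr vl : ℕ → ℕ) (D : List ℕ) (s s' : RamState) : Prop :=
  (s.var rTgt = 0 ∧ s'.arr aSnk = s.arr aSnk ∧ (∀ x ∈ D, s'.arr aOut (vr x) = vl x) ∧
    (∀ v, s.arr aOut v ≠ 0 → s'.arr aOut v = s.arr aOut v) ∧
    (∀ v, s.arr aOut v = 0 → s'.arr aOut v = 0 ∨ ∃ x ∈ D, vr x = v ∧ s'.arr aOut v = vl x)) ∨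
  ((s.var rTgt ≠ 0 ∨ ∃ x ∈ D, s.arr aOut (vr x) ≠ 0 ∨ ∃ y ∈ D, y ≠ x ∧ vr y = vr x) ∧
    s'.arr aOut = s.arr aOut ∧ (∀ x ∈ D, s'.arr aSnk x = 1) ∧
    (∀ x, x ∉ D → s'.arr aSnk x = s.arr aSnk x))

/-- Rejection also undoes the assignments made before the conflict was found. -/
theorem run_settleProg {s : RamState} {vr vl : ℕ → ℕ} {D : List ℕ}
    (hD : D = stackOf (s.arr aOrd) (s.var rBeg) (s.var rFin - s.var rBeg))
    (hfin : s.var rBeg ≤ s.var rFin)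
    (hvr : s.arr aVar = vr) (hvl : s.arr aVal = vl) (hnd : D.Nodup)
    (hpos : ∀ x ∈ D, vl x ≠ 0)
    (hnew : ∀ x ∈ D, s.arr aOut (vr x) ≠ vl x) :
    Run settleProg s fun t s' => Settled vr vl D s s' ∧
      t ≤ settleCost * (s.var rFin - s.var rBeg + 1) := by
  have hmem : ∀ x, x ∈ D ↔ ∃ i, s.var rBeg ≤ i ∧ i < s.var rFin ∧ s.arr aOrd i = x := by
    intro x
    rw [hD, mem_stackOf, Nat.add_sub_cancel' hfin]
  have hordinj : ∀ i j, s.var rBeg ≤ i → i < j → j < s.var rFin →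
      s.arr aOrd i ≠ s.arr aOrd j := by
    have : ∀ m, (stackOf (s.arr aOrd) (s.var rBeg) m).Nodup → ∀ i j, s.var rBeg ≤ i → i < j →
        j < s.var rBeg + m → s.arr aOrd i ≠ s.arr aOrd j := by
      intro m
      induction m with
      | zero => intro _ i j h1 h2 h3; omega
      | succ m ih =>
        intro h i j h1 h2 h3
        rw [stackOf, List.nodup_cons] at h
        by_cases hj : j = s.var rBeg + m
        · intro heq
          exact h.1 (mem_stackOf.2 ⟨i, h1, by omega, by rw [heq, hj]⟩)
        · exact ih h.2 i j h1 h2 (by omega)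
    intro i j h1 h2 h3
    exact this _ (hD ▸ hnd) i j h1 h2 (by omega)
  refine Run.block_straight rfl fun t₁ ht₁ => ?_
  have hb₁ : t₁ ≤ 5 := ht₁.trans (by decide)
  clear ht₁
  set s₁ := RamProg.run _ s with hs₁
  have hbad₁ : s₁.var rBad = s.var rTgt := rfl
  have hJ₁ : s₁.var rJ = s.var rBeg := rfl
  have hbeg₁ : s₁.var rBeg = s.var rBeg := rfl
  have hfin₁ : s₁.var rFin = s.var rFin := rfl
  have harr₁ : s₁.arr = s.arr := rfl
  clear_value s₁
  refine Run.block_cons ((Run.while (fun t s' => RamProg.Frame acceptBody s₁ s' ∧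
      s.var rBeg ≤ s'.var rJ ∧ s'.var rJ ≤ s.var rFin ∧
      (∀ v, s.arr aOut v ≠ 0 → s'.arr aOut v = s.arr aOut v) ∧
      (∀ v, s.arr aOut v = 0 → s'.arr aOut v = 0 ∨ ∃ i, s.var rBeg ≤ i ∧ i < s'.var rJ ∧
        vr (s.arr aOrd i) = v ∧ s'.arr aOut v = vl (s.arr aOrd i)) ∧
      (s'.var rBad = 0 → s.var rTgt = 0 ∧ ∀ i, s.var rBeg ≤ i → i < s'.var rJ →
        s'.arr aOut (vr (s.arr aOrd i)) = vl (s.arr aOrd i)) ∧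
      (s'.var rBad ≠ 0 → s.var rTgt ≠ 0 ∨ ∃ x ∈ D, s.arr aOut (vr x) ≠ 0 ∨
        ∃ y ∈ D, y ≠ x ∧ vr y = vr x) ∧
      t ≤ 30 * (s'.var rJ - s.var rBeg)) (30 * (s.var rFin - s.var rBeg)) ?_
      ⟨.refl _ _, by omega, by omega, fun v _ => by rw [harr₁], fun v hv => .inl (by rw [harr₁, hv]),
        fun h => ⟨hbad₁ ▸ h, fun i h1 h2 => by omega⟩, fun h => .inl (hbad₁ ▸ h), by omega⟩
      ?_).mono ?_)
  · rintro t s' ⟨-, -, h1, -, -, -, -, h2⟩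
    have : 30 * (s'.var rJ - s.var rBeg) ≤ 30 * (s.var rFin - s.var rBeg) :=
      Nat.mul_le_mul_left _ (by omega)
    omega
  · rintro t s₂ ⟨hf, h1, h2, h3, h4, h5, h6, ht⟩ hcond
    rw [Ne, RamExpr.eval_lt_eq_zero] at hcond
    simp only [RamExpr.eval] at hcond
    have hfin₂ : s₂.var rFin = s.var rFin :=
      (hf.var _ (by simp [acceptBody, RamProg.modVar, RamProg.block])).trans hfin₁
    have harr₂ : ∀ a, a ≠ aOut → s₂.arr a = s.arr a := fun a ha => by
      rw [hf.arr _ (by simpa [acceptBody, RamProg.modArr, RamProg.block] using ha), harr₁]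
    have hx : s.arr aOrd (s₂.var rJ) ∈ D := (hmem _).2 ⟨_, h1, by omega, rfl⟩
    set x := s.arr aOrd (s₂.var rJ) with hxdef
    refine (Run.straight (P := acceptBody) rfl (Q := fun t' s' => s' = acceptBody.run s₂ ∧
      t' ≤ acceptBody.bound) fun t' ht' => ⟨rfl, ht'⟩).frame.mono ?_
    rintro t' s₃ ⟨⟨hs₃, ht'⟩, hf₃⟩
    have hb' : t' ≤ 25 := ht'.trans (by decide)
    have hfr : RamProg.Frame acceptBody s₁ s₃ := ⟨fun x hx => by rw [hf₃.var x hx, hf.var x hx],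
      fun x hx => by rw [hf₃.arr x hx, hf.arr x hx]⟩
    have ht₃ : t + ((RamExpr.lt (.var rJ) (.var rFin)).cost + 1 + t') ≤
        30 * (s₂.var rJ + 1 - s.var rBeg) := by
      have : s₂.var rJ + 1 - s.var rBeg = s₂.var rJ - s.var rBeg + 1 := by omega
      rw [this]
      simp only [RamExpr.cost]
      omega
    by_cases ho : s₂.arr aOut (vr x) = 0
    · have hJ₃ : s₃.var rJ = s₂.var rJ + 1 := by
        simp [hs₃, acceptBody, RamProg.block, RamProg.run, RamExpr.eval, harr₂, hvr, hvl,
          ← hxdef, ho]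
      have hbad₃ : s₃.var rBad = s₂.var rBad := by
        simp [hs₃, acceptBody, RamProg.block, RamProg.run, RamExpr.eval, harr₂, hvr, hvl,
          ← hxdef, ho]
      have hout₃ : s₃.arr aOut = Function.update (s₂.arr aOut) (vr x) (vl x) := by
        simp [hs₃, acceptBody, RamProg.block, RamProg.run, RamExpr.eval, harr₂, hvr, hvl,
          ← hxdef, ho]
      rw [hJ₃, hbad₃, hout₃]
      refine ⟨hfr, by omega, by omega, fun v hv => ?_, fun v hv => ?_, fun hb => ?_, h6, ht₃⟩
      · have : v ≠ vr x := by rintro rfl; exact hv (by rw [← h3 _ hv, ho])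
        rw [Function.update_of_ne this, h3 v hv]
      · by_cases hvx : v = vr x
        · subst hvx
          exact .inr ⟨s₂.var rJ, h1, by omega, rfl, by simp [hxdef]⟩
        · rw [Function.update_of_ne hvx]
          rcases h4 v hv with h | ⟨i, hi1, hi2, hi3⟩
          · exact .inl h
          · exact .inr ⟨i, hi1, by omega, hi3⟩
      · refine ⟨(h5 hb).1, fun i hi1 hi2 => ?_⟩
        by_cases hi : i = s₂.var rJ
        · rw [hi, ← hxdef, Function.update_self]
        · have h7 := (h5 hb).2 i hi1 (by omega)
          have : vr (s.arr aOrd i) ≠ vr x := by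
            intro heq
            rw [heq, ho] at h7
            exact hpos _ ((hmem _).2 ⟨i, hi1, by omega, rfl⟩) h7.symm
          rw [Function.update_of_ne this, h7]
    · have hJ₃ : s₃.var rJ = s₂.var rJ + 1 := by
        simp [hs₃, acceptBody, RamProg.block, RamProg.run, RamExpr.eval, harr₂, hvr,
          ← hxdef, ho]
      have hbad₃ : s₃.var rBad = 1 := by
        simp [hs₃, acceptBody, RamProg.block, RamProg.run, RamExpr.eval, harr₂, hvr,
          ← hxdef, ho]
      have hout₃ : s₃.arr aOut = s₂.arr aOut := by
        simp [hs₃, acceptBody, RamProg.block, RamProg.run, RamExpr.eval, harr₂, hvr,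
          ← hxdef, ho]
      rw [hJ₃, hbad₃, hout₃]
      refine ⟨hfr, by omega, by omega, h3, fun v hv => ?_, fun hb => absurd hb one_ne_zero,
        fun _ => .inr ⟨x, hx, ?_⟩, ht₃⟩
      · rcases h4 v hv with h | ⟨i, hi1, hi2, hi3⟩
        · exact .inl h
        · exact .inr ⟨i, hi1, by omega, hi3⟩
      · by_cases ho₀ : s.arr aOut (vr x) = 0
        · rcases h4 _ ho₀ with h | ⟨i, hi1, hi2, hi3, -⟩
          · exact absurd h ho
          · exact .inr ⟨_, (hmem _).2 ⟨i, hi1, by omega, rfl⟩,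
              hordinj i _ hi1 hi2 (by omega), hi3⟩
        · exact .inl ho₀
  rintro t₂ s₂ ⟨hcond, t₂', rfl, hf, h1, h2, h3, h4, h5, h6, ht⟩
  have hfin₂ : s₂.var rFin = s.var rFin :=
    (hf.var _ (by simp [acceptBody, RamProg.modVar, RamProg.block])).trans hfin₁
  have hbeg₂ : s₂.var rBeg = s.var rBeg :=
    (hf.var _ (by simp [acceptBody, RamProg.modVar, RamProg.block])).trans hbeg₁
  have harr₂ : ∀ a, a ≠ aOut → s₂.arr a = s.arr a := fun a ha => by
    rw [hf.arr _ (by simpa [acceptBody, RamProg.modArr, RamProg.block] using ha), harr₁]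
  rw [RamExpr.eval_lt_eq_zero] at hcond
  simp only [RamExpr.eval] at hcond
  have hJ₂ : s₂.var rJ = s.var rFin := by omega
  rw [hJ₂] at h4 h5 ht
  by_cases hbad : s₂.var rBad = 0
  · refine Run.block_cons (Run.iteFalse hbad (Run.straight rfl fun t₃ ht₃ => Run.block_nil
      ⟨.inl ⟨(h5 hbad).1, harr₂ _ (by decide), ?_, h3, ?_⟩, ?_⟩))
    · intro x hx
      obtain ⟨i, hi1, hi2, rfl⟩ := (hmem x).1 hx
      exact (h5 hbad).2 i hi1 hi2
    · intro v hv
      rcases h4 v hv with h | ⟨i, hi1, hi2, hi3, hi4⟩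
      · exact .inl h
      · exact .inr ⟨_, (hmem _).2 ⟨i, hi1, hi2, rfl⟩, hi3, hi4⟩
    · have hb₃ : t₃ ≤ 1 := ht₃
      simp only [RamExpr.cost, settleCost]
      omega
  · refine Run.block_cons (Run.iteTrue hbad (Run.block_straight rfl fun t₃ ht₃ => ?_))
    have hb₃ : t₃ ≤ 2 := ht₃
    clear ht₃
    set s₃ := RamProg.run _ s₂ with hs₃
    have hJ₃ : s₃.var rJ = s.var rBeg := hbeg₂
    have hfin₃ : s₃.var rFin = s.var rFin := hfin₂
    have harr₃ : s₃.arr = s₂.arr := rfl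
    clear_value s₃
    refine Run.block_cons ((Run.while (fun t s' => RamProg.Frame rejectBody s₃ s' ∧
      s.var rBeg ≤ s'.var rJ ∧ s'.var rJ ≤ s.var rFin ∧
      (∀ v, s.arr aOut v ≠ 0 → s'.arr aOut v = s.arr aOut v) ∧
      (∀ v, s.arr aOut v = 0 → s'.arr aOut v = 0 ∨ ∃ i, s'.var rJ ≤ i ∧ i < s.var rFin ∧
        vr (s.arr aOrd i) = v ∧ s'.arr aOut v = vl (s.arr aOrd i)) ∧
      (∀ i, s.var rBeg ≤ i → i < s'.var rJ → s'.arr aSnk (s.arr aOrd i) = 1) ∧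
      (∀ x, x ∉ D → s'.arr aSnk x = s.arr aSnk x) ∧
      t ≤ 40 * (s'.var rJ - s.var rBeg)) (40 * (s.var rFin - s.var rBeg)) ?_
      ⟨.refl _ _, by omega, by omega, fun v hv => by rw [harr₃, h3 v hv], fun v hv => ?_,
        fun i h1 h2 => by omega, fun x _ => by rw [harr₃, harr₂ _ (by decide)], by omega⟩
      ?_).mono ?_)
    · rintro t s' ⟨-, -, h1, -, -, -, -, h2⟩
      have : 40 * (s'.var rJ - s.var rBeg) ≤ 40 * (s.var rFin - s.var rBeg) :=
        Nat.mul_le_mul_left _ (by omega)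
      omega
    · rw [harr₃, hJ₃]; exact h4 v hv
    · rintro t s₄ ⟨hf₄, g1, g2, g3, g4, g5, g6, gt⟩ hcond₄
      rw [Ne, RamExpr.eval_lt_eq_zero] at hcond₄
      simp only [RamExpr.eval] at hcond₄
      have hfin₄ : s₄.var rFin = s.var rFin :=
        (hf₄.var _ (by simp [rejectBody, RamProg.modVar, RamProg.block])).trans hfin₃
      have harr₄ : ∀ a, a ≠ aOut → a ≠ aSnk → s₄.arr a = s.arr a := fun a ha ha' => by
        rw [hf₄.arr _ (by simpa [rejectBody, RamProg.modArr, RamProg.block] using ⟨ha', ha⟩),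
          harr₃, harr₂ a ha]
      have hx : s.arr aOrd (s₄.var rJ) ∈ D := (hmem _).2 ⟨_, g1, by omega, rfl⟩
      set x := s.arr aOrd (s₄.var rJ) with hxdef
      refine (Run.straight (P := rejectBody) rfl (Q := fun t' s' => s' = rejectBody.run s₄ ∧
        t' ≤ rejectBody.bound) fun t' ht' => ⟨rfl, ht'⟩).frame.mono ?_
      rintro t' s₅ ⟨⟨hs₅, ht'⟩, hf₅⟩
      have hb' : t' ≤ 35 := ht'.trans (by decide)
      have hfr : RamProg.Frame rejectBody s₃ s₅ :=
        ⟨fun x hx => by rw [hf₅.var x hx, hf₄.var x hx],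
          fun x hx => by rw [hf₅.arr x hx, hf₄.arr x hx]⟩
      have hJ₅ : s₅.var rJ = s₄.var rJ + 1 := by
        by_cases h : s₄.arr aOut (vr x) = vl x <;>
          simp [hs₅, rejectBody, RamProg.block, RamProg.run, RamExpr.eval, harr₄, hvr, hvl,
            ← hxdef, h]
      have hsnk₅ : s₅.arr aSnk = Function.update (s₄.arr aSnk) x 1 := by
        by_cases h : s₄.arr aOut (vr x) = vl x <;>
          simp [hs₅, rejectBody, RamProg.block, RamProg.run, RamExpr.eval, harr₄, hvr, hvl,
            ← hxdef, h]
      have hout₅ : s₅.arr aOut = if s₄.arr aOut (vr x) = vl x then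
          Function.update (s₄.arr aOut) (vr x) 0 else s₄.arr aOut := by
        by_cases h : s₄.arr aOut (vr x) = vl x <;>
          simp [hs₅, rejectBody, RamProg.block, RamProg.run, RamExpr.eval, harr₄, hvr, hvl,
            ← hxdef, h]
      rw [hJ₅, hsnk₅, hout₅]
      refine ⟨hfr, by omega, by omega, fun v hv => ?_, fun v hv => ?_, fun i hi1 hi2 => ?_,
        fun y hy => ?_, ?_⟩
      · split_ifs with h
        · have : v ≠ vr x := by
            rintro rfl
            rw [g3 _ hv] at h
            exact hnew x hx h
          rw [Function.update_of_ne this, g3 v hv]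
        · exact g3 v hv
      · by_cases hvx : v = vr x
        · subst hvx
          split_ifs with h
          · exact .inl (by simp)
          · rcases g4 _ hv with h' | ⟨i, hi1, hi2, hi3, hi4⟩
            · exact .inl h'
            · refine .inr ⟨i, ?_, hi2, hi3, hi4⟩
              have : i ≠ s₄.var rJ := by rintro rfl; exact h hi4
              omega
        · have e1 : (if s₄.arr aOut (vr x) = vl x then
              Function.update (s₄.arr aOut) (vr x) 0 else s₄.arr aOut) v = s₄.arr aOut v := by
            split_ifs
            · rw [Function.update_of_ne hvx]
            · rfl
          rw [e1]
          rcases g4 _ hv with h' | ⟨i, hi1, hi2, hi3, hi4⟩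
          · exact .inl h'
          · refine .inr ⟨i, ?_, hi2, hi3, hi4⟩
            have : i ≠ s₄.var rJ := by rintro rfl; exact hvx hi3.symm
            omega
      · by_cases hi : i = s₄.var rJ
        · rw [hi, ← hxdef, Function.update_self]
        · rw [Function.update_of_ne (hordinj i _ hi1 (by omega) (by omega)),
            g5 i hi1 (by omega)]
      · rw [Function.update_of_ne (by rintro rfl; exact hy hx), g6 y hy]
      · have : s₄.var rJ + 1 - s.var rBeg = s₄.var rJ - s.var rBeg + 1 := by omega
        rw [this]
        simp only [RamExpr.cost]
        omega
    · rintro t₅ s₅ ⟨hcond₅, t₅', rfl, hf₅, g1, g2, g3, g4, g5, g6, gt⟩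
      have hfin₅ : s₅.var rFin = s.var rFin :=
        (hf₅.var _ (by simp [rejectBody, RamProg.modVar, RamProg.block])).trans hfin₃
      rw [RamExpr.eval_lt_eq_zero] at hcond₅
      simp only [RamExpr.eval] at hcond₅
      have hJ₅ : s₅.var rJ = s.var rFin := by omega
      rw [hJ₅] at g4 g5 gt
      refine Run.block_nil (Run.block_nil ⟨.inr ⟨h6 hbad, ?_, ?_, g6⟩, ?_⟩)
      · funext v
        by_cases hv : s.arr aOut v = 0
        · rcases g4 v hv with h | ⟨i, hi1, hi2, -⟩
          · rw [h, hv]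
          · omega
        · exact g3 v hv
      · intro x hx
        obtain ⟨i, hi1, hi2, rfl⟩ := (hmem x).1 hx
        exact g5 i hi1 hi2
      · simp only [RamExpr.cost, settleCost]
        omega

/-! ### Extending the minimum solution -/

namespace Network

/-- `x` is a node of the network. -/
def IsNode (N : Network) (x : ℕ) : Prop := ∃ h, N.IsArc h ∧ N.dst h = x

/-- `vr` and `vl` give the variables and the values of the nodes. -/
def Layout (N : Network) (k n : ℕ) (vr vl : ℕ → ℕ) : Prop :=
  ∀ x, N.IsNode x → x = node k (vr x) (vl x) ∧ 1 ≤ vl x ∧ vl x ≤ k ∧ vr x < n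

theorem Layout.inj {N : Network} {k n : ℕ} {vr vl : ℕ → ℕ} (hL : N.Layout k n vr vl) {x y : ℕ}
    (hx : N.IsNode x) (hy : N.IsNode y) (h1 : vr x = vr y) (h2 : vl x = vl y) : x = y := by
  rw [(hL x hx).1, (hL y hy).1, h1, h2]

/-- The network with other capacities to the sink. -/
def withSnk (N : Network) (f : ℕ → ℕ) : Network := { N with snk := f }

end Network

/-- In the stage where minimum solutions are extended: `B` is the set of nodes that have been settled, and
`S` the set of those that have been assigned. The other nodes of `B` are marked by `snk`, and no minimum
solution whose cut contains `S` uses them. -/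
structure Assigned (N : Network) (k n : ℕ) (vr vl out snk : ℕ → ℕ) (B S : Finset ℕ) : Prop where
  cover : ∀ x ∈ B, x ∈ S ∨ snk x ≠ 0
  sub : S ⊆ B
  node : ∀ x ∈ B, N.IsNode x
  mem_iff : ∀ x, N.IsNode x → (x ∈ S ↔ out (vr x) = vl x)
  outval : ∀ v, out v ≠ 0 → ∃ x ∈ S, vr x = v ∧ vl x = out v
  edge : ∀ u ∈ S, ∀ w, N.Edge N.cap u w → w ∈ S
  snk_zero : ∀ x ∈ S, snk x = 0
  snk_mono : ∀ x, N.snk x ≠ 0 → snk x ≠ 0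
  fail : ∀ x, snk x ≠ 0 → ∀ ψ : Fin n → Fin (k + 1), N.IsClosed (nodeSet ψ) →
    S ⊆ nodeSet ψ → x ∉ nodeSet ψ

/-- The cut of an assignment contains at most one node for each variable. -/
theorem eq_of_mem_nodeSet {k n : ℕ} {ψ : Fin n → Fin (k + 1)} {v a b : ℕ} (ha : a ≤ k)
    (hb : b ≤ k) (h1 : node k v a ∈ nodeSet ψ) (h2 : node k v b ∈ nodeSet ψ) : a = b := by
  obtain ⟨v₁, -, h1⟩ := mem_nodeSet_iff.1 h1
  obtain ⟨v₂, -, h2⟩ := mem_nodeSet_iff.1 h2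
  obtain ⟨e1, e2⟩ := node_inj (by omega) ha h1
  obtain ⟨e3, e4⟩ := node_inj (by omega) hb h2
  have : v₁ = v₂ := Fin.ext (e1.trans e3.symm)
  rw [← e2, ← e4, this]

section

variable {N : Network} {k n : ℕ} {vr vl out snk out' snk' : ℕ → ℕ} {B S : Finset ℕ} {D : List ℕ}

/-- A component is assigned when it has no edge to a rejected node and its variables have no other values. -/
theorem Assigned.accept (hL : N.Layout k n vr vl) (h : Assigned N k n vr vl out snk B S)
    (hD : ∀ x ∈ D, N.IsNode x)
    (hedge : ∀ x ∈ D, ∀ w, N.Edge N.cap x w → (w ∈ D ∨ w ∈ B) ∧ snk w = 0)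
    (hsnk : ∀ x ∈ D, snk x = 0) (ho1 : ∀ x ∈ D, out' (vr x) = vl x)
    (ho2 : ∀ v, out v ≠ 0 → out' v = out v)
    (ho3 : ∀ v, out v = 0 → out' v = 0 ∨ ∃ x ∈ D, vr x = v ∧ out' v = vl x) :
    Assigned N k n vr vl out' snk (B ∪ D.toFinset) (S ∪ D.toFinset) where
  cover x hx := by
    simp only [Finset.mem_union, List.mem_toFinset] at hx ⊢
    rcases hx with hx | hx
    · rcases h.cover x hx with h' | h'
      · exact .inl (.inl h')
      · exact .inr h'
    · exact .inl (.inr hx)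
  sub := Finset.union_subset_union_left h.sub
  node x hx := by
    simp only [Finset.mem_union, List.mem_toFinset] at hx
    exact hx.elim (h.node x) (hD x)
  mem_iff x hx := by
    simp only [Finset.mem_union, List.mem_toFinset, h.mem_iff x hx]
    have hpos := (hL x hx).2.1
    constructor
    · rintro (h' | h')
      · rw [ho2 _ (by omega), h']
      · exact ho1 x h'
    · intro h'
      by_cases h0 : out (vr x) = 0
      · rcases ho3 _ h0 with h1 | ⟨y, hy, h1, h2⟩
        · omega
        · exact .inr (hL.inj (hD y hy) hx h1 (h2.symm.trans h') ▸ hy)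
      · exact .inl (by rw [← ho2 _ h0, h'])
  outval v hv := by
    by_cases h0 : out v = 0
    · rcases ho3 v h0 with h1 | ⟨y, hy, h1, h2⟩
      · exact absurd h1 hv
      · exact ⟨y, by simp [hy], h1, h2.symm⟩
    · obtain ⟨x, hx, h1, h2⟩ := h.outval v h0
      exact ⟨x, Finset.mem_union_left _ hx, h1, by rw [ho2 v h0, h2]⟩
  edge u hu w huw := by
    simp only [Finset.mem_union, List.mem_toFinset] at hu ⊢
    rcases hu with hu | hu
    · exact .inl (h.edge u hu w huw)
    · obtain ⟨h1 | h1, h2⟩ := hedge u hu w huw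
      · exact .inr h1
      · exact .inl ((h.cover w h1).resolve_right (by simp [h2]))
  snk_zero x hx := by
    simp only [Finset.mem_union, List.mem_toFinset] at hx
    exact hx.elim (h.snk_zero x) (hsnk x)
  snk_mono := h.snk_mono
  fail x hx ψ hψ hS := h.fail x hx ψ hψ (Finset.union_subset_left hS)

/-- A component is rejected when it reaches a rejected node, when one of its variables has been assigned
another value, or when it contains two values of a variable. A closed set that contains one of its nodes
contains all of them. -/
theorem Assigned.reject (hL : N.Layout k n vr vl) (h : Assigned N k n vr vl out snk B S)
    (hD : ∀ x ∈ D, N.IsNode x) (hDB : ∀ x ∈ D, x ∉ B)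
    (hstrong : ∀ x ∈ D, ∀ y ∈ D, N.Reach N.cap x y)
    (hbad : (∃ w, snk w ≠ 0 ∧ ∀ x ∈ D, N.Reach N.cap x w) ∨
      ∃ x ∈ D, out (vr x) ≠ 0 ∨ ∃ y ∈ D, y ≠ x ∧ vr y = vr x)
    (hs1 : ∀ x ∈ D, snk' x = 1) (hs2 : ∀ x, x ∉ D → snk' x = snk x) :
    Assigned N k n vr vl out snk' (B ∪ D.toFinset) S where
  cover x hx := by
    simp only [Finset.mem_union, List.mem_toFinset] at hx
    by_cases hxD : x ∈ D
    · exact .inr (by rw [hs1 x hxD]; exact one_ne_zero)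
    · rw [hs2 x hxD]; exact h.cover x (hx.resolve_right hxD)
  sub := h.sub.trans Finset.subset_union_left
  node x hx := by
    simp only [Finset.mem_union, List.mem_toFinset] at hx
    exact hx.elim (h.node x) (hD x)
  mem_iff := h.mem_iff
  outval := h.outval
  edge := h.edge
  snk_zero x hx := by
    rw [hs2 x fun hxD => hDB x hxD (h.sub hx), h.snk_zero x hx]
  snk_mono x hx := by
    by_cases hxD : x ∈ D
    · rw [hs1 x hxD]; exact one_ne_zero
    · rw [hs2 x hxD]; exact h.snk_mono x hx
  fail z hz ψ hψ hS hzψ := by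
    by_cases hzD : z ∈ D
    · have hall : ∀ y ∈ D, y ∈ nodeSet ψ := fun y hy =>
        mem_of_reach hψ.edge (hstrong z hzD y hy) hzψ
      rcases hbad with ⟨w, hw, hr⟩ | ⟨x, hx, hc⟩
      · exact h.fail w hw ψ hψ hS (mem_of_reach hψ.edge (hr z hzD) hzψ)
      · have hxψ := hall x hx
        obtain ⟨hx1, hx2, hx3, -⟩ := hL x (hD x hx)
        rcases hc with ho | ⟨y, hy, hne, hv⟩
        · obtain ⟨y, hy, h1, h2⟩ := h.outval _ ho
          have hyψ := hS hy
          have hyn := h.node y (h.sub hy)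
          obtain ⟨hy1, hy2, hy3, -⟩ := hL y hyn
          rw [hx1] at hxψ
          rw [hy1, h1] at hyψ
          have := eq_of_mem_nodeSet hx3 hy3 hxψ hyψ
          rw [h2] at this
          exact hDB x hx (h.sub ((h.mem_iff x (hD x hx)).2 this.symm))
        · have hyψ := hall y hy
          obtain ⟨hy1, hy2, hy3, -⟩ := hL y (hD y hy)
          rw [hx1] at hxψ
          rw [hy1, hv] at hyψ
          exact hne (hL.inj (hD y hy) (hD x hx) hv (eq_of_mem_nodeSet hy3 hx3 hyψ hxψ))
    · rw [hs2 z hzD] at hz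
      exact h.fail z hz ψ hψ hS hzψ

end

/-- The memory between two components: the nodes of `B` have been visited and settled. -/
structure Between (N : Network) (k n : ℕ) (vr vl : ℕ → ℕ) (B S : Finset ℕ) (s : RamState) :
    Prop where
  net : Network.ofState s = N.withSnk (s.arr aSnk)
  sp : s.var rSp = 0
  vis_le : ∀ x, s.arr aVis x ≤ s.var rSt
  vis_iff : ∀ x, s.arr aVis x = s.var rSt ↔ x ∈ B
  cur : ∀ x ∈ B, s.arr aCur x = 0
  edge : ∀ u ∈ B, ∀ w, N.Edge N.cap u w → w ∈ B
  vr_eq : s.arr aVar = vr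
  vl_eq : s.arr aVal = vl
  assigned : Assigned N k n vr vl (s.arr aOut) (s.arr aSnk) B S

/-- The part of `Between` that does not depend on the outcome of settling. -/
theorem Between.of_settle {N : Network} {k n : ℕ} {vr vl : ℕ → ℕ} {B B' S' : Finset ℕ}
    {Rt : ℕ → Prop} {s₂ s₃ : RamState} {f : ℕ → ℕ}
    (hS₂ : Searching true (N.withSnk f) Rt B s₂)
    (hvr : s₂.arr aVar = vr) (hvl : s₂.arr aVal = vl)
    (hf : RamProg.Frame settleProg s₂ s₃) (hB' : B' = B ∪ (Dfs.ofState s₂).done.toFinset)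
    (hA : Assigned N k n vr vl (s₃.arr aOut) (s₃.arr aSnk) B' S') :
    Between N k n vr vl B' S' s₃ := by
  have hv : ∀ x, x ≠ rU → x ≠ rBad → x ≠ rJ → s₃.var x = s₂.var x := fun x h1 h2 h3 =>
    hf.var x (by simp [settleProg, acceptBody, rejectBody, RamProg.modVar, RamProg.block, *])
  have ha : ∀ x, x ≠ aOut → x ≠ aSnk → s₃.arr x = s₂.arr x := fun x h1 h2 =>
    hf.arr x (by simp [settleProg, acceptBody, rejectBody, RamProg.modArr, RamProg.block, *])
  have hstk : (Dfs.ofState s₂).stk = [] := by simp [Dfs.ofState, hS₂.sp, stackOf]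
  have hI := hS₂.inv
  rw [Network.active_true] at hI
  have hmem : ∀ x, x ∈ B' ↔ x ∈ (Dfs.ofState s₂).done ∨ x ∈ B := fun x => by
    rw [hB', Finset.mem_union, List.mem_toFinset, or_comm]
  refine
    { net := ?_, sp := (hv _ (by decide) (by decide) (by decide)).trans hS₂.sp, vis_le := ?_,
      vis_iff := ?_, cur := ?_, edge := ?_, vr_eq := (ha _ (by decide) (by decide)).trans hvr,
      vl_eq := (ha _ (by decide) (by decide)).trans hvl, assigned := hA }
  · have h := hS₂.net
    have : Network.ofState s₃ = (Network.ofState s₂).withSnk (s₃.arr aSnk) := by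
      simp only [Network.ofState, Network.withSnk]
      rw [hv rH (by decide) (by decide) (by decide), ha aDst (by decide) (by decide),
        ha aMate (by decide) (by decide), ha aCap (by decide) (by decide),
        ha aNxt (by decide) (by decide), ha aHead (by decide) (by decide),
        ha aSrc (by decide) (by decide)]
    rw [this, h]
    rfl
  · intro x
    rw [ha aVis (by decide) (by decide), hv rSt (by decide) (by decide) (by decide)]
    exact hI.vis_le x
  · intro x
    rw [ha aVis (by decide) (by decide), hv rSt (by decide) (by decide) (by decide), hmem]
    have := hI.vis_iff x
    rw [hstk] at this
    simp only [List.not_mem_nil, false_or] at this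
    exact this
  · intro x hx
    rw [ha aCur (by decide) (by decide)]
    exact hI.cur_done x ((hmem x).1 hx)
  · intro u hu w huw
    exact (hmem w).2 (hI.edge_mem hstk ((hmem u).1 hu) huw)

/-- The number of arcs left does not depend on the part of the memory that is changed between searches. -/
theorem arcsLeft_congr {s s' : RamState} (h1 : s'.var rH = s.var rH) (h2 : s'.arr aDst = s.arr aDst)
    (h3 : s'.arr aMate = s.arr aMate) (h4 : s'.arr aVis = s.arr aVis)
    (h5 : s'.arr aCur = s.arr aCur) (h6 : s'.var rSt = s.var rSt) : arcsLeft s' = arcsLeft s := by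
  unfold arcsLeft Dfs.unpassed
  congr 1
  ext h
  rw [Finset.mem_filter, Finset.mem_filter]
  simp only [Network.ofState, Dfs.ofState, Network.frm, h1, h2, h3, h4, h5, h6]

/-- `o 0, …, o (L - 1)` are the nodes, in a postorder of the network with all arcs reversed. -/
structure IsPostorder (N : Network) (o : ℕ → ℕ) (L : ℕ) : Prop where
  finish : Dfs.FinishOK (fun u w => N.Edge N.cap w u) ∅ (stackOf o 0 L)
  nodup : (stackOf o 0 L).Nodup
  mem_iff : ∀ x, x ∈ stackOf o 0 L ↔ N.IsNode x

theorem finishOK_stackOf {E : ℕ → ℕ → Prop} {B : Finset ℕ} {o : ℕ → ℕ} {L l : ℕ} (hl : l ≤ L)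
    (h : Dfs.FinishOK E B (stackOf o 0 L)) : Dfs.FinishOK E B (stackOf o 0 l) := by
  induction L, hl using Nat.le_induction with
  | base => exact h
  | succ L _ ih => exact ih h.1

theorem nodup_stackOf {o : ℕ → ℕ} {L l : ℕ} (hl : l ≤ L)
    (h : (stackOf o 0 L).Nodup) : (stackOf o 0 l).Nodup := by
  induction L, hl using Nat.le_induction with
  | base => exact h
  | succ L _ ih => exact ih (List.nodup_cons.1 h).2

theorem Network.IsNode.of_reach {N : Network} {c : ℕ → ℕ} {a b : ℕ} (h : N.Reach c a b)
    (ha : N.IsNode a) : N.IsNode b := by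
  induction h with
  | refl => exact ha
  | tail _ hbc _ =>
    obtain ⟨e, he, -, hd, -⟩ := hbc
    exact ⟨e, he, hd⟩

/-- The next component is found and settled. -/
def componentProg : RamProg := .block [
  .block [
    .assign rL (.sub (.var rL) (.const 1)),
    .assign rW (.get aOrd (.var rL)),
    .assign rTgt (.const 0),
    .assign rBeg (.var rFin)],
  rootProg true,
  settleProg]

/-- The cost of `componentProg` per node. -/
def componentCost : ℕ := 500

theorem frame_searchProg {b : Bool} {s s' : RamState} (h : RamProg.Frame (rootProg b) s s') :
    s'.arr aVar = s.arr aVar ∧ s'.arr aVal = s.arr aVal ∧ s'.arr aOut = s.arr aOut ∧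
      s'.var rL = s.var rL := by
  refine ⟨h.arr _ ?_, h.arr _ ?_, h.arr _ ?_, h.var _ ?_⟩ <;>
    simp [rootProg, dfsProg, dfsBody, visitProg, RamProg.modVar, RamProg.modArr, RamProg.block]

theorem frame_settleProg {s s' : RamState} (h : RamProg.Frame settleProg s s') :
    (∀ x, x ≠ rU → x ≠ rBad → x ≠ rJ → s'.var x = s.var x) ∧
      ∀ x, x ≠ aOut → x ≠ aSnk → s'.arr x = s.arr x := by
  refine ⟨fun x h1 h2 h3 => h.var _ ?_, fun x h1 h2 => h.arr _ ?_⟩ <;>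
    simp [settleProg, acceptBody, rejectBody, RamProg.modVar, RamProg.modArr, RamProg.block, *]

section

variable {N : Network} {k n : ℕ} {vr vl o : ℕ → ℕ} {B S : Finset ℕ} {s : RamState} {L l : ℕ}

/-- If the node in question has been settled already, the search finds nothing and nothing changes. -/
theorem run_componentProg (hN : N.IsAdj) (hL : N.Layout k n vr vl) (hP : IsPostorder N o L)
    (hl : l < L) (h : Between N k n vr vl B S s) (hord : ∀ i < L, s.arr aOrd i = o i)
    (hfin : L ≤ s.var rFin) (hrL : s.var rL = l + 1)
    (hcov : ∀ x, N.IsNode x → x ∈ B ∨ x ∈ stackOf o 0 (l + 1)) :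
    Run componentProg s fun t s' => ∃ B' S', S ⊆ S' ∧ Between N k n vr vl B' S' s' ∧
      (∀ i < L, s'.arr aOrd i = o i) ∧ L ≤ s'.var rFin ∧ s'.var rL = l ∧
      (∀ x, N.IsNode x → x ∈ B' ∨ x ∈ stackOf o 0 l) ∧
      t + 240 * arcsLeft s' ≤ 240 * arcsLeft s + componentCost := by
  have hWn : N.IsNode (o l) := (hP.mem_iff _).1 (mem_stackOf.2 ⟨l, by omega, by omega, rfl⟩)
  refine Run.block_straight rfl fun t₁ ht₁ => ?_
  have hb₁ : t₁ ≤ 13 := ht₁.trans (by decide)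
  clear ht₁
  set s₁ := RamProg.run _ s with hs₁
  have hL₁ : s₁.var rL = l := by
    change s.var rL - 1 = l
    omega
  have hW₁ : s₁.var rW = o l := by
    change s.arr aOrd (s.var rL - 1) = o l
    rw [hrL]; exact hord l hl
  have htgt₁ : s₁.var rTgt = 0 := rfl
  have hbeg₁ : s₁.var rBeg = s.var rFin := rfl
  have hfin₁ : s₁.var rFin = s.var rFin := rfl
  have harr₁ : s₁.arr = s.arr := rfl
  have hsp₁ : s₁.var rSp = 0 := h.sp
  have hst₁ : s₁.var rSt = s.var rSt := rfl
  have hH₁ : s₁.var rH = s.var rH := rfl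
  clear_value s₁
  set N' := N.withSnk (s.arr aSnk) with hN'
  have hN'adj : N'.IsAdj := hN.of_eq rfl rfl rfl rfl rfl
  have hnet₁ : Network.ofState s₁ = N' := by
    rw [hN', ← h.net]
    exact Network.ofState_congr hH₁ fun a _ _ => by rw [harr₁]
  have hS₁ : Searching true N' (fun x => x = o l) B s₁ := by
    refine ⟨hnet₁, ?_, hsp₁, by omega⟩
    rw [N'.active_true]
    refine Dfs.Inv.start ?_ ?_ htgt₁ ?_ ?_ ?_ h.edge
    · simp [Dfs.ofState, hsp₁, stackOf]
    · simp [Dfs.ofState, hbeg₁, hfin₁, stackOf]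
    · intro x
      change s₁.arr aVis x ≤ s₁.var rSt
      rw [harr₁, hst₁]; exact h.vis_le x
    · intro x
      change s₁.arr aVis x = s₁.var rSt ↔ _
      rw [harr₁, hst₁]; exact h.vis_iff x
    · intro x hx
      change s₁.arr aCur x = 0
      rw [harr₁]; exact h.cur x hx
  have hleft₁ : arcsLeft s₁ = arcsLeft s := arcsLeft_congr hH₁ (by rw [harr₁]) (by rw [harr₁])
    (by rw [harr₁]) (by rw [harr₁]) hst₁
  refine Run.block_cons ((run_rootProg hN'adj hS₁ hW₁ (hW₁ ▸ hWn)).frame.mono ?_)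
  rintro t₂ s₂ ⟨⟨hS₂, hext, hvis₂, ht₂, hc₂⟩, hf₂⟩
  obtain ⟨hvr₂, hvl₂, hout₂, hrL₂⟩ := frame_searchProg hf₂
  have hbeg₂ := (frame_rootProg hf₂).1
  rw [harr₁] at hvr₂ hvl₂ hout₂
  rw [h.vr_eq] at hvr₂
  rw [h.vl_eq] at hvl₂
  have hsnk₂ : s₂.arr aSnk = s.arr aSnk := by
    change (Network.ofState s₂).snk = _
    rw [hS₂.net]; rfl
  have hI := hS₂.inv
  rw [N'.active_true] at hI
  have hstk : (Dfs.ofState s₂).stk = [] := by simp [Dfs.ofState, hS₂.sp, stackOf]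
  set D := (Dfs.ofState s₂).done with hD
  have hDB : ∀ x ∈ D, x ∉ B := fun x hx hxB => (hI.disj x hxB).2 hx
  have hDn : ∀ x ∈ D, N.IsNode x := fun x hx => hI.isNode x (.inr hx)
  have hDnd : D.Nodup := by have := hI.nodup; rwa [hstk, List.nil_append] at this
  have hreach : ∀ x ∈ D, N.Reach N.cap (o l) x := fun x hx => by
    obtain ⟨r, rfl, hr⟩ := hI.reach x (.inr hx)
    exact hr
  have hcons : stackOf o 0 (l + 1) = o l :: stackOf o 0 l := by rw [stackOf, zero_add]
  have hback : ∀ x ∈ D, N.Reach N.cap x (o l) := fun x hx =>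
    reach_back (hcons ▸ finishOK_stackOf (l := l + 1) hl hP.finish)
      (hcons ▸ nodup_stackOf (l := l + 1) hl hP.nodup) h.edge
      (fun y hy hr => hcons ▸ (hcov y (Network.IsNode.of_reach hr hWn)).resolve_left hy)
      (hDB x hx) (hreach x hx)
  refine Run.block_cons ((run_settleProg (D := D) rfl hS₂.fin hvr₂ hvl₂ hDnd
    (fun x hx => by have := (hL x (hDn x hx)).2.1; omega) fun x hx heq => ?_).frame.mono ?_)
  · rw [hout₂] at heq
    exact hDB x hx (h.assigned.sub ((h.assigned.mem_iff x (hDn x hx)).2 heq))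
  rintro t₃ s₃ ⟨⟨hset, ht₃⟩, hf₃⟩
  obtain ⟨hv₃, ha₃⟩ := frame_settleProg hf₃
  have hA : ∃ S', S ⊆ S' ∧
      Assigned N k n vr vl (s₃.arr aOut) (s₃.arr aSnk) (B ∪ D.toFinset) S' := by
    rcases hset with ⟨h1, h2, h3, h4, h5⟩ | ⟨h1, h2, h3, h4⟩
    · refine ⟨S ∪ D.toFinset, Finset.subset_union_left, ?_⟩
      rw [h2, hsnk₂]
      rw [hout₂] at h4 h5
      refine h.assigned.accept hL hDn (fun x hx w hw => ⟨hI.edge_mem hstk (.inl hx) hw, ?_⟩)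
        (fun x hx => ?_) h3 h4 h5
      · obtain ⟨e, he, rfl, rfl, hc⟩ := hw
        by_contra hne
        refine hI.snk_edge e he (by have := he.1; omega) (.inr hx) ?_ hc hne h1
        have := hI.cur_done _ (.inl hx)
        have h8 := he.1
        change (Dfs.ofState s₂).cur (N.frm e) < e
        rw [this]; omega
      · by_contra hne
        exact hI.snk_node x (.inr hx) hne h1
    · refine ⟨S, subset_rfl, ?_⟩
      rw [h2, hout₂]
      rw [hsnk₂] at h4
      refine h.assigned.reject hL hDn hDB (fun x hx y hy => (hback x hx).trans (hreach y hy)) ?_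
        h3 h4
      rcases h1 with h1 | ⟨x, hx, h1⟩
      · obtain ⟨h6, -, r, rfl, h7⟩ := hI.tgt h1
        exact .inl ⟨_, h6, fun x hx => (hback x hx).trans h7⟩
      · rw [hout₂] at h1
        exact .inr ⟨x, hx, h1⟩
  obtain ⟨S', hSS, hA⟩ := hA
  refine Run.block_nil ⟨_, S', hSS, Between.of_settle hS₂ hvr₂ hvl₂ hf₃ rfl hA, fun i hi => ?_,
    ?_, ?_, fun x hx => ?_, ?_⟩
  · rw [ha₃ _ (by decide) (by decide), hext.ord i (by omega), harr₁, hord i hi]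
  · have := hS₂.fin
    rw [hv₃ _ (by decide) (by decide) (by decide)]
    omega
  · rw [hv₃ _ (by decide) (by decide) (by decide), hrL₂, hL₁]
  · rcases hcov x hx with hx | hx
    · exact .inl (by simp [hx])
    · simp only [stackOf, zero_add, List.mem_cons] at hx
      rcases hx with rfl | hx
      · rw [hW₁] at hvis₂
        have := (hI.vis_iff _).1 hvis₂
        rw [hstk] at this
        left
        simp only [List.not_mem_nil, false_or] at this
        rw [Finset.mem_union, List.mem_toFinset]
        exact this.symm
      · exact .inr hx
  · have h9 : arcsLeft s₃ = arcsLeft s₂ :=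
      arcsLeft_congr (hv₃ _ (by decide) (by decide) (by decide))
        (ha₃ _ (by decide) (by decide)) (ha₃ _ (by decide) (by decide))
        (ha₃ _ (by decide) (by decide)) (ha₃ _ (by decide) (by decide))
        (hv₃ _ (by decide) (by decide) (by decide))
    rw [h9]
    simp only [stepCost, rootCost, settleCost, componentCost] at ht₂ ht₃ ⊢
    omega

end

theorem frame_scanProg {b : Bool} {s s' : RamState} (h : RamProg.Frame (scanProg b) s s') :
    s'.arr aVar = s.arr aVar ∧ s'.arr aVal = s.arr aVal ∧ s'.arr aOut = s.arr aOut ∧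
      s'.var rL = s.var rL ∧ Network.ofState s' = Network.ofState s := by
  refine ⟨h.arr _ ?_, h.arr _ ?_, h.arr _ ?_, h.var _ ?_,
    Network.ofState_congr (h.var _ ?_) fun a h1 h2 => h.arr _ ?_⟩
  case refine_6 =>
    simp [scanProg, scanBody, rootProg, dfsProg, dfsBody, visitProg, RamProg.modArr,
      RamProg.block]
    omega
  all_goals
    simp [scanProg, scanBody, rootProg, dfsProg, dfsBody, visitProg, RamProg.modVar,
      RamProg.modArr, RamProg.block]

/-- From a maximum flow, an extreme minimum solution: the nodes reachable from the source are assigned,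
then the strong components, in topological order (sinks first), as far as possible. -/
def secondProg : RamProg := .block [
  .assign rFin (.const 0),
  scanProg false,
  .assign rL (.var rFin),
  scanProg true,
  settleProg,
  .while (.var rL) componentProg]

/-- The cost of `secondProg` per arc. -/
def secondCost : ℕ := 3000

section

variable {k n : ℕ} {I : List (BasicFn k n)} {N : Network} {r : ℕ} {vr vl : ℕ → ℕ} {s : RamState}

/-- At the beginning, no node is settled. -/
theorem Assigned.empty (N : Network) (k n : ℕ) (vr vl : ℕ → ℕ) (hL : N.Layout k n vr vl) :
    Assigned N k n vr vl (fun _ => 0) N.snk ∅ ∅ where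
  cover := by simp
  sub := subset_rfl
  node := by simp
  mem_iff x hx := by
    have := (hL x hx).2.1
    simp only [Finset.notMem_empty, false_iff]
    omega
  outval v hv := absurd rfl hv
  edge := by simp
  snk_zero := by simp
  snk_mono _ h := h
  fail x hx ψ hψ _ hxψ := hx (hψ.snk x hxψ)

theorem IsPostorder.of_scanned (hN : N.IsAdj) (hs : Scanned false N s) (hbeg : s.var rBeg = 0) :
    IsPostorder N (s.arr aOrd) (s.var rFin) := by
  have hdone : (Dfs.ofState s).done = stackOf (s.arr aOrd) 0 (s.var rFin) := by
    simp [Dfs.ofState, hbeg]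
  have hstk : (Dfs.ofState s).stk = [] := by simp [Dfs.ofState, hs.sp, stackOf]
  have hE : N.Edge (N.active false) = fun u w => N.Edge N.cap w u := by
    funext u w
    exact propext (hN.edge_mate_iff u w)
  have hI := hs.inv
  refine ⟨?_, ?_, fun x => ?_⟩
  · rw [← hdone, ← hE]; exact hI.finish
  · have := hI.nodup
    rwa [hstk, List.nil_append, hdone] at this
  · rw [← hdone]
    refine ⟨fun hx => hI.isNode x (.inr hx), ?_⟩
    rintro ⟨h, hh, rfl⟩
    have := (hI.vis_iff _).1 (hs.roots h hh (by simp [Network.IsRoot]))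
    rw [hstk] at this
    simpa only [List.not_mem_nil, Finset.notMem_empty, false_or, or_false] using this

/-- The nodes reachable from the source are all assigned. -/
theorem Between.of_first {s₂ s₃ : RamState} {R : Finset ℕ} (hN : Represents N I r)
    (hL : N.Layout k n vr vl) (hR : N.IsClosed R)
    (hRreach : ∀ x ∈ R, ∃ u, N.src u ≠ 0 ∧ N.Reach N.cap u x)
    (hS : Scanned true N s₂) (hvr : s₂.arr aVar = vr) (hvl : s₂.arr aVal = vl)
    (hout : s₂.arr aOut = fun _ => 0) (hf : RamProg.Frame settleProg s₂ s₃)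
    (hset : Settled vr vl (Dfs.ofState s₂).done s₂ s₃) :
    ∃ S, (∀ u, N.src u ≠ 0 → u ∈ S) ∧ Between N k n vr vl S S s₃ := by
  have hstk : (Dfs.ofState s₂).stk = [] := by simp [Dfs.ofState, hS.sp, stackOf]
  have hI := hS.inv
  rw [N.active_true] at hI
  have hsnk : s₂.arr aSnk = N.snk := by rw [← hS.net]; rfl
  set D := (Dfs.ofState s₂).done with hD
  have hDn : ∀ x ∈ D, N.IsNode x := fun x hx => hI.isNode x (.inr hx)
  have hmemR : ∀ {u x}, N.IsRoot true u → N.Reach N.cap u x → x ∈ R := fun hu hr =>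
    mem_of_reach hR.edge hr (hR.src _ (hu rfl))
  have hDR : ∀ x ∈ D, x ∈ R := fun x hx => by
    obtain ⟨u, hu, hr⟩ := hI.reach x (.inr hx)
    exact hmemR hu hr
  refine ⟨D.toFinset, fun u hu => ?_, ?_⟩
  · obtain ⟨h, hh, rfl⟩ := hN.wf.src_node u hu
    have := (hI.vis_iff _).1 (hS.roots h hh fun _ => hu)
    rw [hstk] at this
    simpa only [List.not_mem_nil, Finset.notMem_empty, false_or, or_false, List.mem_toFinset]
      using this
  rcases hset with ⟨h1, h2, h3, h4, h5⟩ | ⟨h1, -⟩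
  · refine Between.of_settle (B := ∅) (f := N.snk) hS.toSearching hvr hvl hf (by simp [hD]) ?_
    have := (Assigned.empty N k n vr vl hL).accept (D := D) (out' := s₃.arr aOut) hL hDn ?_ ?_ h3
      (fun v hv => absurd rfl hv) (fun v _ => h5 v (by rw [hout]))
    · rw [h2, hsnk]
      simpa using this
    · intro x hx w hw
      refine ⟨by simpa using hI.edge_mem hstk (.inl hx) hw, hR.snk _ (hR.edge _ (hDR x hx) _ hw)⟩
    · exact fun x hx => hR.snk x (hDR x hx)
  · exfalso
    rcases h1 with h1 | ⟨x, hx, h1⟩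
    · obtain ⟨h6, -, u, hu, h7⟩ := hI.tgt h1
      exact h6 (hR.snk _ (hmemR hu h7))
    · rcases h1 with h1 | ⟨y, hy, hne, hv⟩
      · exact h1 (by rw [hout])
      · obtain ⟨φ, hφ⟩ := hN.exists_nodeSet_eq hR hRreach
        have hxφ := hDR x hx
        have hyφ := hDR y hy
        rw [← hφ] at hxφ hyφ
        obtain ⟨hx1, hx2, hx3, -⟩ := hL x (hDn x hx)
        obtain ⟨hy1, hy2, hy3, -⟩ := hL y (hDn y hy)
        rw [hx1] at hxφ
        rw [hy1, hv] at hyφ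
        exact hne (hL.inj (hDn y hy) (hDn x hx) hv (eq_of_mem_nodeSet hy3 hx3 hyφ hxφ))

theorem run_secondProg (hN : Represents N I r) (hL : N.Layout k n vr vl) (hS : Scanned true N s)
    (htgt : s.var rTgt = 0) (hvr : s.arr aVar = vr) (hvl : s.arr aVal = vl)
    (hout : s.arr aOut = fun _ => 0) :
    Run secondProg s fun t s' => (∃ S B, (∀ u, N.src u ≠ 0 → u ∈ S) ∧ (∀ x, N.IsNode x → x ∈ B) ∧
      Assigned N k n vr vl (s'.arr aOut) (s'.arr aSnk) B S) ∧
      t ≤ secondCost * (N.size + 1) := by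
  have hA := hN.wf.toIsAdj
  -- the last search of the augmentation shows that the flow is maximum
  obtain ⟨R, hR, hRreach⟩ : ∃ R, N.IsClosed R ∧
      ∀ x ∈ R, ∃ u, N.src u ≠ 0 ∧ N.Reach N.cap u x := by
    have hstk : (Dfs.ofState s).stk = [] := by simp [Dfs.ofState, hS.sp, stackOf]
    have hI : Dfs.Inv N N.cap (fun u => N.src u ≠ 0) ∅ 0 (Dfs.ofState s) := by
      have hroot : N.IsRoot true = fun u => N.src u ≠ 0 := by
        funext u
        simp [Network.IsRoot]
      have := hS.inv
      rwa [N.active_true, hroot] at this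
    refine ⟨_, hI.isClosed hstk htgt fun u hu => ?_, fun x hx => hI.reach x (.inr (by simpa using hx))⟩
    obtain ⟨h, hh, rfl⟩ := hN.wf.src_node u hu
    exact hS.roots h hh fun _ => hu
  refine Run.block_straight rfl fun t₁ ht₁ => ?_
  have hb₁ : t₁ ≤ 2 := ht₁.trans (by decide)
  clear ht₁
  set s₁ := RamProg.run _ s with hs₁
  have hnet₁ : Network.ofState s₁ = N := hS.net
  have hsp₁ : s₁.var rSp = 0 := hS.sp
  have hvis₁ : ∀ x, s₁.arr aVis x ≤ s₁.var rSt := hS.inv.vis_le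
  have hvr₁ : s₁.arr aVar = vr := hvr
  have hvl₁ : s₁.arr aVal = vl := hvl
  have hout₁ : s₁.arr aOut = fun _ => 0 := hout
  have hfin₁ : s₁.var rFin = 0 := rfl
  clear_value s₁
  refine Run.block_cons ((run_scanProg false hA hnet₁ hsp₁ hvis₁).frame.mono ?_)
  rintro t₂ s₂ ⟨⟨hS₂, hbeg₂, -, ht₂⟩, hf₂⟩
  obtain ⟨hvr₂, hvl₂, hout₂, -, -⟩ := frame_scanProg hf₂
  have hP := IsPostorder.of_scanned hA hS₂ (hbeg₂.trans hfin₁)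
  have hlen := hS₂.count
  rw [hbeg₂, hfin₁] at hlen
  refine Run.block_straight rfl fun t₃ ht₃ => ?_
  have hb₃ : t₃ ≤ 2 := ht₃.trans (by decide)
  clear ht₃
  set s₃ := RamProg.run _ s₂ with hs₃
  have hnet₃ : Network.ofState s₃ = N := hS₂.net
  have hsp₃ : s₃.var rSp = 0 := hS₂.sp
  have hvis₃ : ∀ x, s₃.arr aVis x ≤ s₃.var rSt := hS₂.inv.vis_le
  have hfin₃ : s₃.var rFin = s₂.var rFin := rfl
  have harr₃ : s₃.arr = s₂.arr := rfl
  have hL₃ : s₃.var rL = s₂.var rFin := rfl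
  clear_value s₃
  refine Run.block_cons ((run_scanProg true hA hnet₃ hsp₃ hvis₃).frame.mono ?_)
  rintro t₄ s₄ ⟨⟨hS₄, hbeg₄, hord₄, ht₄⟩, hf₄⟩
  obtain ⟨hvr₄, hvl₄, hout₄, hL₄, -⟩ := frame_scanProg hf₄
  rw [harr₃, hvr₂, hvr₁] at hvr₄
  rw [harr₃, hvl₂, hvl₁] at hvl₄
  rw [harr₃, hout₂, hout₁] at hout₄
  have hstk₄ : (Dfs.ofState s₄).stk = [] := by simp [Dfs.ofState, hS₄.sp, stackOf]
  have hI₄ := hS₄.inv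
  have hnode₄ : ∀ x ∈ (Dfs.ofState s₄).done, N.IsNode x := fun x hx => hI₄.isNode x (.inr hx)
  refine Run.block_cons ((run_settleProg (D := (Dfs.ofState s₄).done) rfl hS₄.fin hvr₄ hvl₄
    (by have := hI₄.nodup; rwa [hstk₄, List.nil_append] at this)
    (fun x hx => by have := (hL x (hnode₄ x hx)).2.1; omega) fun x hx => by
      rw [hout₄]; have := (hL x (hnode₄ x hx)).2.1; simp only; omega).frame.mono ?_)
  rintro t₅ s₅ ⟨⟨hset, ht₅⟩, hf₅⟩
  obtain ⟨hv₅, ha₅⟩ := frame_settleProg hf₅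
  obtain ⟨S, hSsrc, hB⟩ := Between.of_first hN hL hR hRreach hS₄ hvr₄ hvl₄ hout₄ hf₅ hset
  have hcount₄ := hS₄.count
  set L := s₂.var rFin with hLdef
  have hfin₅ : L ≤ s₅.var rFin := by
    rw [hv₅ _ (by decide) (by decide) (by decide), ← hfin₃, ← hbeg₄]
    exact hS₄.fin
  have hord₅ : ∀ i < L, s₅.arr aOrd i = s₂.arr aOrd i := fun i hi => by
    rw [ha₅ _ (by decide) (by decide), hord₄ i (by omega), harr₃]
  have hL₅ : s₅.var rL = L := by
    rw [hv₅ _ (by decide) (by decide) (by decide), hL₄, hL₃]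
  have hsize₅ : s₅.var rH = N.size := by
    have := congrArg Network.size hB.net
    exact this
  have hleft₅ := arcsLeft_le s₅
  rw [hsize₅] at hleft₅
  refine Run.block_cons ((Run.while (fun t s' => ∃ B S l, (∀ u, N.src u ≠ 0 → u ∈ S) ∧
      Between N k n vr vl B S s' ∧ (∀ i < L, s'.arr aOrd i = s₂.arr aOrd i) ∧ L ≤ s'.var rFin ∧
      s'.var rL = l ∧ l ≤ L ∧ (∀ x, N.IsNode x → x ∈ B ∨ x ∈ stackOf (s₂.arr aOrd) 0 l) ∧
      t + 240 * arcsLeft s' + 510 * l ≤ 240 * arcsLeft s₅ + 510 * L)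
      (240 * arcsLeft s₅ + 510 * L) ?_ ⟨S, S, L, hSsrc, hB, hord₅, hfin₅, hL₅, le_rfl,
        fun x hx => .inr ((hP.mem_iff x).2 hx), by omega⟩ ?_).mono ?_)
  · rintro t s' ⟨B, S, l, -, -, -, -, -, -, -, h⟩
    omega
  · rintro t s₆ ⟨B, S, l, h1, h2, h3, h4, h5, h6, h7, h8⟩ hcond
    have hl : l ≠ 0 := by rw [← h5]; exact hcond
    obtain ⟨l, rfl⟩ := Nat.exists_eq_succ_of_ne_zero hl
    refine (run_componentProg hA hL hP h6 h2 h3 h4 h5 h7).mono ?_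
    rintro t' s₇ ⟨B', S', g1, g2, g3, g4, g5, g6, g7⟩
    refine ⟨B', S', l, fun u hu => g1 (h1 u hu), g2, g3, g4, g5, by omega, g6, ?_⟩
    simp only [RamExpr.cost, componentCost, Nat.succ_eq_add_one] at g7 h8 ⊢
    omega
  · rintro t s₆ ⟨hcond, t', rfl, B, S, l, h1, h2, h3, h4, h5, h6, h7, h8⟩
    have hl : l = 0 := by rw [← h5]; exact hcond
    subst hl
    refine Run.block_nil ⟨⟨S, B, h1, fun x hx => (h7 x hx).resolve_right (by simp [stackOf]),
      h2.assigned⟩, ?_⟩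
    simp only [RamExpr.cost, scanCost, settleCost, secondCost] at ht₂ ht₄ ht₅ ⊢
    omega

end

/-! ### Building a network -/

namespace Network

/-- The network with an arc of capacity `c` from `u` to `w` and its reverse, of capacity `c'`. -/
def addEdge (N : Network) (u w c c' : ℕ) : Network :=
  let head' := Function.update N.head u (N.size + 1)
  { N with
    size := N.size + 2
    dst := Function.update (Function.update N.dst (N.size + 1) w) (N.size + 2) u
    mate := Function.update (Function.update N.mate (N.size + 1) (N.size + 2)) (N.size + 2)
      (N.size + 1)
    cap := Function.update (Function.update N.cap (N.size + 1) c) (N.size + 2) c'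
    nxt := Function.update (Function.update N.nxt (N.size + 1) (N.head u)) (N.size + 2) (head' w)
    head := Function.update head' w (N.size + 2) }

/-- The network with the capacities from the source and to the sink increased at `u`. -/
def addNode (N : Network) (u a b : ℕ) : Network :=
  { N with
    src := Function.update N.src u (N.src u + a)
    snk := Function.update N.snk u (N.snk u + b) }

variable {N : Network} {u w c c' : ℕ}

theorem isArc_addEdge {h : ℕ} : (N.addEdge u w c c').IsArc h ↔
    N.IsArc h ∨ h = N.size + 1 ∨ h = N.size + 2 := by
  simp only [IsArc, addEdge]
  omega

theorem dst_addEdge {h : ℕ} (hh : N.IsArc h) : (N.addEdge u w c c').dst h = N.dst h := by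
  have := hh.2
  simp only [addEdge]
  rw [Function.update_of_ne (by omega), Function.update_of_ne (by omega)]

theorem mate_addEdge {h : ℕ} (hh : N.IsArc h) : (N.addEdge u w c c').mate h = N.mate h := by
  have := hh.2
  simp only [addEdge]
  rw [Function.update_of_ne (by omega), Function.update_of_ne (by omega)]

theorem nxt_addEdge {h : ℕ} (hh : N.IsArc h) : (N.addEdge u w c c').nxt h = N.nxt h := by
  have := hh.2
  simp only [addEdge]
  rw [Function.update_of_ne (by omega), Function.update_of_ne (by omega)]

theorem frm_addEdge (hN : N.IsAdj) {h : ℕ} (hh : N.IsArc h) :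
    (N.addEdge u w c c').frm h = N.frm h := by
  rw [frm, mate_addEdge hh, dst_addEdge (hN.mate_mem h hh), frm]

theorem dst_addEdge_one : (N.addEdge u w c c').dst (N.size + 1) = w := by simp [addEdge]

theorem dst_addEdge_two : (N.addEdge u w c c').dst (N.size + 2) = u := by simp [addEdge]

theorem frm_addEdge_one : (N.addEdge u w c c').frm (N.size + 1) = u := by simp [addEdge, frm]

theorem frm_addEdge_two : (N.addEdge u w c c').frm (N.size + 2) = w := by simp [addEdge, frm]

theorem head_addEdge (x : ℕ) : (N.addEdge u w c c').head x =
    if x = w then N.size + 2 else if x = u then N.size + 1 else N.head x := by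
  simp only [addEdge, Function.update_apply]

theorem IsAdj.addEdge (hN : N.IsAdj) (hu : u ≠ 0) (hw : w ≠ 0) :
    (N.addEdge u w c c').IsAdj where
  dst_ne h hh := by
    rcases isArc_addEdge.1 hh with hh | rfl | rfl
    · rw [dst_addEdge hh]; exact hN.dst_ne h hh
    · rwa [dst_addEdge_one]
    · rwa [dst_addEdge_two]
  mate_mem h hh := by
    rw [isArc_addEdge]
    rcases isArc_addEdge.1 hh with hh | rfl | rfl
    · rw [mate_addEdge hh]; exact .inl (hN.mate_mem h hh)
    · simp [Network.addEdge]
    · simp [Network.addEdge]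
  mate_mate h hh := by
    rcases isArc_addEdge.1 hh with hh | rfl | rfl
    · rw [mate_addEdge hh, mate_addEdge (hN.mate_mem h hh), hN.mate_mate h hh]
    · simp [Network.addEdge]
    · simp [Network.addEdge]
  mate_ne h hh := by
    rcases isArc_addEdge.1 hh with hh | rfl | rfl
    · rw [mate_addEdge hh]; exact hN.mate_ne h hh
    · simp [Network.addEdge]
    · simp [Network.addEdge]
  head_le x := by
    have := hN.head_le x
    rw [head_addEdge]
    change _ ≤ N.size + 2
    split_ifs <;> omega
  frm_head x := by
    rw [head_addEdge]
    split_ifs with h1 h2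
    · rw [frm_addEdge_two, h1]; exact fun _ => rfl
    · rw [frm_addEdge_one, h2]; exact fun _ => rfl
    · intro h0
      rw [frm_addEdge hN ⟨by omega, hN.head_le x⟩, hN.frm_head x h0]
  le_head h hh := by
    rw [head_addEdge]
    rcases isArc_addEdge.1 hh with hh | rfl | rfl
    · rw [frm_addEdge hN hh]
      have h1 := hN.le_head h hh
      have h2 := hh.2
      split_ifs <;> omega
    · rw [frm_addEdge_one]
      split_ifs <;> omega
    · rw [frm_addEdge_two, if_pos rfl]
  nxt_lt h hh := by
    rcases isArc_addEdge.1 hh with hh | rfl | rfl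
    · rw [nxt_addEdge hh]; exact hN.nxt_lt h hh
    · have := hN.head_le u
      simp [Network.addEdge]
      omega
    · have := hN.head_le w
      simp only [Network.addEdge, Function.update_self, Function.update_apply]
      split_ifs <;> omega
  frm_nxt h hh := by
    rcases isArc_addEdge.1 hh with hh | rfl | rfl
    · rw [nxt_addEdge hh, frm_addEdge hN hh]
      intro h0
      have h1 := hN.nxt_lt h hh
      have h2 := hh.2
      rw [frm_addEdge hN ⟨by omega, by omega⟩, hN.frm_nxt h hh h0]
    · have : (N.addEdge u w c c').nxt (N.size + 1) = N.head u := by simp [Network.addEdge]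
      rw [this, frm_addEdge_one]
      intro h0
      rw [frm_addEdge hN ⟨by omega, hN.head_le u⟩, hN.frm_head u h0]
    · have : (N.addEdge u w c c').nxt (N.size + 2) =
          if w = u then N.size + 1 else N.head w := by
        simp [Network.addEdge, Function.update_apply]
      rw [this, frm_addEdge_two]
      split_ifs with h
      · rw [frm_addEdge_one, h]; exact fun _ => rfl
      · intro h0
        rw [frm_addEdge hN ⟨by omega, hN.head_le w⟩, hN.frm_head w h0]
  le_nxt h h' hh h1 hlt := by
    rcases isArc_addEdge.1 hh with hh | rfl | rfl
    · have h2 := hh.2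
      rw [nxt_addEdge hh, frm_addEdge hN hh, frm_addEdge hN ⟨h1, by omega⟩]
      exact hN.le_nxt h h' hh h1 hlt
    · have : (N.addEdge u w c c').nxt (N.size + 1) = N.head u := by simp [Network.addEdge]
      rw [this, frm_addEdge_one, frm_addEdge hN ⟨h1, by omega⟩]
      rintro rfl
      exact hN.le_head h' ⟨h1, by omega⟩
    · have : (N.addEdge u w c c').nxt (N.size + 2) =
          if w = u then N.size + 1 else N.head w := by
        simp [Network.addEdge, Function.update_apply]
      rw [this, frm_addEdge_two]
      by_cases hs : h' = N.size + 1
      · rw [hs, frm_addEdge_one]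
        rintro rfl
        rw [if_pos rfl]
      · rw [frm_addEdge hN ⟨h1, by omega⟩]
        rintro rfl
        have := hN.le_head h' ⟨h1, by omega⟩
        split_ifs <;> omega

theorem isNode_addEdge (x : ℕ) :
    (N.addEdge u w c c').IsNode x ↔ N.IsNode x ∨ x = u ∨ x = w := by
  constructor
  · rintro ⟨h, hh, rfl⟩
    rcases isArc_addEdge.1 hh with hh | rfl | rfl
    · exact .inl ⟨h, hh, (dst_addEdge hh).symm⟩
    · exact .inr (.inr dst_addEdge_one)
    · exact .inr (.inl dst_addEdge_two)
  · rintro (⟨h, hh, rfl⟩ | rfl | rfl)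
    · exact ⟨h, isArc_addEdge.2 (.inl hh), dst_addEdge hh⟩
    · exact ⟨_, isArc_addEdge.2 (.inr (.inr rfl)), dst_addEdge_two⟩
    · exact ⟨_, isArc_addEdge.2 (.inr (.inl rfl)), dst_addEdge_one⟩

variable {M : ℕ}

theorem Wf.addEdge (hN : N.Wf M) (hu : u ≠ 0) (hw : w ≠ 0) (huM : u < M) (hwM : w < M) :
    (N.addEdge u w c c').Wf M where
  toIsAdj := hN.toIsAdj.addEdge hu hw
  dst_lt h hh := by
    rcases isArc_addEdge.1 hh with hh | rfl | rfl
    · rw [dst_addEdge hh]; exact hN.dst_lt h hh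
    · rwa [dst_addEdge_one]
    · rwa [dst_addEdge_two]
  src_node x hx := (isNode_addEdge x).2 (.inl (hN.src_node x hx))
  snk_node x hx := (isNode_addEdge x).2 (.inl (hN.snk_node x hx))

/-- The capacity that an edge contributes to the cut `S`. -/
def edgeCut (S : Finset ℕ) (u w c c' : ℕ) : ℤ :=
  (if u ∈ S ∧ w ∉ S then (c : ℤ) else 0) + if w ∈ S ∧ u ∉ S then (c' : ℤ) else 0

theorem cut_addEdge (hN : N.Wf M) (S : Finset ℕ) :
    (N.addEdge u w c c').cut M S = N.cut M S + edgeCut S u w c c' := by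
  have hsz : (N.addEdge u w c c').size = N.size + 1 + 1 := rfl
  have hcap1 : (N.addEdge u w c c').cap (N.size + 1) = c := by simp [Network.addEdge]
  have hcap2 : (N.addEdge u w c c').cap (N.size + 2) = c' := by simp [Network.addEdge]
  have h0 : ∀ h ∈ Finset.Icc 1 N.size, (N.addEdge u w c c').arcCut S h = N.arcCut S h := by
    intro h hh
    have hh' : N.IsArc h := Finset.mem_Icc.1 hh
    have hc : (N.addEdge u w c c').cap h = N.cap h := by
      have := hh'.2
      simp only [Network.addEdge]
      rw [Function.update_of_ne (by omega), Function.update_of_ne (by omega)]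
    rw [arcCut, arcCut, frm_addEdge hN.toIsAdj hh', dst_addEdge hh', hc]
  have h3 : ∀ x, (N.addEdge u w c c').nodeCut S x = N.nodeCut S x := fun x => rfl
  rw [cut, cut, hsz, Finset.sum_Icc_succ_top (by omega), Finset.sum_Icc_succ_top (by omega),
    Finset.sum_congr rfl h0, edgeCut, arcCut, arcCut, frm_addEdge_one, dst_addEdge_one,
    frm_addEdge_two, dst_addEdge_two, hcap1, hcap2]
  simp only [h3]
  ring

theorem Wf.addNode (hN : N.Wf M) (hu : N.IsNode u) (a b : ℕ) : (N.addNode u a b).Wf M :=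
  { toIsAdj := hN.toIsAdj.of_eq rfl rfl rfl rfl rfl
    dst_lt := hN.dst_lt
    src_node := fun x hx => by
      by_cases hxu : x = u
      · rw [hxu]; exact hu
      · simp only [Network.addNode, Function.update_of_ne hxu] at hx
        exact hN.src_node x hx
    snk_node := fun x hx => by
      by_cases hxu : x = u
      · rw [hxu]; exact hu
      · simp only [Network.addNode, Function.update_of_ne hxu] at hx
        exact hN.snk_node x hx }

theorem cut_addNode (hu : u < M) (a b : ℕ) (S : Finset ℕ) :
    (N.addNode u a b).cut M S = N.cut M S + if u ∈ S then (b : ℤ) else a := by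
  have hnode : ∀ x, (N.addNode u a b).nodeCut S x =
      N.nodeCut S x + if x = u then (if u ∈ S then (b : ℤ) else a) else 0 := by
    intro x
    by_cases hx : x = u
    · subst hx
      simp only [nodeCut, addNode, Function.update_self, if_true]
      split_ifs <;> push_cast <;> rfl
    · simp [nodeCut, addNode, hx]
  have harc : ∀ h, (N.addNode u a b).arcCut S h = N.arcCut S h := fun h => rfl
  have hsz : (N.addNode u a b).size = N.size := rfl
  rw [cut, cut, hsz]
  simp only [harc, hnode, Finset.sum_add_distrib, Finset.sum_ite_eq', Finset.mem_range, hu, if_true]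
  ring

/-- The empty network. -/
theorem Wf.empty (M : ℕ) {N : Network} (h0 : N.size = 0) (h1 : ∀ x, N.head x = 0)
    (h2 : ∀ x, N.src x = 0) (h3 : ∀ x, N.snk x = 0) : N.Wf M := by
  have : ∀ h, ¬ N.IsArc h := fun h hh => by have := hh.1; have := hh.2; omega
  exact
    { dst_ne := fun h hh => absurd hh (this h)
      mate_mem := fun h hh => absurd hh (this h)
      mate_mate := fun h hh => absurd hh (this h)
      mate_ne := fun h hh => absurd hh (this h)
      head_le := fun x => by rw [h1]; omega
      frm_head := fun x hx => absurd (h1 x) hx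
      le_head := fun h hh => absurd hh (this h)
      nxt_lt := fun h hh => absurd hh (this h)
      frm_nxt := fun h hh => absurd hh (this h)
      le_nxt := fun h _ hh => absurd hh (this h)
      dst_lt := fun h hh => absurd hh (this h)
      src_node := fun x hx => absurd (h2 x) hx
      snk_node := fun x hx => absurd (h3 x) hx }

end Network

/-! ### Reading the input -/

notation "rX" => 18
notation "rXa" => 19
notation "rY" => 20
notation "rYa" => 21
notation "rC" => 22
notation "rCm" => 23

/-- An edge is added from the node of the variable in `rX` and the value in `rXa` to that in `rY` and `rYa`,
with the capacities in `rC` and `rCm`. -/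
def edgeProg : RamProg := .block [
  .assign rU (.add (.get aBase (.var rX)) (.var rXa)),
  .assign rW (.add (.get aBase (.var rY)) (.var rYa)),
  .store aVar (.var rU) (.var rX),
  .store aVal (.var rU) (.var rXa),
  .store aVar (.var rW) (.var rY),
  .store aVal (.var rW) (.var rYa),
  .assign rH (.add (.var rH) (.const 1)),
  .store aDst (.var rH) (.var rW),
  .store aMate (.var rH) (.add (.var rH) (.const 1)),
  .store aCap (.var rH) (.var rC),
  .store aNxt (.var rH) (.get aHead (.var rU)),
  .store aHead (.var rU) (.var rH),
  .assign rH (.add (.var rH) (.const 1)),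
  .store aDst (.var rH) (.var rU),
  .store aMate (.var rH) (.sub (.var rH) (.const 1)),
  .store aCap (.var rH) (.var rCm),
  .store aNxt (.var rH) (.get aHead (.var rW)),
  .store aHead (.var rW) (.var rH)]

/-- The memory holds a network with the nodes of the variables below `n` and the cuts `C`. -/
structure Built (k n : ℕ) (C : Finset ℕ → ℤ) (s : RamState) : Prop where
  wf : (Network.ofState s).Wf (n * (k + 1))
  cut : ∀ S, (Network.ofState s).cut (n * (k + 1)) S = C S
  layout : (Network.ofState s).Layout k n (s.arr aVar) (s.arr aVal)
  base : ∀ v < n, s.arr aBase v = v * (k + 1)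

theorem node_lt {k n v a : ℕ} (hv : v < n) (ha : a ≤ k) : node k v a < n * (k + 1) := by
  have : (v + 1) * (k + 1) ≤ n * (k + 1) := Nat.mul_le_mul_right _ hv
  have h2 : (v + 1) * (k + 1) = v * (k + 1) + (k + 1) := by ring
  unfold node
  omega

section

variable {k n : ℕ} {C : Finset ℕ → ℤ} {s : RamState}

theorem ofState_edgeProg {u w : ℕ} (hu : s.arr aBase (s.var rX) + s.var rXa = u)
    (hw : s.arr aBase (s.var rY) + s.var rYa = w) :
    Network.ofState (edgeProg.run s) =
      (Network.ofState s).addEdge u w (s.var rC) (s.var rCm) := by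
  subst hu hw
  simp [edgeProg, RamProg.block, RamProg.run, RamExpr.eval, Network.ofState, Network.addEdge]

theorem Built.edge (h : Built k n C s) {x a y b : ℕ} (hx : s.var rX = x) (ha : s.var rXa = a)
    (hy : s.var rY = y) (hb : s.var rYa = b) (hxn : x < n) (ha1 : 1 ≤ a) (hak : a ≤ k)
    (hyn : y < n) (hb1 : 1 ≤ b) (hbk : b ≤ k) :
    Built k n (fun S => C S + Network.edgeCut S (node k x a) (node k y b) (s.var rC) (s.var rCm))
      (edgeProg.run s) ∧
    Network.ofState (edgeProg.run s) =
      (Network.ofState s).addEdge (node k x a) (node k y b) (s.var rC) (s.var rCm) ∧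
    (edgeProg.run s).var rU = node k x a := by
  have hu : s.arr aBase (s.var rX) + s.var rXa = node k x a := by
    rw [hx, ha, h.base x hxn, node]
  have hw : s.arr aBase (s.var rY) + s.var rYa = node k y b := by
    rw [hy, hb, h.base y hyn, node]
  have hnet := ofState_edgeProg hu hw
  have hvr : (edgeProg.run s).arr aVar =
      Function.update (Function.update (s.arr aVar) (node k x a) x) (node k y b) y := by
    simp [edgeProg, RamProg.block, RamProg.run, RamExpr.eval, hu, hw]
    simp [hx, hy]
  have hvl : (edgeProg.run s).arr aVal =
      Function.update (Function.update (s.arr aVal) (node k x a) a) (node k y b) b := by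
    simp [edgeProg, RamProg.block, RamProg.run, RamExpr.eval, hu, hw]
    simp [ha, hb]
  have hbase : (edgeProg.run s).arr aBase = s.arr aBase := by
    simp [edgeProg, RamProg.block, RamProg.run]
  have hU : (edgeProg.run s).var rU = node k x a := by
    simp [edgeProg, RamProg.block, RamProg.run, RamExpr.eval, hu]
  have hpos : ∀ v c, 1 ≤ c → node k v c ≠ 0 := fun v c hc => by unfold node; omega
  refine ⟨⟨?_, fun S => ?_, ?_, fun v hv => by rw [hbase]; exact h.base v hv⟩, hnet, hU⟩
  · rw [hnet]
    exact h.wf.addEdge (hpos _ _ ha1) (hpos _ _ hb1) (node_lt hxn hak) (node_lt hyn hbk)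
  · rw [hnet, Network.cut_addEdge h.wf, h.cut]
  · rw [hnet, hvr, hvl]
    intro z hz
    rw [Network.isNode_addEdge] at hz
    by_cases h1 : z = node k y b
    · subst h1
      simp only [Function.update_self]
      exact ⟨trivial, hb1, hbk, hyn⟩
    · rw [Function.update_of_ne h1, Function.update_of_ne h1]
      by_cases h2 : z = node k x a
      · subst h2
        simp only [Function.update_self]
        exact ⟨trivial, ha1, hak, hxn⟩
      · rw [Function.update_of_ne h2, Function.update_of_ne h2]
        exact h.layout z (by tauto)

/-- `body` is run for the values `1, …, k` in `rA`. -/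
def forProg (body : RamProg) : RamProg := .block [
  .assign rA (.const 1),
  .while (.lt (.var rA) (.add (.var rK) (.const 1)))
    (.block [body, .assign rA (.add (.var rA) (.const 1))])]

theorem run_forProg {body : RamProg} (hst : body.straight = true) {c : ℕ} (hc : body.bound ≤ c)
    (hA : rA ∉ body.modVar) (hK : rK ∉ body.modVar) (Inv : ℕ → RamState → Prop)
    (hcongr : ∀ i s x, Inv i s → Inv i ⟨Function.update s.var rA x, s.arr⟩)
    (hstep : ∀ i s, i < k → Inv i s → s.var rA = i + 1 → s.var rK = k → Inv (i + 1) (body.run s))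
    (h0 : Inv 0 s) (hk : s.var rK = k) :
    Run (forProg body) s fun t s' => Inv k s' ∧ t ≤ (c + 20) * (k + 1) := by
  refine Run.block_straight rfl fun t₁ ht₁ => ?_
  have hb₁ : t₁ ≤ 2 := ht₁.trans (by decide)
  clear ht₁
  refine Run.block_cons ((Run.while (fun t s' => ∃ i, Inv i s' ∧ i ≤ k ∧ s'.var rA = i + 1 ∧
      s'.var rK = k ∧ t ≤ (c + 15) * i) ((c + 15) * k) ?_
      ⟨0, hcongr _ _ _ h0, by omega, rfl, hk, by omega⟩ ?_).mono ?_)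
  · rintro t s' ⟨i, -, h1, -, -, h2⟩
    exact h2.trans (Nat.mul_le_mul_left _ h1)
  · rintro t s₂ ⟨i, hi, h1, h2, h3, ht⟩ hcond
    have hik : i < k := by
      rw [Ne, RamExpr.eval_lt_eq_zero] at hcond
      simp only [RamExpr.eval] at hcond
      omega
    refine Run.block_cons ((Run.straight (P := body) hst (Q := fun t' s' => s' = body.run s₂ ∧
      t' ≤ body.bound) fun t' ht' => ⟨rfl, ht'⟩).frame.mono ?_)
    rintro t' s₃ ⟨⟨rfl, ht'⟩, hf⟩
    refine Run.block_straight rfl fun t₄ ht₄ => Run.block_nil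
      ⟨i + 1, hcongr _ _ _ (hstep i s₂ hik hi h2 h3), hik, ?_, ?_, ?_⟩
    · change (body.run s₂).var rA + 1 = _
      rw [hf.var _ hA, h2]
    · change (body.run s₂).var rK = _
      rw [hf.var _ hK, h3]
    · have hb₄ : t₄ ≤ 4 := ht₄.trans (by decide)
      rw [Nat.mul_succ]
      simp only [RamExpr.cost]
      omega
  · rintro t s₂ ⟨hcond, t', rfl, i, hi, h1, h2, h3, ht⟩
    have hik : i = k := by
      rw [RamExpr.eval_lt_eq_zero] at hcond
      simp only [RamExpr.eval] at hcond
      omega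
    subst hik
    refine Run.block_nil ⟨hi, ?_⟩
    have e1 : (c + 20) * (i + 1) = (c + 15) * i + 5 * i + c + 20 := by ring
    simp only [RamExpr.cost]
    omega

/-- For each variable, all nodes or no nodes are present. -/
def Network.IsFull (N : Network) (k : ℕ) : Prop :=
  ∀ v a b, 1 ≤ a → a ≤ k → 1 ≤ b → b ≤ k → N.IsNode (node k v a) → N.IsNode (node k v b)

/-- The nodes of `N` are nodes of `N'`; those of `N'` that are not in `N` belong to variables that satisfy
`T`; and the nodes for the variables and values that satisfy `K` are in `N'`. -/
structure Grown (k : ℕ) (T : ℕ → Prop) (K : ℕ → ℕ → Prop) (N N' : Network) : Prop where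
  mono : ∀ x, N.IsNode x → N'.IsNode x
  cover : ∀ v a, K v a → N'.IsNode (node k v a)
  only : ∀ x, N'.IsNode x → N.IsNode x ∨ ∃ v a, T v ∧ a ≤ k ∧ x = node k v a

theorem Grown.isFull {T : ℕ → Prop} {K : ℕ → ℕ → Prop} {N N' : Network} (h : Grown k T K N N')
    (hK : ∀ v a, T v → 1 ≤ a → a ≤ k → K v a) (hN : N.IsFull k) : N'.IsFull k := by
  intro v a b ha1 ha hb1 hb hv
  rcases h.only _ hv with h1 | ⟨w, c, hw, hc, heq⟩
  · exact h.mono _ (hN v a b ha1 ha hb1 hb h1)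
  · obtain ⟨rfl, -⟩ := node_inj ha hc heq
    exact h.cover v b (hK v b hw hb1 hb)

theorem Grown.addEdge {T : ℕ → Prop} {K K' : ℕ → ℕ → Prop} {N N' : Network}
    {x a y b c c' : ℕ} (h : Grown k T K N N') (hx : T x) (ha : a ≤ k) (hy : T y) (hb : b ≤ k)
    (hK : ∀ v e, K' v e → K v e ∨ v = x ∧ e = a ∨ v = y ∧ e = b) :
    Grown k T K' N (N'.addEdge (node k x a) (node k y b) c c') where
  mono z hz := (Network.isNode_addEdge z).2 (.inl (h.mono z hz))
  cover v e hv := by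
    rw [Network.isNode_addEdge]
    rcases hK v e hv with h1 | ⟨rfl, rfl⟩ | ⟨rfl, rfl⟩
    · exact .inl (h.cover v e h1)
    · exact .inr (.inl rfl)
    · exact .inr (.inr rfl)
  only z hz := by
    rcases (Network.isNode_addEdge z).1 hz with h1 | rfl | rfl
    · exact h.only z h1
    · exact .inr ⟨x, a, hx, ha, rfl⟩
    · exact .inr ⟨y, b, hy, hb, rfl⟩

/-- In the course of adding the nodes and edges of a basic function: those for the values up to `i` have been
added; the value `j + 1` contributes `f S j` to the cut `S`. -/
structure Filling (k n : ℕ) (C : Finset ℕ → ℤ) (f : Finset ℕ → ℕ → ℤ) (T : ℕ → Prop)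
    (K : ℕ → ℕ → ℕ → Prop) (s₀ : RamState) (i : ℕ) (s : RamState) : Prop where
  built : Built k n (fun S => C S + ∑ j ∈ Finset.range i, f S j) s
  grown : Grown k T (K i) (Network.ofState s₀) (Network.ofState s)
  size : s.var rH ≤ s₀.var rH + 4 * i
  input : s.arr aIn = s₀.arr aIn
  pos : s.var rP = s₀.var rP

theorem Filling.congr {f : Finset ℕ → ℕ → ℤ} {T : ℕ → Prop} {K : ℕ → ℕ → ℕ → Prop} {s₀ : RamState}
    (i : ℕ) (s : RamState)
    (x : ℕ) (h : Filling k n C f T K s₀ i s) :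
    Filling k n C f T K s₀ i ⟨Function.update s.var rA x, s.arr⟩ :=
  ⟨⟨h.built.wf, h.built.cut, h.built.layout, h.built.base⟩, h.grown, h.size, h.input, h.pos⟩

theorem Filling.zero {f : Finset ℕ → ℕ → ℤ} {T : ℕ → Prop} {K : ℕ → ℕ → ℕ → Prop}
    {s₀ : RamState} (hK : ∀ v a, ¬ K 0 v a) (h : Built k n C s₀) : Filling k n C f T K s₀ 0 s₀ where
  built := ⟨h.wf, fun S => by simpa using h.cut S, h.layout, h.base⟩
  grown := ⟨fun _ h => h, fun v a h => absurd h (hK v a), fun _ h => .inl h⟩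
  size := by omega
  input := rfl
  pos := rfl

theorem frame_edgeProg (s : RamState) :
    (∀ x, x ≠ rU → x ≠ rW → x ≠ rH → (edgeProg.run s).var x = s.var x) ∧
      (edgeProg.run s).arr aIn = s.arr aIn ∧ (edgeProg.run s).var rH = s.var rH + 2 ∧
      (edgeProg.run s).arr aSrc = s.arr aSrc ∧ (edgeProg.run s).arr aSnk = s.arr aSnk := by
  obtain ⟨t, -, h⟩ := edgeProg.exists_exec_of_straight rfl s
  have hf := RamProg.frame_of_exec h
  refine ⟨fun x h1 h2 h3 => hf.var x ?_, hf.arr _ ?_, ?_, hf.arr _ ?_, hf.arr _ ?_⟩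
  case refine_3 => simp [edgeProg, RamProg.block, RamProg.run, RamExpr.eval]
  all_goals simp [edgeProg, RamProg.modVar, RamProg.modArr, RamProg.block, *]

/-- The edge of `x = π(y)` for the value of `y` in `rA`. -/
def permBody : RamProg := .block [
  .block [
    .assign rX (.get aIn (.add (.var rP) (.const 1))),
    .assign rXa (.get aIn (.add (.add (.var rP) (.const 2)) (.var rA))),
    .assign rY (.get aIn (.add (.var rP) (.const 2))),
    .assign rYa (.var rA),
    .assign rC (.const 1),
    .assign rCm (.const 1)],
  edgeProg]

theorem Filling.perm {s₀ : RamState} {x y : Fin n} {π : Equiv.Perm (Fin k)} {f : Finset ℕ → ℕ → ℤ}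
    {T : ℕ → Prop} {K : ℕ → ℕ → ℕ → Prop}
    (hx : s₀.arr aIn (s₀.var rP + 1) = x) (hy : s₀.arr aIn (s₀.var rP + 2) = y)
    (hπ : ∀ j : Fin k, s₀.arr aIn (s₀.var rP + 2 + (j + 1)) = (π j).succ)
    (hf : ∀ S (j : Fin k), f S j =
      Network.edgeCut S (node k x (π j).succ) (node k y j.succ) 1 1)
    (hTx : T x) (hTy : T y)
    (hK : ∀ (j : Fin k) v e, K (j + 1) v e → K j v e ∨ v = x ∧ e = ((π j).succ : Fin (k + 1)) ∨
      v = y ∧ e = (j.succ : Fin (k + 1)))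
    {j : Fin k} (h : Filling k n C f T K s₀ j s) (hA : s.var rA = j + 1) :
    Filling k n C f T K s₀ (j + 1) (permBody.run s) := by
  change Filling k n C f T K s₀ (j + 1) (RamProg.run .skip (edgeProg.run (RamProg.run _ s)))
  change Filling k n C f T K s₀ (j + 1) (edgeProg.run (RamProg.run _ s))
  set s₁ := RamProg.run _ s with hs₁
  have harr : s₁.arr = s.arr := rfl
  have hvar : s₁.var rP = s.var rP := rfl
  have hvarH : s₁.var rH = s.var rH := rfl
  have hX : s₁.var rX = x := by
    rw [← hx, ← h.input, ← h.pos]; rfl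
  have hXa : s₁.var rXa = ((π j).succ : Fin (k + 1)) := by
    rw [← hπ, ← h.input, ← h.pos, ← hA]; rfl
  have hY : s₁.var rY = y := by
    rw [← hy, ← h.input, ← h.pos]; rfl
  have hYa : s₁.var rYa = (j.succ : Fin (k + 1)) := hA
  have hC : s₁.var rC = 1 := rfl
  have hCm : s₁.var rCm = 1 := rfl
  have hB₁ : Built k n (fun S => C S + ∑ i ∈ Finset.range j, f S i) s₁ :=
    ⟨h.built.wf, h.built.cut, h.built.layout, h.built.base⟩
  have hnet : Network.ofState s₁ = Network.ofState s := rfl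
  clear_value s₁
  have hs : ∀ i : Fin k, 1 ≤ (i.succ : ℕ) ∧ (i.succ : ℕ) ≤ k := fun i =>
    ⟨by simp, by have := i.2; simp⟩
  obtain ⟨hB, hnet', -⟩ := hB₁.edge hX hXa hY hYa x.2 (hs _).1 (hs _).2 y.2 (hs _).1 (hs _).2
  obtain ⟨hv, hin, hH, -⟩ := frame_edgeProg s₁
  rw [hC, hCm] at hB hnet'
  refine ⟨⟨hB.wf, fun S => ?_, hB.layout, hB.base⟩, ?_, ?_, ?_, ?_⟩
  · rw [hB.cut, Finset.sum_range_succ, hf, add_assoc]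
  · rw [hnet', hnet]
    exact h.grown.addEdge hTx (hs _).2 hTy (hs _).2 (hK j)
  · have := h.size
    omega
  · rw [hin, harr, h.input]
  · rw [hv _ (by decide) (by decide) (by decide), hvar, h.pos]

/-- The two edges of `x = d ∨ y = d'` for the value in `rA`. -/
def orBody : RamProg := .block [
  .block [
    .assign rX (.get aIn (.add (.var rP) (.const 1))),
    .assign rXa (.var rA),
    .assign rY (.get aIn (.add (.var rP) (.const 3))),
    .assign rYa (.get aIn (.add (.var rP) (.const 4))),
    .assign rC (.sub (.const 1) (.eq (.var rA) (.get aIn (.add (.var rP) (.const 2))))),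
    .assign rCm (.const 0)],
  edgeProg,
  .block [
    .assign rX (.get aIn (.add (.var rP) (.const 3))),
    .assign rXa (.var rA),
    .assign rY (.get aIn (.add (.var rP) (.const 1))),
    .assign rYa (.get aIn (.add (.var rP) (.const 2))),
    .assign rC (.sub (.const 1) (.eq (.var rA) (.get aIn (.add (.var rP) (.const 4))))),
    .assign rCm (.const 0)],
  edgeProg]

theorem Filling.or {s₀ : RamState} {x y : Fin n} {d d' : Fin k} {f : Finset ℕ → ℕ → ℤ}
    {T : ℕ → Prop} {K : ℕ → ℕ → ℕ → Prop}
    (hx : s₀.arr aIn (s₀.var rP + 1) = x) (hd : s₀.arr aIn (s₀.var rP + 2) = d.succ)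
    (hy : s₀.arr aIn (s₀.var rP + 3) = y) (hd' : s₀.arr aIn (s₀.var rP + 4) = d'.succ)
    (hf : ∀ S (j : Fin k), f S j =
      Network.edgeCut S (node k x j.succ) (node k y d'.succ) (if j = d then 0 else 1) 0 +
      Network.edgeCut S (node k y j.succ) (node k x d.succ) (if j = d' then 0 else 1) 0)
    (hTx : T x) (hTy : T y)
    (hK : ∀ (j : Fin k) v e, K (j + 1) v e → K j v e ∨ v = x ∧ e = (j.succ : Fin (k + 1)) ∨
      v = y ∧ e = (j.succ : Fin (k + 1)))
    {j : Fin k} (h : Filling k n C f T K s₀ j s) (hA : s.var rA = j + 1) :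
    Filling k n C f T K s₀ (j + 1) (orBody.run s) := by
  change Filling k n C f T K s₀ (j + 1)
    (edgeProg.run (RamProg.run _ (edgeProg.run (RamProg.run _ s))))
  have hs : ∀ i : Fin k, 1 ≤ (i.succ : ℕ) ∧ (i.succ : ℕ) ≤ k := fun i =>
    ⟨by simp, by have := i.2; simp⟩
  have hC : ∀ i : Fin k, 1 - (if (j : ℕ) + 1 = (i.succ : Fin (k + 1)) then 1 else 0) =
      if j = i then 0 else 1 := by
    intro i
    by_cases h : j = i
    · simp [h]
    · simp [h, Fin.ext_iff.not.1 h]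
  set s₁ := RamProg.run _ s with hs₁
  have harr₁ : s₁.arr = s.arr := rfl
  have hP₁ : s₁.var rP = s.var rP := rfl
  have hA₁ : s₁.var rA = s.var rA := rfl
  have hH₁ : s₁.var rH = s.var rH := rfl
  have hX₁ : s₁.var rX = x := by
    rw [← hx, ← h.input, ← h.pos]; rfl
  have hXa₁ : s₁.var rXa = (j.succ : Fin (k + 1)) := hA
  have hY₁ : s₁.var rY = y := by
    rw [← hy, ← h.input, ← h.pos]; rfl
  have hYa₁ : s₁.var rYa = (d'.succ : Fin (k + 1)) := by
    rw [← hd', ← h.input, ← h.pos]; rfl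
  have hC₁ : s₁.var rC = if j = d then 0 else 1 := by
    rw [← hC, ← hd, ← hA, ← h.input, ← h.pos]; rfl
  have hCm₁ : s₁.var rCm = 0 := rfl
  have hB₁ : Built k n (fun S => C S + ∑ i ∈ Finset.range j, f S i) s₁ :=
    ⟨h.built.wf, h.built.cut, h.built.layout, h.built.base⟩
  have hnet₁ : Network.ofState s₁ = Network.ofState s := rfl
  clear_value s₁
  obtain ⟨hB₂, hnet₂, -⟩ := hB₁.edge hX₁ hXa₁ hY₁ hYa₁ x.2 (hs _).1 (hs _).2 y.2 (hs _).1 (hs _).2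
  obtain ⟨hv₂, hin₂, hH₂, -⟩ := frame_edgeProg s₁
  rw [hC₁, hCm₁] at hB₂ hnet₂
  set s₂ := edgeProg.run s₁ with hs₂
  have hP₂ : s₂.var rP = s₀.var rP := by
    rw [hv₂ _ (by decide) (by decide) (by decide), hP₁, h.pos]
  have hA₂ : s₂.var rA = j + 1 := by
    rw [hv₂ _ (by decide) (by decide) (by decide), hA₁, hA]
  rw [harr₁, h.input] at hin₂
  clear_value s₂
  set s₃ := RamProg.run _ s₂ with hs₃
  have harr₃ : s₃.arr = s₂.arr := rfl
  have hP₃ : s₃.var rP = s₂.var rP := rfl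
  have hH₃ : s₃.var rH = s₂.var rH := rfl
  have hX₃ : s₃.var rX = y := by
    rw [← hy, ← hin₂, ← hP₂]; rfl
  have hXa₃ : s₃.var rXa = (j.succ : Fin (k + 1)) := hA₂
  have hY₃ : s₃.var rY = x := by
    rw [← hx, ← hin₂, ← hP₂]; rfl
  have hYa₃ : s₃.var rYa = (d.succ : Fin (k + 1)) := by
    rw [← hd, ← hin₂, ← hP₂]; rfl
  have hC₃ : s₃.var rC = if j = d' then 0 else 1 := by
    rw [← hC, ← hd', ← hA₂, ← hin₂, ← hP₂]; rfl
  have hCm₃ : s₃.var rCm = 0 := rfl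
  have hB₃ : Built k n (fun S => C S + ∑ i ∈ Finset.range j, f S i +
      Network.edgeCut S (node k x j.succ) (node k y d'.succ) (if j = d then 0 else 1) 0) s₃ :=
    ⟨hB₂.wf, hB₂.cut, hB₂.layout, hB₂.base⟩
  have hnet₃ : Network.ofState s₃ = Network.ofState s₂ := rfl
  clear_value s₃
  obtain ⟨hB, hnet', -⟩ := hB₃.edge hX₃ hXa₃ hY₃ hYa₃ y.2 (hs _).1 (hs _).2 x.2 (hs _).1 (hs _).2
  obtain ⟨hv, hin, hH, -⟩ := frame_edgeProg s₃
  rw [hC₃, hCm₃] at hB hnet'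
  change Filling k n C f T K s₀ (j + 1) (edgeProg.run s₃)
  refine ⟨⟨hB.wf, fun S => ?_, hB.layout, hB.base⟩, ?_, ?_, ?_, ?_⟩
  · rw [hB.cut, Finset.sum_range_succ, hf]
    ring
  · rw [hnet', hnet₃, hnet₂, hnet₁]
    refine (h.grown.addEdge (K' := fun v e => K j v e ∨ v = x ∧ e = (j.succ : Fin (k + 1)))
      hTx (hs _).2 hTy (hs _).2 fun v e h => by tauto).addEdge
      hTy (hs _).2 hTx (hs _).2 fun v e h => ?_
    have := hK j v e h
    tauto
  · have := h.size
    omega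
  · rw [hin, harr₃, hin₂]
  · rw [hv _ (by decide) (by decide) (by decide), hP₃, hP₂]

/-- The node for the value in `rA`, with its share of a unary function. The loop of capacity `0` makes it an end
of an arc, so that the searches from all ends of arcs find it. -/
def unaryBody : RamProg := .block [
  .block [
    .assign rX (.get aIn (.add (.var rP) (.const 1))),
    .assign rXa (.var rA),
    .assign rY (.get aIn (.add (.var rP) (.const 1))),
    .assign rYa (.var rA),
    .assign rC (.const 0),
    .assign rCm (.const 0)],
  edgeProg,
  .store aSrc (.var rU) (.add (.get aSrc (.var rU))
    (.sub (.get aIn (.add (.var rP) (.const 2)))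
      (.get aIn (.add (.add (.var rP) (.const 2)) (.var rA))))),
  .store aSnk (.var rU) (.add (.get aSnk (.var rU))
    (.sub (.get aIn (.add (.add (.var rP) (.const 2)) (.var rA)))
      (.get aIn (.add (.var rP) (.const 2)))))]

theorem Filling.unary {s₀ : RamState} {x : Fin n} {g : Fin (k + 1) → ℕ} {f : Finset ℕ → ℕ → ℤ}
    {T : ℕ → Prop} {K : ℕ → ℕ → ℕ → Prop}
    (hx : s₀.arr aIn (s₀.var rP + 1) = x)
    (hg : ∀ a : Fin (k + 1), s₀.arr aIn (s₀.var rP + 2 + a) = g a)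
    (hf : ∀ S (j : Fin k), f S j =
      ((if node k x j.succ ∈ S then g j.succ - g 0 else g 0 - g j.succ : ℕ) : ℤ))
    (hTx : T x)
    (hK : ∀ (j : Fin k) v e, K (j + 1) v e → K j v e ∨ v = x ∧ e = (j.succ : Fin (k + 1)))
    {j : Fin k} (h : Filling k n C f T K s₀ j s) (hA : s.var rA = j + 1) :
    Filling k n C f T K s₀ (j + 1) (unaryBody.run s) := by
  change Filling k n C f T K s₀ (j + 1) (RamProg.run _ (edgeProg.run (RamProg.run _ s)))
  have hs : ∀ i : Fin k, 1 ≤ (i.succ : ℕ) ∧ (i.succ : ℕ) ≤ k := fun i =>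
    ⟨by simp, by have := i.2; simp⟩
  set s₁ := RamProg.run _ s with hs₁
  have harr₁ : s₁.arr = s.arr := rfl
  have hP₁ : s₁.var rP = s.var rP := rfl
  have hA₁ : s₁.var rA = s.var rA := rfl
  have hH₁ : s₁.var rH = s.var rH := rfl
  have hX₁ : s₁.var rX = x := by
    rw [← hx, ← h.input, ← h.pos]; rfl
  have hXa₁ : s₁.var rXa = (j.succ : Fin (k + 1)) := hA
  have hY₁ : s₁.var rY = x := by
    rw [← hx, ← h.input, ← h.pos]; rfl
  have hYa₁ : s₁.var rYa = (j.succ : Fin (k + 1)) := hA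
  have hC₁ : s₁.var rC = 0 := rfl
  have hCm₁ : s₁.var rCm = 0 := rfl
  have hB₁ : Built k n (fun S => C S + ∑ i ∈ Finset.range j, f S i) s₁ :=
    ⟨h.built.wf, h.built.cut, h.built.layout, h.built.base⟩
  have hnet₁ : Network.ofState s₁ = Network.ofState s := rfl
  clear_value s₁
  obtain ⟨hB₂, hnet₂, hU₂⟩ :=
    hB₁.edge hX₁ hXa₁ hY₁ hYa₁ x.2 (hs _).1 (hs _).2 x.2 (hs _).1 (hs _).2
  obtain ⟨hv₂, hin₂, hH₂, -⟩ := frame_edgeProg s₁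
  rw [hC₁, hCm₁] at hB₂ hnet₂
  set s₂ := edgeProg.run s₁ with hs₂
  have hP₂ : s₂.var rP = s₀.var rP := by
    rw [hv₂ _ (by decide) (by decide) (by decide), hP₁, h.pos]
  have hA₂ : s₂.var rA = j + 1 := by
    rw [hv₂ _ (by decide) (by decide) (by decide), hA₁, hA]
  rw [harr₁, h.input] at hin₂
  clear_value s₂
  set u := node k x j.succ with hu
  have hnode₂ : (Network.ofState s₂).IsNode u := by
    rw [hnet₂, Network.isNode_addEdge]; exact .inr (.inl rfl)
  have e0 : s₂.arr aIn (s₂.var rP + 2) = g 0 := by rw [hP₂, hin₂, ← hg 0]; rfl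
  have e1 : s₂.arr aIn (s₂.var rP + 2 + s₂.var rA) = g j.succ := by
    rw [hP₂, hin₂, hA₂, ← hg j.succ]; rfl
  set s₃ := RamProg.run _ s₂ with hs₃
  have hnet₃ : Network.ofState s₃ = (Network.ofState s₂).addNode u (g 0 - g j.succ)
      (g j.succ - g 0) := by
    rw [← hU₂, ← e0, ← e1]
    simp [hs₃, RamProg.run, RamExpr.eval, RamProg.block, Network.ofState, Network.addNode]
  have hv₃ : s₃.var = s₂.var := rfl
  have ha₃ : ∀ a, a ≠ aSrc → a ≠ aSnk → s₃.arr a = s₂.arr a := fun a h1 h2 => by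
    simp [hs₃, RamProg.run, RamProg.block, h1, h2]
  clear_value s₃
  refine ⟨⟨?_, fun S => ?_, ?_, ?_⟩, ?_, ?_, ?_, ?_⟩
  · rw [hnet₃]; exact hB₂.wf.addNode hnode₂ _ _
  · have h0 : Network.edgeCut S u u 0 0 = 0 := by simp [Network.edgeCut]
    rw [hnet₃, Network.cut_addNode (node_lt x.2 (hs _).2), hB₂.cut, h0, Finset.sum_range_succ, hf]
    split_ifs <;> ring
  · rw [hnet₃, ha₃ _ (by decide) (by decide), ha₃ _ (by decide) (by decide)]
    exact hB₂.layout
  · rw [ha₃ _ (by decide) (by decide)]; exact hB₂.base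
  · have hG : Grown k T (K (j + 1)) (Network.ofState s₀) (Network.ofState s₂) := by
      rw [hnet₂, hnet₁]
      exact h.grown.addEdge hTx (hs _).2 hTx (hs _).2 fun v e h => by
        have := hK j v e h
        tauto
    rw [hnet₃]
    exact ⟨hG.mono, hG.cover, hG.only⟩
  · have := h.size
    rw [hv₃]
    omega
  · rw [ha₃ _ (by decide) (by decide), hin₂]
  · rw [hv₃, hP₂]

end

section

variable {k n : ℕ} {C C' : Finset ℕ → ℤ} {s s₀ : RamState}

theorem Built.congr (h : Built k n C s) (hC : ∀ S, C S = C' S) : Built k n C' s :=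
  ⟨h.wf, fun S => (h.cut S).trans (hC S), h.layout, h.base⟩

/-- The edges of a basic function are added by `body`, and the input position is moved on. -/
def addProg (body : RamProg) (len : RamExpr) : RamProg := .block [
  forProg body, .assign rP (.add (.var rP) len)]

/-- One summand is read. -/
def summandProg : RamProg :=
  .ite (.eq (.get aIn (.var rP)) (.const 0))
    (addProg unaryBody (.add (.var rK) (.const 3)))
    (.ite (.eq (.get aIn (.var rP)) (.const 1))
      (addProg permBody (.add (.var rK) (.const 3)))
      (addProg orBody (.const 5)))

/-- The cost of reading a summand, per value. -/
def summandCost : ℕ := 400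

/-- The network of a basic function `g` has been added, by a program started in `s₀`. -/
structure Added (g : BasicFn k n) (C : Finset ℕ → ℤ) (s₀ s : RamState) : Prop where
  built : Built k n (fun S => C S + g.cutVal S) s
  full : (Network.ofState s).IsFull k
  size : s.var rH ≤ s₀.var rH + 4 * k
  input : s.arr aIn = s₀.arr aIn
  pos : s.var rP = s₀.var rP + g.encode.length

theorem run_addProg {g : BasicFn k n} {body : RamProg} {len : RamExpr} {f : Finset ℕ → ℕ → ℤ}
    {T : ℕ → Prop} {K : ℕ → ℕ → ℕ → Prop}
    (hst : body.straight = true) (hc : body.bound ≤ 300) (hA : rA ∉ body.modVar)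
    (hK : rK ∉ body.modVar) (hlen : ∀ s, s.var rK = k → len.eval s = g.encode.length)
    (hcost : len.cost ≤ 3)
    (hK0 : ∀ v a, ¬ K 0 v a) (hKT : ∀ v a, T v → 1 ≤ a → a ≤ k → K k v a)
    (hf : ∀ S, ∑ j : Fin k, f S j = g.cutVal S)
    (hstep : ∀ (j : Fin k) s, Filling k n C f T K s₀ j s → s.var rA = j + 1 →
      Filling k n C f T K s₀ (j + 1) (body.run s))
    (hs : Built k n C s₀) (hfull : (Network.ofState s₀).IsFull k) (hk : s₀.var rK = k) :
    Run (addProg body len) s₀ fun t s' => Added g C s₀ s' ∧ t ≤ 350 * (k + 1) := by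
  refine Run.block_cons ((run_forProg hst hc hA hK (Filling k n C f T K s₀) Filling.congr
    (fun i s hi h hA _ => hstep ⟨i, hi⟩ s h hA) (Filling.zero hK0 hs) hk).frame.mono ?_)
  rintro t s₁ ⟨⟨h, ht⟩, hfr⟩
  have hk₁ : s₁.var rK = k := by
    rw [hfr.var _ (by simp [forProg, RamProg.block, RamProg.modVar, hK]), hk]
  refine Run.block_straight rfl fun t₁ ht₁ => Run.block_nil ?_
  have hb₁ : t₁ ≤ 6 := ht₁.trans (by simp only [RamProg.bound, RamExpr.cost]; omega)
  refine ⟨⟨?_, h.grown.isFull hKT hfull, h.size, h.input, ?_⟩, by omega⟩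
  · refine Built.congr (s := RamProg.run _ s₁)
      ⟨h.built.wf, h.built.cut, h.built.layout, h.built.base⟩ fun S => ?_
    rw [← hf S, Finset.sum_range]
  · change s₁.var rP + len.eval s₁ = _
    rw [hlen _ hk₁, h.pos]

theorem run_summandProg (g : BasicFn k n)
    (hin : ∀ j, j < g.encode.length → s₀.arr aIn (s₀.var rP + j) = g.encode.getD j 0)
    (hs : Built k n C s₀) (hfull : (Network.ofState s₀).IsFull k) (hk : s₀.var rK = k) :
    Run summandProg s₀ fun t s' => Added g C s₀ s' ∧ t ≤ summandCost * (k + 1) := by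
  cases g with
  | unary v h hsub =>
    have h0 : s₀.arr aIn (s₀.var rP) = 0 := hin 0 (by simp [BasicFn.encode])
    have hg : ∀ a : Fin (k + 1), s₀.arr aIn (s₀.var rP + 2 + a) = h a := fun a => by
      rw [add_assoc, hin _ (by simp [BasicFn.encode]; omega)]
      simp [BasicFn.encode, List.getD_eq_getElem?_getD, -List.ofFn_succ, add_comm 2,
        show (a : ℕ) ≤ k by omega]
    refine Run.iteTrue (by simp [RamExpr.eval, h0]) ((run_addProg (g := .unary v h hsub) (s₀ := s₀)
      (C := C)
      (f := fun S j => ((if node k v (j + 1) ∈ S then s₀.arr aIn (s₀.var rP + 2 + (j + 1)) - h 0 else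
        h 0 - s₀.arr aIn (s₀.var rP + 2 + (j + 1)) : ℕ) : ℤ))
      (T := fun w => w = v) (K := fun i w a => w = v ∧ 1 ≤ a ∧ a ≤ i)
      (by rfl) (by decide) (by decide) (by decide) ?_ (by decide) (by omega) (by omega) ?_ ?_
      hs hfull hk).mono ?_)
    · intro s hs
      simp [RamExpr.eval, hs, BasicFn.encode]
    · intro S
      simp only [BasicFn.cutVal, unarySum]
      refine Finset.sum_congr rfl fun j _ => ?_
      rw [show (j : ℕ) + 1 = (j.succ : Fin (k + 1)) by simp, hg]
    · intro j s hF hA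
      refine Filling.unary (x := v) (g := h) (T := fun w => w = v)
        (hin 1 (by simp [BasicFn.encode])) hg (fun S j => ?_) rfl (fun j w e hw => ?_)
        hF hA
      · rw [show (j : ℕ) + 1 = (j.succ : Fin (k + 1)) by simp, hg]
      · simp only [Fin.val_succ]
        omega
    · rintro t s' ⟨h1, h2⟩
      refine ⟨h1, ?_⟩
      simp only [RamExpr.cost, summandCost]
      omega
  | perm x y π =>
    have h0 : s₀.arr aIn (s₀.var rP) = 1 := hin 0 (by simp [BasicFn.encode])
    have hg : ∀ j : Fin k, s₀.arr aIn (s₀.var rP + 2 + (j + 1)) =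
        ((π j).succ : Fin (k + 1)) := fun j => by
      rw [add_assoc, hin _ (by simp [BasicFn.encode]; omega)]
      simp [BasicFn.encode, List.getD_eq_getElem?_getD,
        show 2 + ((j : ℕ) + 1) = j + 3 by omega]
    refine Run.iteFalse (by simp [RamExpr.eval, h0]) (Run.iteTrue (by simp [RamExpr.eval, h0])
      ((run_addProg (g := .perm x y π) (s₀ := s₀) (C := C)
      (f := fun S j => Network.edgeCut S (node k x (s₀.arr aIn (s₀.var rP + 2 + (j + 1))))
        (node k y (j + 1)) 1 1)
      (T := fun w => w = x ∨ w = y)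
      -- the values of the first variable come in the order given by `π`
      (K := fun i w a => (w = x ∧ ∃ j : Fin k, j < i ∧ a = ((π j).succ : Fin (k + 1))) ∨
        (w = y ∧ 1 ≤ a ∧ a ≤ i))
      (by rfl) (by decide) (by decide) (by decide) ?_ (by decide) (by simp; omega) ?_ ?_ ?_
      hs hfull hk).mono ?_))
    · intro s hs
      simp [RamExpr.eval, hs, BasicFn.encode]
    · rintro w a (rfl | rfl) h1 h2
      · left
        refine ⟨rfl, π.symm ⟨a - 1, by omega⟩, by simp, ?_⟩
        simp
        omega
      · exact .inr ⟨rfl, h1, h2⟩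
    · intro S
      simp only [BasicFn.cutVal, permSum]
      refine Finset.sum_congr rfl fun j _ => ?_
      rw [hg]
      simp [Network.edgeCut]
    · intro j s hF hA
      refine Filling.perm (x := x) (y := y) (π := π) (hin 1 (by simp [BasicFn.encode]))
        (hin 2 (by simp [BasicFn.encode])) hg (fun S j => ?_) (.inl rfl) (.inr rfl)
        (fun j w e hw => ?_) hF hA
      · simp only [hg, Fin.val_succ]
      · rcases hw with ⟨h1, i, hi, he⟩ | ⟨h1, h2, h3⟩
        · by_cases hij : i = j
          · subst hij
            exact .inr (.inl ⟨h1, he⟩)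
          · refine .inl (.inl ⟨h1, i, ?_, he⟩)
            have := Fin.val_ne_of_ne hij
            omega
        · simp only [Fin.val_succ]
          by_cases he : e = j + 1
          · exact .inr (.inr ⟨h1, he⟩)
          · exact .inl (.inr ⟨h1, h2, by omega⟩)
    · rintro t s' ⟨h1, h2⟩
      refine ⟨h1, ?_⟩
      simp only [RamExpr.cost, summandCost]
      omega
  | or x d y d' =>
    have h0 : s₀.arr aIn (s₀.var rP) = 2 := hin 0 (by simp [BasicFn.encode])
    refine Run.iteFalse (by simp [RamExpr.eval, h0]) (Run.iteFalse (by simp [RamExpr.eval, h0])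
      ((run_addProg (g := .or x d y d') (s₀ := s₀) (C := C)
      (f := fun S j =>
        Network.edgeCut S (node k x (j + 1)) (node k y d'.succ) (if j = d then 0 else 1) 0 +
        Network.edgeCut S (node k y (j + 1)) (node k x d.succ) (if j = d' then 0 else 1) 0)
      (T := fun w => w = x ∨ w = y)
      (K := fun i w a => (w = x ∨ w = y) ∧ 1 ≤ a ∧ a ≤ i)
      (by rfl) (by decide) (by decide) (by decide) ?_ (by decide) (by omega) ?_ ?_ ?_
      hs hfull hk).mono ?_))
    · intro s hs
      simp [RamExpr.eval, BasicFn.encode]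
    · exact fun w a hw h1 h2 => ⟨hw, h1, h2⟩
    · intro S
      simp only [BasicFn.cutVal, orSum]
      refine Finset.sum_congr rfl fun j _ => ?_
      simp [Network.edgeCut, Fin.ext_iff]
    · intro j s hF hA
      refine Filling.or (x := x) (y := y) (d := d) (d' := d') (hin 1 (by simp [BasicFn.encode]))
        (hin 2 (by simp [BasicFn.encode])) (hin 3 (by simp [BasicFn.encode]))
        (hin 4 (by simp [BasicFn.encode])) (fun S j => ?_) (.inl rfl) (.inr rfl)
        (fun j w e hw => ?_) hF hA
      · simp [Fin.ext_iff]
      · simp only [Fin.val_succ]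
        by_cases he : e = j + 1
        · right
          rcases hw.1 with h1 | h1
          · exact .inl ⟨h1, he⟩
          · exact .inr ⟨h1, he⟩
        · exact .inl ⟨hw.1, hw.2.1, by omega⟩
    · rintro t s' ⟨h1, h2⟩
      refine ⟨h1, ?_⟩
      simp only [RamExpr.cost, summandCost]
      omega

end

/-! ### The algorithm -/

/-- The nodes of the variable in `rI` begin after `rI * (rK + 1)`. -/
def baseBody : RamProg := .block [
  .store aBase (.var rI) (.var rW),
  .assign rW (.add (.var rW) (.add (.var rK) (.const 1))),
  .assign rI (.add (.var rI) (.const 1))]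

/-- One round of the loop that reads the summands. -/
def readBody : RamProg := .block [summandProg, .assign rI (.add (.var rI) (.const 1))]

/-- The network is built from the input. -/
def readProg : RamProg := .block [
  .while (.lt (.var rI) (.var rN)) baseBody,
  .assign rI (.const 0),
  .while (.lt (.var rI) (.var rM)) readBody]

/-- The cost of reading the input. -/
def readCost : ℕ := 500

section

variable {k n : ℕ} {I : List (BasicFn k n)} {s : RamState}

theorem sumCut_append (I J : List (BasicFn k n)) (S : Finset ℕ) :
    sumCut (I ++ J) S = sumCut I S + sumCut J S := by
  simp [sumCut]

theorem run_baseLoop (hk : s.var rK = k) (hn : s.var rN = n) (hI : s.var rI = 0)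
    (hW : s.var rW = 0) :
    Run (.while (.lt (.var rI) (.var rN)) baseBody) s fun t s' =>
      (∀ v < n, s'.arr aBase v = v * (k + 1)) ∧ t ≤ 20 * (n + 1) := by
  refine (Run.while (fun t s' => RamProg.Frame baseBody s s' ∧ s'.var rI ≤ n ∧
      s'.var rW = s'.var rI * (k + 1) ∧ (∀ v < s'.var rI, s'.arr aBase v = v * (k + 1)) ∧
      t ≤ 20 * s'.var rI) (20 * n) (fun t s' h => ?_)
      ⟨.refl _ _, by omega, by rw [hI, hW, zero_mul], fun v hv => by omega, by omega⟩ ?_).mono ?_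
  · obtain ⟨-, h1, -, -, h2⟩ := h
    omega
  · rintro t s₁ ⟨hf, h1, h2, h3, ht⟩ hcond
    have hn₁ : s₁.var rN = n :=
      (hf.var _ (by simp [baseBody, RamProg.modVar, RamProg.block])).trans hn
    have hk₁ : s₁.var rK = k :=
      (hf.var _ (by simp [baseBody, RamProg.modVar, RamProg.block])).trans hk
    rw [Ne, RamExpr.eval_lt_eq_zero] at hcond
    simp only [RamExpr.eval] at hcond
    refine (Run.straight (P := baseBody) rfl (Q := fun t' s' => s' = baseBody.run s₁ ∧
      t' ≤ baseBody.bound) fun t' ht' => ⟨rfl, ht'⟩).frame.mono ?_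
    rintro t' s₂ ⟨⟨hs₂, ht'⟩, hf₂⟩
    have hb : t' ≤ 16 := ht'.trans (by decide)
    have hI₂ : s₂.var rI = s₁.var rI + 1 := by
      simp [hs₂, baseBody, RamProg.block, RamProg.run, RamExpr.eval]
    have hW₂ : s₂.var rW = s₁.var rW + (k + 1) := by
      simp [hs₂, baseBody, RamProg.block, RamProg.run, RamExpr.eval, hk₁]
    have hB₂ : s₂.arr aBase = Function.update (s₁.arr aBase) (s₁.var rI) (s₁.var rW) := by
      simp [hs₂, baseBody, RamProg.block, RamProg.run, RamExpr.eval]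
    refine ⟨⟨fun x hx => by rw [hf₂.var x hx, hf.var x hx],
      fun x hx => by rw [hf₂.arr x hx, hf.arr x hx]⟩, by omega, ?_, fun v hv => ?_, ?_⟩
    · rw [hW₂, hI₂, h2]; ring
    · rw [hB₂]
      by_cases hvI : v = s₁.var rI
      · rw [hvI, Function.update_self, h2]
      · rw [Function.update_of_ne hvI, h3 v (by omega)]
    · simp only [RamExpr.cost]
      omega
  · rintro t s₁ ⟨hcond, t', rfl, hf, h1, h2, h3, ht⟩
    have hn₁ : s₁.var rN = n :=
      (hf.var _ (by simp [baseBody, RamProg.modVar, RamProg.block])).trans hn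
    rw [RamExpr.eval_lt_eq_zero] at hcond
    simp only [RamExpr.eval] at hcond
    refine ⟨fun v hv => h3 v (by omega), ?_⟩
    simp only [RamExpr.cost]
    omega

/-- The network of the first summands `J` has been built. -/
structure Reading (I J : List (BasicFn k n)) (s : RamState) : Prop where
  built : Built k n (sumCut J) s
  full : (Network.ofState s).IsFull k
  size : s.var rH ≤ 4 * k * J.length
  pos : s.var rP = (J.flatMap BasicFn.encode).length
  input : s.arr aIn = fun i => (I.flatMap BasicFn.encode).getD i 0

theorem run_readLoop (hR : Reading I [] s) (hk : s.var rK = k) (hm : s.var rM = I.length)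
    (hI : s.var rI = 0) :
    Run (.while (.lt (.var rI) (.var rM)) readBody) s fun t s' =>
      Reading I I s' ∧ t ≤ 420 * ((k + 1) * I.length) + 4 := by
  refine (Run.while (fun t s' => RamProg.Frame readBody s s' ∧ ∃ J J', I = J ++ J' ∧
      Reading I J s' ∧ s'.var rI = J.length ∧ t ≤ 420 * ((k + 1) * J.length))
      (420 * ((k + 1) * I.length)) ?_ ⟨.refl _ _, [], I, rfl, hR, hI, by simp⟩ ?_).mono ?_
  · rintro t s' ⟨-, J, J', hJ, -, -, h⟩
    have : J.length ≤ I.length := by rw [hJ, List.length_append]; omega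
    exact h.trans (by gcongr)
  · rintro t s₁ ⟨hf, J, J', hJ, h, hI₁, ht⟩ hcond
    have hm₁ : s₁.var rM = I.length :=
      (hf.var _ (by decide)).trans hm
    have hk₁ : s₁.var rK = k :=
      (hf.var _ (by decide)).trans hk
    rw [Ne, RamExpr.eval_lt_eq_zero] at hcond
    simp only [RamExpr.eval] at hcond
    rcases J' with _ | ⟨g, J'⟩
    · rw [List.append_nil] at hJ
      rw [hJ] at hm₁
      omega
    have hin : ∀ j, j < g.encode.length → s₁.arr aIn (s₁.var rP + j) = g.encode.getD j 0 := by
      intro j hj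
      rw [h.input, h.pos, hJ]
      simp only [List.flatMap_append, List.flatMap_cons]
      rw [List.getD_append_right _ _ _ _ (by omega), Nat.add_sub_cancel_left,
        List.getD_append _ _ _ _ hj]
    refine (Run.frame (Q := fun t' s' => Reading I (J ++ [g]) s' ∧ s'.var rI = s₁.var rI + 1 ∧
      t' ≤ 410 * (k + 1)) ?_).mono ?_
    · refine Run.block_cons ((run_summandProg g hin h.built h.full hk₁).frame.mono ?_)
      rintro t₂ s₂ ⟨⟨hA, ht₂⟩, hf₂⟩
      refine Run.block_straight rfl fun t₃ ht₃ => Run.block_nil ⟨⟨?_, hA.full, ?_, ?_, ?_⟩, ?_, ?_⟩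
      · refine Built.congr (s := RamProg.run _ s₂) ⟨hA.built.wf, hA.built.cut, hA.built.layout,
          hA.built.base⟩ fun S => ?_
        rw [sumCut_append]
        simp [sumCut]
      · have h1 := hA.size
        have h2 := h.size
        rw [List.length_append, List.length_singleton, Nat.mul_succ]
        change s₂.var rH ≤ _
        omega
      · have h1 := hA.pos
        have h2 := h.pos
        simp only [List.flatMap_append, List.length_append, List.flatMap_cons, List.flatMap_nil,
          List.append_nil]
        change s₂.var rP = _
        omega
      · exact hA.input.trans h.input
      · change s₂.var rI + 1 = _
        rw [hf₂.var _ (by decide)]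
      · have hb₃ : t₃ ≤ 4 := ht₃.trans (by decide)
        simp only [summandCost] at ht₂
        omega
    · rintro t₂ s₂ ⟨⟨hR₂, hI₂, ht₂⟩, hf₂⟩
      refine ⟨⟨fun x hx => by rw [hf₂.var x hx, hf.var x hx],
        fun x hx => by rw [hf₂.arr x hx, hf.arr x hx]⟩, J ++ [g], J', by simp [hJ], hR₂, ?_, ?_⟩
      · rw [hI₂, hI₁]; simp
      · rw [List.length_append, List.length_singleton, Nat.mul_succ, Nat.mul_add]
        simp only [RamExpr.cost]
        omega
  · rintro t s₁ ⟨hcond, t', rfl, hf, J, J', hJ, h, hI₁, ht⟩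
    have hm₁ : s₁.var rM = I.length :=
      (hf.var _ (by decide)).trans hm
    rw [RamExpr.eval_lt_eq_zero] at hcond
    simp only [RamExpr.eval] at hcond
    obtain rfl : J' = [] := by
      rw [hJ, List.length_append] at hm₁
      exact List.length_eq_zero_iff.1 (by omega)
    rw [List.append_nil] at hJ
    subst hJ
    refine ⟨h, ?_⟩
    simp only [RamExpr.cost]
    omega

theorem run_readProg (I : List (BasicFn k n)) :
    Run readProg (initState I) fun t s => Reading I I s ∧
      t ≤ readCost * ((k + 1) * I.length + n + 1) := by
  refine Run.block_cons ((run_baseLoop (k := k) (n := n) (s := initState I) rfl rfl rfl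
    rfl).frame.mono ?_)
  rintro t₁ s₁ ⟨⟨hbase, ht₁⟩, hf⟩
  refine Run.block_straight rfl fun t₂ ht₂ => ?_
  have hb₂ : t₂ ≤ 2 := ht₂.trans (by decide)
  have hv : ∀ x, x ≠ rI → x ≠ rW → s₁.var x = (initState I).var x := fun x h1 h2 =>
    hf.var x (by simp [baseBody, RamProg.modVar, RamProg.block, *])
  have ha : ∀ a, a ≠ aBase → s₁.arr a = (initState I).arr a := fun a h1 =>
    hf.arr a (by simp [baseBody, RamProg.modArr, RamProg.block, *])
  have h0 : ∀ a, a ≠ aIn → a ≠ aBase → ∀ i, s₁.arr a i = 0 := fun a h1 h2 i => by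
    rw [ha a h2]; simp [initState, h1]
  have hH : s₁.var rH = 0 := (hv _ (by decide) (by decide)).trans rfl
  have hnode : ∀ x, ¬ (Network.ofState s₁).IsNode x := by
    rintro x ⟨h, ⟨h1, h2⟩, -⟩
    change h ≤ s₁.var rH at h2
    omega
  refine Run.block_cons ((run_readLoop (I := I) (s := RamProg.run (.assign rI (.const 0)) s₁)
    ⟨⟨?_, fun S => ?_, fun x hx => absurd hx (hnode x), hbase⟩, ?_, ?_, ?_, ?_⟩
    (hv _ (by decide) (by decide)) (hv _ (by decide) (by decide)) rfl).mono ?_)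
  · exact Network.Wf.empty _ hH (h0 aHead (by decide) (by decide)) (h0 aSrc (by decide) (by decide))
      (h0 aSnk (by decide) (by decide))
  · change (Network.ofState s₁).cut _ S = 0
    have e1 : (Network.ofState s₁).size = 0 := hH
    rw [Network.cut, e1, Finset.sum_eq_zero fun h hh => ?_, Finset.sum_eq_zero fun u _ => ?_,
      add_zero]
    · have e2 : (Network.ofState s₁).src u = 0 := h0 aSrc (by decide) (by decide) u
      have e3 : (Network.ofState s₁).snk u = 0 := h0 aSnk (by decide) (by decide) u
      simp [Network.nodeCut, e2, e3]
    · simp at hh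
  · exact fun v a b _ _ _ _ h => absurd h (hnode _)
  · change s₁.var rH ≤ _
    omega
  · exact (hv _ (by decide) (by decide)).trans rfl
  · exact (ha _ (by decide)).trans rfl
  · rintro t₃ s₃ ⟨hR, ht₃⟩
    refine Run.block_nil ⟨hR, ?_⟩
    simp only [readCost]
    omega

/-- A variable without nodes gets the value `1`. -/
def finishBody : RamProg := .block [
  .ite (.get aHead (.add (.get aBase (.var rI)) (.const 1))) .skip
    (.store aOut (.var rI) (.const 1)),
  .assign rI (.add (.var rI) (.const 1))]

/-- The variables without nodes get the value `1`. -/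
def finishProg : RamProg := .block [
  .assign rI (.const 0),
  .while (.lt (.var rI) (.var rN)) finishBody]

theorem run_finishProg (hn : s.var rN = n) (hbase : ∀ v < n, s.arr aBase v = v * (k + 1)) :
    Run finishProg s fun t s' =>
      (∀ v < n, s'.arr aOut v = if s.arr aHead (node k v 1) = 0 then 1 else s.arr aOut v) ∧
      t ≤ 30 * (n + 1) := by
  refine Run.block_straight rfl fun t₁ ht₁ => ?_
  have hb₁ : t₁ ≤ 2 := ht₁.trans (by decide)
  clear ht₁
  set s₁ := RamProg.run _ s with hs₁
  have hn₁ : s₁.var rN = n := hn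
  have hI₁ : s₁.var rI = 0 := rfl
  have harr₁ : s₁.arr = s.arr := rfl
  clear_value s₁
  refine Run.block_cons ((Run.while (fun t s' => RamProg.Frame finishBody s₁ s' ∧ s'.var rI ≤ n ∧
      (∀ v < s'.var rI, s'.arr aOut v =
        if s.arr aHead (node k v 1) = 0 then 1 else s.arr aOut v) ∧
      (∀ v, s'.var rI ≤ v → s'.arr aOut v = s.arr aOut v) ∧
      t ≤ 25 * s'.var rI) (25 * n) (fun t s' h => ?_)
      ⟨.refl _ _, by omega, fun v hv => by omega, fun v _ => by rw [harr₁], by omega⟩ ?_).mono ?_)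
  · obtain ⟨-, h1, -, -, h2⟩ := h
    omega
  · rintro t s₂ ⟨hf, h1, h2, h3, ht⟩ hcond
    have hn₂ : s₂.var rN = n := (hf.var _ (by decide)).trans hn₁
    have hbase₂ : s₂.arr aBase = s.arr aBase := (hf.arr _ (by decide)).trans (by rw [harr₁])
    have hhead₂ : s₂.arr aHead = s.arr aHead := (hf.arr _ (by decide)).trans (by rw [harr₁])
    rw [Ne, RamExpr.eval_lt_eq_zero] at hcond
    simp only [RamExpr.eval] at hcond
    refine (Run.straight (P := finishBody) rfl (Q := fun t' s' => s' = finishBody.run s₂ ∧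
      t' ≤ finishBody.bound) fun t' ht' => ⟨rfl, ht'⟩).frame.mono ?_
    rintro t' s₃ ⟨⟨hs₃, ht'⟩, hf₃⟩
    have hb : t' ≤ 18 := ht'.trans (by decide)
    have hx : s.arr aBase (s₂.var rI) + 1 = node k (s₂.var rI) 1 := by
      rw [hbase _ (by omega), node]
    have hI₃ : s₃.var rI = s₂.var rI + 1 := by
      by_cases h : s.arr aHead (node k (s₂.var rI) 1) = 0 <;>
      simp [hs₃, finishBody, RamProg.block, RamProg.run, RamExpr.eval, hbase₂, hhead₂, hx, h]
    have hout₃ : s₃.arr aOut = if s.arr aHead (node k (s₂.var rI) 1) = 0 then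
        Function.update (s₂.arr aOut) (s₂.var rI) 1 else s₂.arr aOut := by
      by_cases h : s.arr aHead (node k (s₂.var rI) 1) = 0 <;>
      simp [hs₃, finishBody, RamProg.block, RamProg.run, RamExpr.eval, hbase₂, hhead₂, hx, h]
    refine ⟨⟨fun x hx => by rw [hf₃.var x hx, hf.var x hx],
      fun x hx => by rw [hf₃.arr x hx, hf.arr x hx]⟩, by omega, fun v hv => ?_, fun v hv => ?_, ?_⟩
    · rw [hout₃]
      by_cases hvI : v = s₂.var rI
      · subst hvI
        split_ifs with h
        · rw [Function.update_self]
        · exact h3 _ le_rfl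
      · rw [← h2 v (by omega)]
        split_ifs
        · rw [Function.update_of_ne hvI]
        · rfl
    · rw [hout₃, ← h3 v (by omega)]
      split_ifs
      · rw [Function.update_of_ne (by omega)]
      · rfl
    · simp only [RamExpr.cost]
      omega
  · rintro t s₂ ⟨hcond, t', rfl, hf, h1, h2, h3, ht⟩
    have hn₂ : s₂.var rN = n := (hf.var _ (by decide)).trans hn₁
    rw [RamExpr.eval_lt_eq_zero] at hcond
    simp only [RamExpr.eval] at hcond
    refine Run.block_nil ⟨fun v hv => h2 v (by omega), ?_⟩
    simp only [RamExpr.cost]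
    omega

/-- The nodes are recognized by their chains of outgoing arcs. -/
theorem Network.IsAdj.head_ne_zero_iff {N : Network} (hN : N.IsAdj) (x : ℕ) :
    N.head x ≠ 0 ↔ N.IsNode x := by
  constructor
  · intro h
    have ha : N.IsArc (N.head x) := ⟨by omega, hN.head_le x⟩
    exact ⟨_, hN.mate_mem _ ha, hN.frm_head x h⟩
  · rintro ⟨h, hh, rfl⟩
    have h1 := hN.le_head _ (hN.mate_mem h hh)
    have h2 := (hN.mate_mem h hh).1
    rw [hN.frm_mate hh] at h1
    omega

/-- When all nodes are settled, the assigned nodes give an extreme minimum solution, with any nonzero values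
for the variables without nodes. -/
theorem exists_isExtremeMinSol_of_assigned {N : Network} {r : ℕ} {vr vl out snk out' : ℕ → ℕ}
    {B S : Finset ℕ} (hk : 1 ≤ k) (hN : Represents N I r) (hL : N.Layout k n vr vl)
    (hfull : N.IsFull k) (hA : Assigned N k n vr vl out snk B S) (hB : ∀ x, N.IsNode x → x ∈ B)
    (hsrc : ∀ u, N.src u ≠ 0 → u ∈ S)
    (hout : ∀ v < n, out' v = if N.head (node k v 1) = 0 then 1 else out v) :
    ∃ φ : Fin n → Fin (k + 1), (∀ v, out' (v : Fin n) = φ v) ∧ IsExtremeMinSol (sumFn I) φ := by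
  have hhead := hN.wf.toIsAdj.head_ne_zero_iff
  have hSL : ∀ v, out v ≠ 0 → node k v (out v) ∈ S ∧ out v ≤ k := fun v hv => by
    obtain ⟨x, hx, h1, h2⟩ := hA.outval v hv
    obtain ⟨h3, -, h4, -⟩ := hL x (hA.node x (hA.sub hx))
    rw [h1, h2] at h3
    exact ⟨h3 ▸ hx, h2 ▸ h4⟩
  have hle : ∀ v < n, out' v < k + 1 := fun v hv => by
    rw [hout v hv]
    split_ifs
    · omega
    · by_cases h0 : out v = 0
      · omega
      · have := (hSL v h0).2
        omega
  refine ⟨fun v => ⟨out' v, hle v v.2⟩, fun v => rfl, ?_⟩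
  set φ : Fin n → Fin (k + 1) := fun v => ⟨out' v, hle v v.2⟩ with hφ
  have htouch : ∀ v : Fin n, ∀ a, 1 ≤ a → a ≤ k → N.IsNode (node k v a) → out' v = out v :=
    fun v a h1 h2 h => by
      rw [hout v v.2, if_neg ((hhead _).2 (hfull v a 1 h1 h2 le_rfl hk h))]
  have hval : ∀ v, (φ v : ℕ) = out' v := fun v => rfl
  have hsub : S ⊆ nodeSet φ := fun x hx => by
    have hxn := hA.node x (hA.sub hx)
    obtain ⟨h1, h2, h3, h4⟩ := hL x hxn
    have h5 := (hA.mem_iff x hxn).1 hx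
    rw [h1] at hxn
    have h6 := htouch ⟨vr x, h4⟩ _ h2 h3 hxn
    have h7 : (φ ⟨vr x, h4⟩ : ℕ) = vl x := h6.trans h5
    refine mem_nodeSet_iff.2 ⟨⟨vr x, h4⟩, fun h => ?_, ?_⟩
    · rw [h] at h7
      simp at h7
      omega
    · rw [h7, h1.symm]
  have hback : ∀ x ∈ nodeSet φ, N.IsNode x → x ∈ S := fun x hx hxn => by
    obtain ⟨v, hv, rfl⟩ := mem_nodeSet_iff.1 hx
    have h1 : (φ v : ℕ) ≠ 0 := fun h => hv (Fin.ext h)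
    have h2 := htouch v _ (by omega) (by omega) hxn
    rw [hval, h2] at h1 ⊢
    exact (hSL v h1).1
  refine hN.isExtremeMinSol ⟨fun u hu => hsub (hsrc u hu), fun u hu => ?_, fun u hu w huw => ?_⟩
    fun ψ hψ hsubψ v hv => ?_
  · by_contra hne
    exact hA.snk_mono u hne (hA.snk_zero u (hback u hu (hN.wf.snk_node u hne)))
  · have hun : N.IsNode u := by
      obtain ⟨h, hh, rfl, -⟩ := huw
      exact ⟨N.mate h, hN.wf.mate_mem h hh, rfl⟩
    exact hsub (hA.edge u (hback u hu hun) w huw)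
  · have hv0 : out' v = 0 := by rw [← hval, hv]; rfl
    have hnode : N.IsNode (node k v 1) := by
      rw [← hhead]
      intro h
      rw [hout v v.2, if_pos h] at hv0
      omega
    by_contra hne
    have h1 : (ψ v : ℕ) ≠ 0 := fun h => hne (Fin.ext h)
    have hxn := hfull v 1 (ψ v) le_rfl hk (by omega) (by omega) hnode
    have hxψ : node k v (ψ v) ∈ nodeSet ψ := mem_nodeSet_iff.2 ⟨v, hne, rfl⟩
    rcases hA.cover _ (hB _ hxn) with hxS | hxs
    · obtain ⟨w, hw, heq⟩ := mem_nodeSet_iff.1 (hsub hxS)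
      obtain ⟨h2, -⟩ := node_inj (by omega) (by omega) heq
      rw [Fin.ext h2] at hw
      exact hw hv
    · exact hA.fail _ hxs ψ hψ (hsub.trans hsubψ) hxψ

end

/-- The algorithm. For `k = 0` the output array is correct from the start. -/
def mainProg : RamProg :=
  .ite (.var rK) (.block [readProg, augmentProg, secondProg, finishProg]) .skip

theorem frame_augmentProg {s s' : RamState} (h : RamProg.Frame augmentProg s s') :
    (∀ a, a ∈ [aOut, aBase, aDst, aHead, aVar, aVal] → s'.arr a = s.arr a) ∧
      s'.var rN = s.var rN := by
  refine ⟨fun a ha => h.arr a ?_, h.var _ (by decide)⟩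
  simp only [List.mem_cons, List.not_mem_nil, or_false] at ha
  rcases ha with rfl | rfl | rfl | rfl | rfl | rfl <;> decide

theorem frame_secondProg {s s' : RamState} (h : RamProg.Frame secondProg s s') :
    (∀ a, a ∈ [aBase, aHead] → s'.arr a = s.arr a) ∧ s'.var rN = s.var rN := by
  refine ⟨fun a ha => h.arr a ?_, h.var _ (by decide)⟩
  simp only [List.mem_cons, List.not_mem_nil, or_false] at ha
  rcases ha with rfl | rfl <;> decide

theorem Built.represents {k n : ℕ} {I : List (BasicFn k n)} {s : RamState}
    (h : Built k n (sumCut I) s) : Represents (Network.ofState s) I 0 where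
  wf := h.wf
  cut S := by rw [h.cut]; simp
  isNode e he := by
    obtain ⟨h1, h2, h3, h4⟩ := h.layout _ ⟨e, he, rfl⟩
    refine ⟨⟨_, h4⟩, ⟨s.arr aVal ((Network.ofState s).dst e) - 1, by omega⟩, ?_⟩
    refine h1.trans ?_
    congr 1
    simp only [Fin.succ_mk]
    omega

/-- The number of steps until the end, from the numbers of steps of the phases. -/
theorem time_le {k n m T R : ℕ} {μ : ℚ} (hk : 1 ≤ k) (hμ : 1 ≤ μ)
    (hR : (R : ℚ) ≤ 2 * μ) (hR0 : m = 0 → R = 0)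
    (hT : T ≤ 500 * ((k + 1) * m + n + 1) + 3700 * (4 * k * m + 1) * (R + 1) + 30 * (n + 1) + 10) :
    (T : ℚ) ≤ 60000 * (μ * k * m + n + 1) := by
  have hkm : (k + 1) * m ≤ 2 * (k * m) := by nlinarith
  have hT' : T ≤ 500 * (2 * (k * m) + n + 1) + 3700 * (4 * (k * m) + 1) * (R + 1) + 30 * (n + 1) + 10 := by
    rw [mul_assoc 4] at hT
    have : 500 * ((k + 1) * m + n + 1) ≤ 500 * (2 * (k * m) + n + 1) := by omega
    linarith
  have hTq : (T : ℚ) ≤ 500 * (2 * (k * m) + n + 1) + 3700 * (4 * (k * m) + 1) * (R + 1) +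
      30 * (n + 1) + 10 := by
    have := (Nat.cast_le (α := ℚ)).2 hT'
    push_cast at this
    exact this
  by_cases h0 : m = 0
  · rw [hR0 h0, h0] at hTq
    rw [h0]
    push_cast at hTq ⊢
    have : (0 : ℚ) ≤ n := Nat.cast_nonneg n
    linarith
  · have hkm1 : 1 ≤ k * m := Nat.mul_pos hk (by omega)
    have hx : (1 : ℚ) ≤ k * m := by exact_mod_cast hkm1
    have hn : (0 : ℚ) ≤ n := Nat.cast_nonneg n
    rw [mul_assoc μ]
    set x : ℚ := k * m with hxdef
    have h1 : x ≤ μ * x := le_mul_of_one_le_left (by linarith) hμ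
    have h2 : (4 * x + 1) * (R + 1) ≤ (5 * x) * (3 * μ) := by
      gcongr <;> linarith
    nlinarith

theorem run_mainProg {k n : ℕ} (hk : 1 ≤ k) (I : List (BasicFn k n)) :
    Run mainProg (initState I) fun t s => ∃ φ : Fin n → Fin (k + 1), Outputs s φ ∧
      IsExtremeMinSol (sumFn I) φ ∧
      (t : ℚ) ≤ 60000 * (max 1 (minVal (sumFn I)) * k * I.length + n + 1) := by
  have hmin : ∃ χ : Fin n → Fin (k + 1), minVal (sumFn I) = sumFn I χ := by
    obtain ⟨χ, -, h⟩ := Finset.exists_mem_eq_inf' (Finset.univ_nonempty) (sumFn I)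
    exact ⟨χ, h⟩
  obtain ⟨χ, hχ⟩ := hmin
  refine Run.iteTrue (by simp [RamExpr.eval, initState]; omega) (Run.block_cons
    ((run_readProg I).frame.mono ?_))
  rintro t₁ s₁ ⟨⟨hR, ht₁⟩, hf₁⟩
  have hN := hR.built.represents
  have harr : ∀ a, a ∉ readProg.modArr → a ≠ aIn → s₁.arr a = fun _ => 0 := fun a h1 h2 => by
    rw [hf₁.arr a h1]
    funext i
    simp [initState, h2]
  have hout₁ : s₁.arr aOut = fun _ => 0 := harr _ (by decide) (by decide)
  have hn₁ : s₁.var rN = n := (hf₁.var _ (by decide)).trans rfl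
  set R := ⌊2 * minVal (sumFn I)⌋₊ with hRdef
  refine Run.block_cons ((run_augmentProg (R := R) hN rfl ((hf₁.var _ (by decide)).trans rfl)
    (fun x => by rw [harr aVis (by decide) (by decide)]; exact Nat.zero_le _)
    fun N' r' hN' => Nat.le_floor (by rw [hχ]; exact hN'.le_two_mul_sumFn χ)).frame.mono ?_)
  rintro t₂ s₂ ⟨⟨N, r, hN₂, hS₂, hsize, htgt, ht₂⟩, hf₂⟩
  obtain ⟨ha₂, hn₂⟩ := frame_augmentProg hf₂
  have hdst : N.dst = (Network.ofState s₁).dst := by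
    rw [← hS₂.net]; exact ha₂ aDst (by simp)
  have hhead : N.head = s₁.arr aHead := by
    rw [← hS₂.net]; exact ha₂ aHead (by simp)
  have hnode : ∀ x, N.IsNode x ↔ (Network.ofState s₁).IsNode x := fun x => by
    simp only [Network.IsNode, Network.IsArc, hsize, hdst]
  have hL : N.Layout k n (s₁.arr aVar) (s₁.arr aVal) := fun x hx =>
    hR.built.layout x ((hnode x).1 hx)
  have hfull : N.IsFull k := fun v a b h1 h2 h3 h4 h =>
    (hnode _).2 (hR.full v a b h1 h2 h3 h4 ((hnode _).1 h))
  refine Run.block_cons ((run_secondProg hN₂ hL hS₂ htgt (ha₂ aVar (by simp)) (ha₂ aVal (by simp))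
    ((ha₂ aOut (by simp)).trans hout₁)).frame.mono ?_)
  rintro t₃ s₃ ⟨⟨⟨S, B, hSsrc, hB, hA⟩, ht₃⟩, hf₃⟩
  obtain ⟨ha₃, hn₃⟩ := frame_secondProg hf₃
  refine Run.block_cons ((run_finishProg (k := k) (n := n) (by rw [hn₃, hn₂, hn₁]) fun v hv => by
    rw [ha₃ _ (by simp), ha₂ _ (by simp), hR.built.base v hv]).mono ?_)
  rintro t₄ s₄ ⟨hout₄, ht₄⟩
  rw [ha₃ _ (by simp), ha₂ _ (by simp), ← hhead] at hout₄
  obtain ⟨φ, hφ, hext⟩ := exists_isExtremeMinSol_of_assigned hk hN₂ hL hfull hA hB hSsrc hout₄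
  refine Run.block_nil ⟨φ, hφ, hext, ?_⟩
  have hnil : I.length = 0 → minVal (sumFn I) = 0 := fun h => by
    rw [hχ, List.length_eq_zero_iff.1 h]
    simp [sumFn]
  refine time_le (R := R) hk (le_max_left _ _) ?_ (fun h => ?_) ?_
  · have h0 : (0 : ℚ) ≤ 2 * minVal (sumFn I) := by
      rw [hχ]; exact (Nat.cast_nonneg r).trans (hN₂.le_two_mul_sumFn χ)
    refine (Nat.floor_le h0).trans ?_
    have := le_max_right 1 (minVal (sumFn I))
    linarith
  · rw [hRdef, hnil h]; simp
  · have hsz : N.size ≤ 4 * k * I.length := by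
      rw [hsize]; exact hR.size
    have e0 : (Network.ofState s₁).size = N.size := hsize.symm
    rw [e0] at ht₂
    have e1 : (N.size + 1) * (R + 1) ≤ (4 * k * I.length + 1) * (R + 1) := by gcongr
    have e2 : N.size + 1 ≤ (4 * k * I.length + 1) * (R + 1) := le_trans (by omega)
      (Nat.le_mul_of_pos_right (4 * k * I.length + 1) (Nat.succ_pos R))
    simp only [augmentCost, secondCost, readCost, mul_assoc 700, mul_assoc 3700] at ht₁ ht₂ ht₃ ⊢
    simp only [RamExpr.cost]
    omega

theorem mainTheorem4 :
    ∃ (P : RamProg) (C : ℕ), ∀ (k n : ℕ) (I : List (BasicFn k n)),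
      ∃ (t : ℕ) (s : RamState) (φ : Fin n → Fin (k + 1)),
        RamExec P (initState I) t s ∧
        Outputs s φ ∧
        IsExtremeMinSol (sumFn I) φ ∧
        (t : ℚ) ≤ C * (max 1 (minVal (sumFn I)) * k * I.length + n + 1) := by
  refine ⟨mainProg, 60000, fun k n I => ?_⟩
  rcases Nat.eq_zero_or_pos k with rfl | hk
  · -- there is only one assignment, and the output array holds it from the start
    have hsub : ∀ φ ψ : Fin n → Fin (0 + 1), φ = ψ := fun φ ψ =>
      funext fun v => Subsingleton.elim (α := Fin 1) _ _
    refine ⟨_, _, fun _ => 0, .iteFalse (by simp [RamExpr.eval, initState]) (.skip _), fun v => rfl,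
      ⟨fun ψ => (congrArg _ (hsub _ _)).le, ?_⟩, ?_⟩
    · rintro ⟨ψ, -, h, -⟩
      exact h (hsub _ _)
    · have : (0 : ℚ) ≤ n := Nat.cast_nonneg n
      simp only [RamExpr.cost]
      push_cast
      linarith
  · obtain ⟨t, s, hx, φ, h1, h2, h3⟩ := run_mainProg hk I
    exact ⟨t, s, φ, hx, h1, h2, by exact_mod_cast h3⟩
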